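/- (Birkhoff–Grothendieck theorem) Let $E$ be a holomorphic vector bundle of rank $n$ over the Riemann sphere $\mathbb P^1=\mathbb P^1(\mathbb C)$, let $\mathcal O$ and $\mathcal M$ be the sheaves of holomorphic and of meromorphic functions on $\mathbb P^1$, let $\mathcal E$ be the sheaf of holomorphic sections of $E$, and let $\mathcal V=\mathcal E\otimes_{\mathcal O}\mathcal M$ be the sheaf of meromorphic sections of $E$. Let $H$ be the set of $\mathcal O$-submodules $\mathcal F\subset\mathcal V$ that are locally isomorphic to $\mathcal O^n$ (so that $\mathcal E\in H$). Then every $\mathcal F\in H$ is a direct sum of holomorphic line bundles: there are $\mathcal O$-submodules $\mathcal L_1,\dots,\mathcal L_n\subset\mathcal V$, each locally free of rank $1$, such that $\mathcal F=\mathcal L_1\oplus\cdots\oplus\mathcal L_n$. -/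

import Mathlib

open Topology TopologicalSpace Bundle Filter
open scoped Manifold ContDiff

noncomputable section

/-! ### The Riemann sphere `ℙ¹ = ℂ ∪ {∞}` as a complex manifold -/

namespace RiemannSphere

/-- The map `z ↦ 1/z` of the sphere, exchanging `0` and `∞`. -/
def inversion : OnePoint ℂ → OnePoint ℂ
  | none => ((0 : ℂ) : OnePoint ℂ)
  | some z => if z = 0 then OnePoint.infty else ((z⁻¹ : ℂ) : OnePoint ℂ)

@[simp] theorem inversion_infty : inversion OnePoint.infty = ((0 : ℂ) : OnePoint ℂ) := rfl

@[simp] theorem inversion_zero : inversion ((0 : ℂ) : OnePoint ℂ) = OnePoint.infty :=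
  if_pos rfl

theorem inversion_coe {z : ℂ} (hz : z ≠ 0) :
    inversion (z : OnePoint ℂ) = ((z⁻¹ : ℂ) : OnePoint ℂ) := if_neg hz

theorem inversion_involutive : Function.Involutive inversion := by
  intro x
  induction x using OnePoint.rec with
  | infty => simp
  | coe z =>
    by_cases hz : z = 0
    · subst hz; simp
    · rw [inversion_coe hz, inversion_coe (inv_ne_zero hz), inv_inv]

theorem continuous_inversion : Continuous inversion := by
  rw [continuous_iff_continuousAt]
  intro x
  induction x using OnePoint.rec with
  | infty =>
    rw [OnePoint.continuousAt_infty']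
    have h0 : Tendsto (fun z : ℂ => ((z⁻¹ : ℂ) : OnePoint ℂ)) (coclosedCompact ℂ)
        (𝓝 ((0 : ℂ) : OnePoint ℂ)) := by
      refine (OnePoint.continuous_coe.tendsto 0).comp ?_
      rw [coclosedCompact_eq_cocompact, ← Metric.cobounded_eq_cocompact]
      exact tendsto_inv₀_cobounded
    refine h0.congr' ?_
    have : ∀ᶠ z : ℂ in coclosedCompact ℂ, z ≠ 0 := by
      rw [coclosedCompact_eq_cocompact]
      exact (isCompact_singleton (x := (0 : ℂ))).compl_mem_cocompact
    filter_upwards [this] with z hz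
    exact (inversion_coe hz).symm
  | coe z =>
    rw [OnePoint.continuousAt_coe]
    by_cases hz : z = 0
    · subst hz
      rw [continuousAt_iff_punctured_nhds]
      have h0 : Tendsto (fun z : ℂ => ((z⁻¹ : ℂ) : OnePoint ℂ)) (𝓝[≠] 0)
          (𝓝 (OnePoint.infty : OnePoint ℂ)) := by
        refine OnePoint.tendsto_coe_infty.comp ?_
        rw [coclosedCompact_eq_cocompact, ← Metric.cobounded_eq_cocompact]
        exact tendsto_inv₀_nhdsNE_zero
      have h1 : (inversion ∘ ((↑) : ℂ → OnePoint ℂ)) 0 = OnePoint.infty := inversion_zero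
      rw [h1]
      refine h0.congr' ?_
      filter_upwards [self_mem_nhdsWithin] with z hz
      exact (inversion_coe hz).symm
    · have h0 : ContinuousAt (fun z : ℂ => ((z⁻¹ : ℂ) : OnePoint ℂ)) z :=
        OnePoint.continuous_coe.continuousAt.comp (continuousAt_inv₀ hz)
      refine h0.congr ?_
      filter_upwards [isOpen_ne.mem_nhds hz] with w hw
      exact (inversion_coe hw).symm

/-- `z ↦ 1/z` as a homeomorphism of the sphere. -/
def inversionHomeomorph : OnePoint ℂ ≃ₜ OnePoint ℂ where
  toEquiv := inversion_involutive.toPerm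
  continuous_toFun := continuous_inversion
  continuous_invFun := continuous_inversion

/-- The affine chart `z ↦ z` on `ℂ ⊆ ℙ¹`. -/
def affineChart : OpenPartialHomeomorph (OnePoint ℂ) ℂ :=
  (OnePoint.isOpenEmbedding_coe.toOpenPartialHomeomorph ((↑) : ℂ → OnePoint ℂ)).symm

/-- The chart `z ↦ 1/z` on `ℙ¹ ∖ {0}`. -/
def inftyChart : OpenPartialHomeomorph (OnePoint ℂ) ℂ :=
  inversionHomeomorph.toOpenPartialHomeomorph.trans affineChart

theorem affineChart_source : affineChart.source = {OnePoint.infty}ᶜ := by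
  simp [affineChart, OnePoint.compl_infty]

theorem affineChart_symm (z : ℂ) : affineChart.symm z = (z : OnePoint ℂ) := rfl

theorem affineChart_coe (z : ℂ) : affineChart (z : OnePoint ℂ) = z :=
  affineChart.right_inv (x := z) (by simp [affineChart])

theorem inftyChart_symm (z : ℂ) : inftyChart.symm z = inversion (z : OnePoint ℂ) := rfl

theorem inftyChart_apply (x : OnePoint ℂ) : inftyChart x = affineChart (inversion x) := rfl

instance : ChartedSpace ℂ (OnePoint ℂ) where
  atlas := {affineChart, inftyChart}
  chartAt x := open Classical in if x = OnePoint.infty then inftyChart else affineChart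
  mem_chart_source x := by
    by_cases hx : x = OnePoint.infty
    · subst hx
      simp only [if_true, inftyChart, OpenPartialHomeomorph.trans_source]
      refine ⟨trivial, ?_⟩
      rw [affineChart_source]
      exact OnePoint.coe_ne_infty 0
    · rw [if_neg hx, affineChart_source]
      exact hx
  chart_mem_atlas x := by
    by_cases hx : x = OnePoint.infty <;> simp [hx]

instance : IsManifold 𝓘(ℂ) ω (OnePoint ℂ) := by
  have hinv : ContDiffOn ℂ ω (fun z : ℂ => z⁻¹) {0}ᶜ := fun z hz =>
    (contDiffAt_inv ℂ hz).contDiffWithinAt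
  have key : ∀ z : ℂ, inversion (z : OnePoint ℂ) ≠ OnePoint.infty → z ≠ 0 := by
    rintro z h rfl
    exact h inversion_zero
  apply isManifold_of_contDiffOn
  rintro e e' (rfl | rfl) (rfl | rfl)
  · exact contDiffOn_id.congr fun z _ => affineChart_coe z
  · refine (hinv.mono ?_).congr ?_
    · rintro z ⟨⟨_, _, hz⟩, _⟩
      rw [Set.mem_preimage, affineChart_source] at hz
      exact key z hz
    · rintro z ⟨⟨_, _, hz⟩, _⟩
      rw [Set.mem_preimage, affineChart_source] at hz
      change affineChart (inversion (z : OnePoint ℂ)) = z⁻¹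
      rw [inversion_coe (key z hz), affineChart_coe]
  · refine (hinv.mono ?_).congr ?_
    · rintro z ⟨⟨_, hz⟩, _⟩
      rw [Set.mem_preimage, affineChart_source] at hz
      exact key z hz
    · rintro z ⟨⟨_, hz⟩, _⟩
      rw [Set.mem_preimage, affineChart_source] at hz
      change affineChart (inversion (z : OnePoint ℂ)) = z⁻¹
      rw [inversion_coe (key z hz), affineChart_coe]
  · refine contDiffOn_id.congr fun z _ => ?_
    change affineChart (inversion (inversion (z : OnePoint ℂ))) = z
    rw [inversion_involutive, affineChart_coe]

end RiemannSphere

/-! ### Holomorphic functions and meromorphic sections -/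

section Sheaves

variable {X : Type} [TopologicalSpace X] [ChartedSpace ℂ X]

/-- `𝒪(U)`: the ring of holomorphic functions on the open set `U`. -/
def holomorphicFunctions (U : Opens X) : Subalgebra ℂ (U → ℂ) where
  carrier := {f | MDifferentiable 𝓘(ℂ) 𝓘(ℂ) f}
  mul_mem' hf hg := MDifferentiable.mul hf hg
  add_mem' hf hg := MDifferentiable.add hf hg
  algebraMap_mem' _ := mdifferentiable_const

variable [IsManifold 𝓘(ℂ) ω X]

theorem holomorphicFunctions_meromorphicAt {U : Opens X} (f : holomorphicFunctions U) (x : U) :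
    MeromorphicAt (fun z => f.1 ((chartAt ℂ x).symm z)) (chartAt ℂ x x) := by
  have : IsManifold 𝓘(ℂ) 1 U := IsManifold.of_le (n := ω) le_top
  have h : MDifferentiableOn 𝓘(ℂ) 𝓘(ℂ) (f.1 ∘ (chartAt ℂ x).symm) (chartAt ℂ x).target :=
    (show MDifferentiable 𝓘(ℂ) 𝓘(ℂ) f.1 from f.2).comp_mdifferentiableOn
      (mdifferentiableOn_atlas_symm (I := 𝓘(ℂ)) (chart_mem_atlas ℂ x))
  rw [mdifferentiableOn_iff_differentiableOn] at h
  exact (h.analyticAt ((chartAt ℂ x).open_target.mem_nhds (mem_chart_target ℂ x))).meromorphicAt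

/-- Restriction of holomorphic functions. -/
def holomorphicFunctions.restrict {W U : Opens X} (h : W ≤ U) :
    holomorphicFunctions U →+* holomorphicFunctions W where
  toFun f := ⟨fun x => f.1 (Set.inclusion h x),
    (show MDifferentiable 𝓘(ℂ) 𝓘(ℂ) f.1 from f.2).comp
      ((contMDiff_inclusion (n := ω) h).mdifferentiable (by simp))⟩
  map_one' := rfl
  map_mul' _ _ := rfl
  map_zero' := rfl
  map_add' _ _ := rfl

variable {n : ℕ} (E : X → Type*) [∀ x, AddCommGroup (E x)] [∀ x, Module ℂ (E x)]

/-- The sections over `U` which vanish on a punctured neighbourhood of every point of `U`, that is,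
outside a closed discrete subset of `U`. -/
def negligibleSections (U : Opens X) : Submodule (holomorphicFunctions U) (∀ x : U, E x) where
  carrier := {s | ∀ x : U, ∀ᶠ y in 𝓝[≠] x, s y = 0}
  add_mem' hs ht x := by
    filter_upwards [hs x, ht x] with y h1 h2
    rw [Pi.add_apply, h1, h2, add_zero]
  zero_mem' _ := Eventually.of_forall fun _ => rfl
  smul_mem' f s hs x := by
    filter_upwards [hs x] with y h1
    change f.1 y • s y = 0
    rw [h1, smul_zero]

/-- Set-theoretic sections of `E` over `U`, where two sections are identified if they agree outside
a closed discrete subset of `U`. The meromorphic ones form the submodule `meromorphicSections`. -/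
abbrev SectionClasses (U : Opens X) : Type _ := (∀ x : U, E x) ⧸ negligibleSections E U

/-- Restriction of sections to a smaller open set. -/
def restrictSections {W U : Opens X} (h : W ≤ U) :
    (∀ x : U, E x) →ₛₗ[holomorphicFunctions.restrict h] (∀ x : W, E x) where
  toFun s x := s (Set.inclusion h x)
  map_add' _ _ := rfl
  map_smul' _ _ := rfl

/-- Restriction of classes of sections to a smaller open set. -/
def SectionClasses.restrict {W U : Opens X} (h : W ≤ U) :
    SectionClasses E U →ₛₗ[holomorphicFunctions.restrict h] SectionClasses E W :=
  Submodule.mapQ _ _ (restrictSections E h) fun s hs x => by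
    have ht : Tendsto (Set.inclusion h) (𝓝[≠] x) (𝓝[≠] (Set.inclusion h x)) :=
      (continuous_inclusion h).continuousAt.continuousWithinAt.tendsto_nhdsWithin
        fun y hy hxy => hy (Set.inclusion_injective h hxy)
    exact ht.eventually (hs (Set.inclusion h x))

variable (n)
variable [TopologicalSpace (TotalSpace (Fin n → ℂ) E)] [∀ x, TopologicalSpace (E x)]
  [FiberBundle (Fin n → ℂ) E] [VectorBundle ℂ (Fin n → ℂ) E]

/-- The section `s` of the bundle `E` over `U`, read near `x` in the local trivialisation of `E`
at `x`, as a vector-valued function. -/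
def readInTrivialization {U : Opens X} (s : ∀ x : U, E x) (x : U) (y : U) : Fin n → ℂ :=
  (trivializationAt (Fin n → ℂ) E (x : X)).linearMapAt ℂ (y : X) (s y)

/-- Representatives of meromorphic sections of the vector bundle `E` over `U`: set-theoretic
sections which, in local trivialisations and local coordinates, are meromorphic at every point
of `U`. Such a representative may have arbitrary values on a closed discrete set. -/
def preMeromorphicSections (U : Opens X) :
    Submodule (holomorphicFunctions U) (∀ x : U, E x) where
  carrier := {s | ∀ x : U, MeromorphicAt
    (fun z => readInTrivialization n E s x ((chartAt ℂ x).symm z)) (chartAt ℂ x x)}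
  add_mem' hs ht x := by
    refine ((hs x).add (ht x)).congr (Eventually.of_forall fun z => ?_)
    exact (map_add ((trivializationAt (Fin n → ℂ) E (x : X)).linearMapAt ℂ _) _ _).symm
  zero_mem' x := by
    refine (MeromorphicAt.const (0 : Fin n → ℂ) _).congr (Eventually.of_forall fun z => ?_)
    exact (map_zero ((trivializationAt (Fin n → ℂ) E (x : X)).linearMapAt ℂ _)).symm
  smul_mem' f s hs x := by
    refine ((holomorphicFunctions_meromorphicAt f x).smul (hs x)).congr
      (Eventually.of_forall fun z => ?_)
    exact (map_smul ((trivializationAt (Fin n → ℂ) E (x : X)).linearMapAt ℂ _) _ _).symm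

/-- `𝒱(U)`, where `𝒱 = ℰ ⊗ ℳ` is the sheaf of meromorphic sections of the bundle `E`:
the `𝒪(U)`-module of meromorphic sections of `E` over `U`. -/
def meromorphicSections (U : Opens X) :
    Submodule (holomorphicFunctions U) (SectionClasses E U) :=
  (preMeromorphicSections n E U).map (negligibleSections E U).mkQ

/-- Meromorphic sections restrict to meromorphic sections. -/
theorem restrict_mem_meromorphicSections {W U : Opens X} (h : W ≤ U) {s : SectionClasses E U}
    (hs : s ∈ meromorphicSections n E U) :
    SectionClasses.restrict E h s ∈ meromorphicSections n E W := by
  obtain ⟨s, hs, rfl⟩ := hs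
  refine ⟨restrictSections E h s, fun x => ?_, rfl⟩
  let y : U := Set.inclusion h x
  have hU : Nonempty U := ⟨y⟩
  have hW : Nonempty W := ⟨x⟩
  refine MeromorphicAt.congr (hs y) (Filter.Eventually.filter_mono nhdsWithin_le_nhds ?_)
  filter_upwards [(chartAt ℂ x).open_target.mem_nhds (mem_chart_target ℂ x)] with z hz
  have e : (chartAt ℂ y).symm z = Set.inclusion h ((chartAt ℂ x).symm z) :=
    OpenPartialHomeomorph.subtypeRestr_symm_eqOn_of_le (chartAt ℂ (x : X)) hW hU h hz
  change readInTrivialization n E s y ((chartAt ℂ y).symm z) =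
    readInTrivialization n E s y (Set.inclusion h ((chartAt ℂ x).symm z))
  rw [e]

/-- A subsheaf of `𝒪`-modules of the sheaf `𝒱` of meromorphic sections of `E`. -/
structure MeromorphicSubsheaf where
  /-- The module of sections over `U`. -/
  sections (U : Opens X) : Submodule (holomorphicFunctions U) (SectionClasses E U)
  sections_le (U : Opens X) : sections U ≤ meromorphicSections n E U
  restrict_mem {W U : Opens X} (h : W ≤ U) {s : SectionClasses E U} (hs : s ∈ sections U) :
    SectionClasses.restrict E h s ∈ sections W
  mem_of_locally {U : Opens X} {s : SectionClasses E U} (hmer : s ∈ meromorphicSections n E U)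
    (hs : ∀ x ∈ U, ∃ (W : Opens X) (h : W ≤ U), x ∈ W ∧
      SectionClasses.restrict E h s ∈ sections W) : s ∈ sections U

variable {n E}

namespace MeromorphicSubsheaf

/-- `ℱ` is locally isomorphic to `𝒪ʳ`: every point has an open neighbourhood `U` with sections
`e₁, …, e_r` of `𝒱` over `U` whose restrictions to every open `W ⊆ U` form an `𝒪(W)`-basis of
`ℱ(W)`. -/
def IsLocallyFree (F : MeromorphicSubsheaf n E) (r : ℕ) : Prop :=
  ∀ x : X, ∃ (U : Opens X) (e : Fin r → SectionClasses E U), x ∈ U ∧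
    ∀ (W : Opens X) (h : W ≤ U),
      LinearIndependent (holomorphicFunctions W)
        (fun i => SectionClasses.restrict E h (e i)) ∧
      Submodule.span (holomorphicFunctions W)
        (Set.range fun i => SectionClasses.restrict E h (e i)) = F.sections W

/-- The `𝒪`-module `ℱ` is the (internal) direct sum of its submodules `ℒᵢ`. -/
def IsDirectSum {ι : Type} (F : MeromorphicSubsheaf n E) (L : ι → MeromorphicSubsheaf n E) : Prop :=
  ∀ U : Opens X, iSupIndep (fun i => (L i).sections U) ∧ ⨆ i, (L i).sections U = F.sections U

end MeromorphicSubsheaf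

end Sheaves

end

/-! The proof has an analytic half, which produces enough global sections with poles only at
infinity, and an algebraic half, which improves them to a frame.

Analysis. Local frames of the sheaf give a holomorphic cocycle `A` on a finite cover of `ℂ` in which
only one set `D o` is unbounded. A section with polynomial principal part at infinity is sought as a
cut-off sum `∑ ψ k • A m k • t k`, where `t k` is the principal part (for `k = o` only) minus a
Cauchy transform. As the Cauchy transform inverts `∂̄` (`dbar_cauchyTransform`), holomorphy of the
sum becomes a linear integral equation. The cut-offs are arranged so that its kernel is continuous;
the operator is then the identity plus a small operator plus one of finite rank, and its range has
finite codimension (`finite_quotient_range_one_add_toOperator`). Polynomials form an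
infinite-dimensional space, so the equation is solvable for some nonzero polynomial `p`. This is the
usual finiteness of `H¹`, and it gives `HolomorphicCocycle.exists_section`. Taking each standard
basis vector as direction of the pole yields `n` sections which, multiplied by suitable powers of `t
= 1/z`, form a frame at infinity.

Algebra. The determinant of these sections in local frames has finitely many zeros, counted by a
multiset `D`. At a zero `p` some combination of the twisted sections with constant coefficients
vanishes. Dividing it by the local parameter, and substituting it for the section of largest twist
among those involved, lowers that twist and removes one copy of `p` from `D`, without creating zeros
elsewhere (`exists_isTwistedMatrix_det_ne_zero`). When no zero is left, the sections `σ i`, twisted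
at infinity, form a frame of the sheaf near every point, and the sheaf is the direct sum of its
subsheaves of sections lying generically on the lines `ℂ ∙ σ i y` (`exists_isDirectSum`). -/

noncomputable section

/-! ### The Cauchy transform -/

section CauchyTransform

open MeasureTheory Complex

variable {V : Type*} [NormedAddCommGroup V] [NormedSpace ℂ V]

/-- The Wirtinger derivative `∂f/∂z̄`. -/
def dbar (f : ℂ → V) (z : ℂ) : V :=
  (2⁻¹ : ℂ) • (fderiv ℝ f z 1 + I • fderiv ℝ f z I)

/-- The Cauchy transform of `g`, a solution `u` of `∂u/∂z̄ = g`. -/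
def cauchyTransform (g : ℂ → V) (z : ℂ) : V :=
  ∫ w, (Real.pi * (z - w) : ℂ)⁻¹ • g w

/-- In polar coordinates the factor `r` of the area element cancels the singularity `1/r`. -/
theorem locallyIntegrable_inv : LocallyIntegrable (fun w : ℂ => (Real.pi * w : ℂ)⁻¹) := by
  intro x
  refine ⟨Metric.ball 0 (‖x‖ + 1), Metric.isOpen_ball.mem_nhds (by simp), ?_⟩
  have h : IntegrableOn (fun w : ℂ => (fun y : ℝ => (Real.pi * y)⁻¹) ‖w‖)
      (Metric.ball 0 (‖x‖ + 1)) := by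
    rw [integrableOn_fun_norm_addHaar volume (f := fun y : ℝ => (Real.pi * y)⁻¹)]
    have h1 : IntegrableOn (fun _ : ℝ => Real.pi⁻¹) (Set.Ioo 0 (‖x‖ + 1)) :=
      integrableOn_const (by simp)
    refine h1.congr_fun (fun y hy => ?_) measurableSet_Ioo
    have := hy.1.ne'
    simp only [Complex.finrank_real_complex, smul_eq_mul]
    field_simp
    simp
  refine h.mono' (by fun_prop) (Eventually.of_forall fun w => ?_)
  simp [abs_of_pos Real.pi_pos]

/-- As a convolution with a locally integrable kernel, the transform can be differentiated by
differentiating `g` alone. -/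
theorem cauchyTransform_eq_convolution (g : ℂ → V) :
    cauchyTransform g = MeasureTheory.convolution (fun w : ℂ => (Real.pi * w : ℂ)⁻¹) g
      (ContinuousLinearMap.lsmul ℝ ℂ) volume := by
  ext z
  rw [convolution_def, cauchyTransform, ← integral_sub_left_eq_self _ volume z]
  simp

/-- The Cauchy–Pompeiu formula for compactly supported functions. -/
theorem integral_inv_smul_dbar [CompleteSpace V] {g : ℂ → V} (hg : ContDiff ℝ 1 g)
    (hc : HasCompactSupport g) :
    ∫ w : ℂ, w⁻¹ • dbar g w = -(Real.pi : ℂ) • g 0 := by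
  obtain ⟨R, hR⟩ := (hc.fderiv ℝ).isCompact.isBounded.subset_closedBall 0
  have hDg : Continuous (fderiv ℝ g) := hg.continuous_fderiv one_ne_zero
  let e : ℝ → ℂ := fun θ => Real.cos θ + Real.sin θ * I
  have he : Continuous e := by fun_prop
  have hen : ∀ θ, ‖e θ‖ = 1 := fun θ => by
    rw [← Complex.norm_exp_ofReal_mul_I θ, Complex.exp_mul_I]; simp [e]
  have he0 : ∀ θ, e θ ≠ 0 := fun θ h => by simpa [h] using hen θ
  -- `A` is the radial derivative of `g` and `r • B` the angular one. The Jacobian `r` cancels the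
  -- modulus of `w⁻¹`, turning the integrand into `(A + I • B) / 2`. Along each ray `A` integrates
  -- to `-g 0`, and around each circle `B` integrates to zero by periodicity.
  let A : ℝ × ℝ → V := fun p => fderiv ℝ g (p.1 * e p.2) (e p.2)
  let B : ℝ × ℝ → V := fun p => fderiv ℝ g (p.1 * e p.2) (I * e p.2)
  have hzero : ∀ p : ℝ × ℝ, R < |p.1| → fderiv ℝ g (p.1 * e p.2) = 0 := fun p hp => by
    by_contra h
    have := hR (subset_tsupport _ h)
    rw [mem_closedBall_zero_iff, norm_mul, hen, mul_one, Complex.norm_real] at this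
    exact absurd this (not_le.2 hp)
  have hint : ∀ F : ℝ × ℝ → V, Continuous F → (∀ p : ℝ × ℝ, R < |p.1| → F p = 0) →
      IntegrableOn F (Set.Ioi 0 ×ˢ Set.Ioo (-Real.pi) Real.pi) (volume.prod volume) := by
    intro F hF h0
    have : IsCompact (Set.Icc 0 R ×ˢ Set.Icc (-Real.pi) Real.pi) := isCompact_Icc.prod isCompact_Icc
    refine (hF.continuousOn.integrableOn_compact this).of_forall_sdiff_eq_zero
      (measurableSet_Ioi.prod measurableSet_Ioo) fun p hp => h0 p ?_
    by_contra h
    exact hp.2 ⟨⟨le_of_lt hp.1.1, (le_abs_self _).trans (not_lt.1 h)⟩,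
      Set.Ioo_subset_Icc_self hp.1.2⟩
  have hAc : Continuous A := by fun_prop
  have hBc : Continuous B := by fun_prop
  have hA := hint A hAc fun p hp => by simp [A, hzero p hp]
  have hB := hint B hBc fun p hp => by simp [B, hzero p hp]
  have hray : ∀ θ r, HasDerivAt (fun r : ℝ => g (r * e θ)) (A (r, θ)) r := fun θ r => by
    have h1 : HasDerivAt (fun r : ℝ => (r : ℂ) * e θ) (e θ) r := by
      simpa using (Complex.ofRealCLM.hasDerivAt (x := r)).mul_const (e θ)
    exact ((hg.differentiable one_ne_zero) _).hasFDerivAt.comp_hasDerivAt r h1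
  have hcirc : ∀ r θ : ℝ, HasDerivAt (fun θ : ℝ => g (r * e θ)) ((r : ℂ) • B (r, θ)) θ := by
    intro r θ
    have h1 : HasDerivAt (fun θ : ℝ => (r : ℂ) * e θ) ((r : ℂ) * (I * e θ)) θ := by
      have h2 : HasDerivAt e (I * e θ) θ := by
        have := ((Real.hasDerivAt_cos θ).ofReal_comp).add
          (((Real.hasDerivAt_sin θ).ofReal_comp).mul_const I)
        refine this.congr_deriv ?_
        simp only [e, mul_add, Complex.ofReal_neg]
        linear_combination (-(Real.sin θ : ℂ)) * I_mul_I
      exact h2.const_mul (r : ℂ)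
    have h3 := ((hg.differentiable one_ne_zero) ((r : ℂ) * e θ)).hasFDerivAt.comp_hasDerivAt θ h1
    refine h3.congr_deriv ?_
    rw [show (r : ℂ) * (I * e θ) = r • (I * e θ) by simp, map_smul]
    simp [B]
  have hIA : ∫ p in Set.Ioi 0 ×ˢ Set.Ioo (-Real.pi) Real.pi, A p = -(2 * Real.pi : ℂ) • g 0 := by
    have h1 : ∀ θ : ℝ, ∫ r in Set.Ioi 0, A (r, θ) = - g 0 := fun θ => by
      have h := integral_Ioi_of_hasDerivAt_of_tendsto' (a := 0) (m := 0)
        (fun r _ => hray θ r) ?_ ?_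
      · simpa using h
      · refine ((hAc.comp
          (by fun_prop : Continuous fun r : ℝ => (r, θ))).continuousOn.integrableOn_compact
          (isCompact_Icc (a := 0) (b := R))).of_forall_sdiff_eq_zero measurableSet_Ioi fun r hr => ?_
        have : R < |r| := by
          by_contra h
          exact hr.2 ⟨le_of_lt hr.1, (le_abs_self _).trans (not_lt.1 h)⟩
        simp [A, hzero (r, θ) this]
      · obtain ⟨R', hR'⟩ := hc.isCompact.isBounded.subset_closedBall 0
        refine tendsto_const_nhds.congr' ?_
        filter_upwards [eventually_gt_atTop (max R' 0)] with r hr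
        by_contra h
        have := hR' (subset_tsupport _ (Ne.symm h))
        rw [mem_closedBall_zero_iff, norm_mul, hen, mul_one, Complex.norm_real, Real.norm_eq_abs,
          abs_of_pos ((le_max_right _ _).trans_lt hr)] at this
        exact absurd this (not_le.2 ((le_max_left _ _).trans_lt hr))
    rw [Measure.volume_eq_prod, ← Measure.prod_restrict, integral_prod_symm _ (by
      rw [Measure.prod_restrict]; exact hA)]
    simp_rw [h1]
    rw [setIntegral_const]
    have : volume.real (Set.Ioo (-Real.pi) Real.pi) = 2 * Real.pi := by
      rw [Real.volume_real_Ioo_of_le (by linarith [Real.pi_pos])]; ring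
    rw [this, smul_neg, neg_smul, ← Complex.coe_smul]
    simp
  have hIB : ∫ p in Set.Ioi 0 ×ˢ Set.Ioo (-Real.pi) Real.pi, B p = 0 := by
    rw [Measure.volume_eq_prod, setIntegral_prod _ hB]
    refine (setIntegral_congr_fun measurableSet_Ioi fun r hr => ?_).trans (integral_zero _ _)
    have h1 := intervalIntegral.integral_eq_sub_of_hasDerivAt (a := -Real.pi) (b := Real.pi)
      (fun θ _ => hcirc r θ) (by apply Continuous.intervalIntegrable; fun_prop)
    have h2 : e Real.pi = e (-Real.pi) := by simp [e]
    rw [h2, sub_self, intervalIntegral.integral_smul, smul_eq_zero] at h1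
    have h3 := h1.resolve_left (by exact_mod_cast (ne_of_gt hr))
    rwa [intervalIntegral.integral_of_le (by linarith [Real.pi_pos]), integral_Ioc_eq_integral_Ioo]
      at h3
  rw [← Complex.integral_comp_polarCoord_symm]
  have key : ∀ p ∈ polarCoord.target, p.1 • ((Complex.polarCoord.symm p)⁻¹ •
      dbar g (Complex.polarCoord.symm p)) = (2⁻¹ : ℂ) • A p + (2⁻¹ * I : ℂ) • B p := by
    intro p hp
    have hp1 : (p.1 : ℂ) ≠ 0 := by exact_mod_cast (ne_of_gt hp.1)
    have hpol : Complex.polarCoord.symm p = p.1 * e p.2 := by simp [e]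
    rw [hpol]
    have hlin : ∀ a b : ℝ, fderiv ℝ g (p.1 * e p.2) (a + b * I) =
        (a : ℂ) • fderiv ℝ g (p.1 * e p.2) 1 + (b : ℂ) • fderiv ℝ g (p.1 * e p.2) I := by
      intro a b
      rw [Complex.coe_smul, Complex.coe_smul, ← map_smul, ← map_smul, ← map_add]
      simp
    have h1 : I * e p.2 = ((-Real.sin p.2 : ℝ) : ℂ) + (Real.cos p.2 : ℝ) * I := by
      simp only [e, Complex.ofReal_neg]
      linear_combination (Real.sin p.2 : ℂ) * I_mul_I
    have h2 : (e p.2)⁻¹ = Real.cos p.2 - Real.sin p.2 * I := by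
      refine inv_eq_of_mul_eq_one_right ?_
      have h3 : (Real.cos p.2 : ℂ) ^ 2 + (Real.sin p.2 : ℂ) ^ 2 = 1 := by
        exact_mod_cast Real.cos_sq_add_sin_sq p.2
      simp only [e]
      linear_combination h3 - (Real.sin p.2 : ℂ) ^ 2 * I_mul_I
    simp only [A, B, dbar]
    rw [h1, hlin, show e p.2 = (Real.cos p.2 : ℝ) + (Real.sin p.2 : ℝ) * I from rfl, hlin,
      show (Real.cos p.2 : ℂ) + (Real.sin p.2 : ℂ) * I = e p.2 from rfl, ← Complex.coe_smul,
      mul_inv, h2, Complex.ofReal_neg]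
    generalize (Real.sin p.2 : ℂ) = s, (Real.cos p.2 : ℂ) = c
    match_scalars
    · field_simp
      ring
    · field_simp
      linear_combination (-s) * I_mul_I
  rw [setIntegral_congr_fun (polarCoord.open_target.measurableSet) key,
    integral_add (by exact hA.smul _) (by exact hB.smul _), integral_smul, integral_smul]
  rw [show polarCoord.target = Set.Ioi 0 ×ˢ Set.Ioo (-Real.pi) Real.pi from rfl, hIA, hIB,
    smul_zero, add_zero, smul_smul]
  congr 1
  ring

theorem hasFDerivAt_cauchyTransform {g : ℂ → V} (hg : ContDiff ℝ 1 g)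
    (hc : HasCompactSupport g) (z : ℂ) : HasFDerivAt (cauchyTransform g)
      (MeasureTheory.convolution (fun w : ℂ => (Real.pi * w : ℂ)⁻¹) (fderiv ℝ g)
      ((ContinuousLinearMap.lsmul ℝ ℂ).precompR ℂ) volume z) z := by
  rw [cauchyTransform_eq_convolution]
  exact hc.hasFDerivAt_convolution_right _ locallyIntegrable_inv hg z

/-- Differentiation falls on `g` inside the convolution; the resulting integral is evaluated by the
Cauchy–Pompeiu formula for the reflected function `t ↦ g (z - t)`. The reflection changes the sign
of the derivative, which cancels the sign in that formula. -/
theorem dbar_cauchyTransform [CompleteSpace V] {g : ℂ → V} (hg : ContDiff ℝ 1 g)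
    (hc : HasCompactSupport g) (z : ℂ) : dbar (cauchyTransform g) z = g z := by
  have hint : ∀ v : ℂ, Integrable fun t : ℂ => (Real.pi * t : ℂ)⁻¹ • fderiv ℝ g (z - t) v := by
    intro v
    have h1 : HasCompactSupport fun x => fderiv ℝ g x v :=
      (hc.fderiv ℝ).comp_left (g := fun l : ℂ →L[ℝ] V => l v) rfl
    exact h1.convolutionExists_right (ContinuousLinearMap.lsmul ℝ ℂ) locallyIntegrable_inv
      ((hg.continuous_fderiv one_ne_zero).clm_apply continuous_const) z
  have hv : ∀ v : ℂ, fderiv ℝ (cauchyTransform g) z v =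
      ∫ t : ℂ, (Real.pi * t : ℂ)⁻¹ • fderiv ℝ g (z - t) v := by
    intro v
    rw [(hasFDerivAt_cauchyTransform hg hc z).fderiv, convolution_precompR_apply]
    · simp [convolution_def]
    · exact locallyIntegrable_inv
    · exact hc.fderiv ℝ
    · exact hg.continuous_fderiv one_ne_zero
  have hG : ContDiff ℝ 1 fun t => g (z - t) := hg.comp (contDiff_const.sub contDiff_id)
  have hGc : HasCompactSupport fun t => g (z - t) :=
    hc.comp_homeomorph (Homeomorph.subLeft z)
  have hGd : ∀ t v, fderiv ℝ (fun t => g (z - t)) t v = - fderiv ℝ g (z - t) v := by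
    intro t v
    have h1 : HasFDerivAt (fun t : ℂ => z - t) (-ContinuousLinearMap.id ℝ ℂ) t :=
      (hasFDerivAt_id t).const_sub z
    have h2 := ((hg.differentiable one_ne_zero) (z - t)).hasFDerivAt.comp t h1
    have h3 : HasFDerivAt (fun t => g (z - t)) _ t := h2
    rw [h3.fderiv]
    simp
  have h := integral_inv_smul_dbar hG hGc
  simp only [dbar, hGd] at h
  rw [dbar, hv, hv, ← integral_smul, ← integral_add (hint 1) (by exact (hint I).smul I),
    ← integral_smul]
  rw [sub_zero] at h
  have hpi : (Real.pi : ℂ) ≠ 0 := by exact_mod_cast Real.pi_ne_zero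
  have h4 : g z = (-(Real.pi : ℂ)⁻¹) • (-(Real.pi : ℂ) • g z) := by
    rw [smul_smul, neg_mul_neg, inv_mul_cancel₀ hpi, one_smul]
  rw [h4, ← h, ← integral_smul]
  refine integral_congr_ae (Eventually.of_forall fun t => ?_)
  simp only [mul_inv]
  module

/-- The Cauchy transform of `g` is holomorphic off the support of `g`. -/
theorem differentiableAt_cauchyTransform [CompleteSpace V] {g : ℂ → V} (hg : Continuous g)
    (hc : HasCompactSupport g) {z : ℂ} (hz : z ∉ tsupport g) :
    DifferentiableAt ℂ (cauchyTransform g) z := by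
  obtain ⟨δ, hδ, hball⟩ := Metric.isOpen_iff.1 (isClosed_tsupport g).isOpen_compl z hz
  have hgi : Integrable g := hg.integrable_of_hasCompactSupport hc
  -- For `x` within `δ / 2` of `z`, the denominators `x - w` stay away from zero wherever `g w ≠ 0`;
  -- this is the uniform bound for differentiating under the integral.
  have hdist : ∀ w, g w ≠ 0 → ∀ x ∈ Metric.ball z (δ / 2), δ / 2 ≤ ‖x - w‖ := by
    intro w hw x hx
    by_contra! h
    refine hball (a := w) ?_ (subset_tsupport _ hw)
    rw [Metric.mem_ball, dist_comm]
    rw [Metric.mem_ball, dist_comm] at hx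
    calc dist z w ≤ dist z x + dist x w := dist_triangle _ _ _
      _ < δ / 2 + δ / 2 := add_lt_add hx (by rwa [dist_eq_norm])
      _ = δ := by ring
  have hmeas : ∀ x : ℂ, AEStronglyMeasurable (fun w => (Real.pi * (x - w) : ℂ)⁻¹ • g w) := fun x =>
    AEStronglyMeasurable.smul (by fun_prop) hg.aestronglyMeasurable
  refine (hasDerivAt_integral_of_dominated_loc_of_deriv_le (μ := volume)
    (F := fun x w => (Real.pi * (x - w) : ℂ)⁻¹ • g w)
    (F' := fun x w => (-(Real.pi : ℂ) / (Real.pi * (x - w)) ^ 2) • g w)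
    (bound := fun w => (Real.pi / (Real.pi * (δ / 2)) ^ 2) * ‖g w‖)
    (Metric.ball_mem_nhds z (half_pos hδ)) (Eventually.of_forall hmeas) ?_ ?_ ?_
    (hgi.norm.const_mul _) ?_).2.differentiableAt
  · refine (hgi.norm.const_mul (Real.pi * (δ / 2))⁻¹).mono' (hmeas z)
      (Eventually.of_forall fun w => ?_)
    by_cases hw : g w = 0
    · simp [hw]
    · have h1 := hdist w hw z (Metric.mem_ball_self (half_pos hδ))
      rw [norm_smul, norm_inv, norm_mul, Complex.norm_real, Real.norm_of_nonneg Real.pi_pos.le]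
      gcongr
  · exact AEStronglyMeasurable.smul (Measurable.aestronglyMeasurable (by fun_prop))
      hg.aestronglyMeasurable
  · refine Eventually.of_forall fun w x hx => ?_
    by_cases hw : g w = 0
    · simp [hw]
    · have h1 := hdist w hw x hx
      rw [norm_smul, norm_div, norm_pow, norm_neg, norm_mul, Complex.norm_real,
        Real.norm_of_nonneg Real.pi_pos.le]
      gcongr
  · refine Eventually.of_forall fun w x hx => ?_
    by_cases hw : g w = 0
    · simpa [hw] using hasDerivAt_const x (0 : V)
    · have h1 := hdist w hw x hx
      have h2 : x - w ≠ 0 := fun h => by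
        rw [h, norm_zero] at h1
        linarith
      have hpi : (Real.pi : ℂ) ≠ 0 := by exact_mod_cast Real.pi_ne_zero
      have h3 : HasDerivAt (fun x : ℂ => (Real.pi * (x - w) : ℂ)) Real.pi x := by
        simpa using ((hasDerivAt_id x).sub_const w).const_mul (Real.pi : ℂ)
      exact (h3.fun_inv (mul_ne_zero hpi h2)).smul_const (g w)

/-- If `g` is supported in the disc of radius `R`, then `‖z - w‖ ≥ ‖z‖ - R` on the support, so the
transform is `O(1 / ‖z‖)`. -/
theorem tendsto_cauchyTransform_cobounded {g : ℂ → V} (hg : Continuous g)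
    (hc : HasCompactSupport g) :
    Tendsto (cauchyTransform g) (Bornology.cobounded ℂ) (𝓝 0) := by
  obtain ⟨R, hR⟩ := hc.isCompact.isBounded.subset_closedBall 0
  have hgi : Integrable g := hg.integrable_of_hasCompactSupport hc
  have hlim : Tendsto (fun z : ℂ => (Real.pi * (‖z‖ - R))⁻¹ * ∫ w, ‖g w‖)
      (Bornology.cobounded ℂ) (𝓝 0) := by
    rw [← zero_mul (∫ w, ‖g w‖)]
    refine Tendsto.mul_const _ (tendsto_inv_atTop_zero.comp ?_)
    exact (tendsto_atTop_add_const_right _ (-R) tendsto_norm_cobounded_atTop).const_mul_atTop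
      Real.pi_pos
  refine squeeze_zero_norm' ?_ hlim
  filter_upwards [tendsto_norm_cobounded_atTop.eventually_gt_atTop R] with z hz
  rw [← integral_const_mul]
  refine norm_integral_le_of_norm_le (hgi.norm.const_mul _) (Eventually.of_forall fun w => ?_)
  by_cases hw : g w = 0
  · simp [hw]
  · have h1 := hR (subset_tsupport _ hw)
    rw [mem_closedBall_zero_iff] at h1
    have h2 : ‖z‖ - R ≤ ‖z - w‖ := by linarith [norm_sub_norm_le z w]
    have h3 : 0 < ‖z‖ - R := by linarith
    rw [norm_smul, norm_inv, norm_mul, Complex.norm_real, Real.norm_of_nonneg Real.pi_pos.le]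
    gcongr

end CauchyTransform

/-! ### Fredholm integral equations -/

section Fredholm

open MeasureTheory

variable {Y : Type*} [TopologicalSpace Y] [CompactSpace Y]
variable {B V : Type*} [NormedAddCommGroup B] [NormedSpace ℂ B] [NormedAddCommGroup V]
  [NormedSpace ℂ V]

/-- If `K` is the sum of an operator of finite rank and of an operator of norm less than `1`, then
the range of `1 + K` has finite codimension. -/
theorem finite_quotient_range_one_add [CompleteSpace B] {W : Type*} [AddCommGroup W] [Module ℂ W]
    [Module.Finite ℂ W] (K S : B →L[ℂ] B) (hS : ‖S‖ < 1) (J : W →ₗ[ℂ] B) (R : B →ₗ[ℂ] W)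
    (hK : ∀ u, K u = S u + J (R u)) :
    Module.Finite ℂ (B ⧸ (LinearMap.range ((1 + K : B →L[ℂ] B) : B →ₗ[ℂ] B))) := by
  refine Module.Finite.of_surjective (Submodule.mkQ _ ∘ₗ J) fun y => ?_
  obtain ⟨g, rfl⟩ := Submodule.mkQ_surjective _ y
  -- Neumann series. Writing `g = (1 + S) x = (1 + K) x - J (R x)` shows that `J` maps onto the
  -- quotient by the range of `1 + K`.
  have hu : IsUnit (1 + S) := by
    have h := (Units.oneSub (-S) (by rwa [norm_neg])).isUnit
    simpa using h
  obtain ⟨u, hu⟩ := hu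
  let x : B := (↑u⁻¹ : B →L[ℂ] B) g
  have hx : x + S x = g := by
    have : ((u : B →L[ℂ] B) * (↑u⁻¹ : B →L[ℂ] B)) g = g := by simp
    rw [hu] at this
    exact this
  refine ⟨-R x, ?_⟩
  rw [LinearMap.comp_apply, ← sub_eq_zero, ← map_sub, Submodule.mkQ_apply,
    Submodule.Quotient.mk_eq_zero]
  refine ⟨-x, ?_⟩
  have h2 : (1 + K) (-x) = J (-R x) - g := by
    rw [← hx]
    simp only [add_apply, one_apply_eq_self, map_neg, hK]
    abel
  exact h2

set_option synthInstance.maxHeartbeats 200000 in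
/-- A continuous function on a compact space with values in the operators `B → V`, as an operator
from `B` to the continuous functions. -/
def ContinuousMap.toOperator (Λ : C(Y, B →L[ℂ] V)) : B →L[ℂ] C(Y, V) :=
  LinearMap.mkContinuous
    { toFun := fun u => ⟨fun y => Λ y u, by fun_prop⟩
      map_add' := fun u v => by ext; simp
      map_smul' := fun c u => by ext; simp } ‖Λ‖ fun u => by
    rw [ContinuousMap.norm_le _ (by positivity)]
    exact fun y => (Λ y).le_of_opNorm_le (Λ.norm_coe_le_norm y) u

theorem ContinuousMap.norm_toOperator_le (Λ : C(Y, B →L[ℂ] V)) {C : ℝ} (hC : 0 ≤ C)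
    (h : ∀ y, ‖Λ y‖ ≤ C) : ‖Λ.toOperator‖ ≤ C :=
  ContinuousLinearMap.opNorm_le_bound _ hC fun u => by
    rw [ContinuousMap.norm_le _ (by positivity)]
    exact fun y => (Λ y).le_of_opNorm_le (h y) u

/-- Continuous functions on a compact space are approximated by finite sums of products of scalar
functions and constants. -/
theorem ContinuousMap.exists_norm_sub_sum_smul_le [T2Space Y] {E : Type*} [NormedAddCommGroup E]
    [NormedSpace ℝ E] (f : C(Y, E)) {ε : ℝ} (hε : 0 < ε) :
    ∃ (s : Finset Y) (θ : Y → C(Y, ℝ)), ∀ y, ‖f y - ∑ i ∈ s, θ i y • f i‖ ≤ ε := by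
  have hU : ∀ i : Y, IsOpen {y | ‖f y - f i‖ < ε} := fun i =>
    isOpen_lt (by fun_prop) continuous_const
  obtain ⟨s, hs⟩ := isCompact_univ.elim_finite_subcover _ hU
    (fun y _ => Set.mem_iUnion.2 ⟨y, by simpa using hε⟩)
  obtain ⟨p, hp⟩ := PartitionOfUnity.exists_isSubordinate isClosed_univ
    (fun i : s => {y | ‖f y - f i‖ < ε}) (fun i => hU i) (fun y hy => by
      obtain ⟨i, hi, h⟩ := Set.mem_iUnion₂.1 (hs hy)
      exact Set.mem_iUnion.2 ⟨⟨i, hi⟩, h⟩)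
  classical
  refine ⟨s, fun i => if h : i ∈ s then p ⟨i, h⟩ else 0, fun y => ?_⟩
  have hsum : ∑ i : s, p i y = 1 := by
    rw [← finsum_eq_sum_of_fintype]
    exact p.sum_eq_one (Set.mem_univ y)
  have h1 : ∑ i ∈ s, (if h : i ∈ s then p ⟨i, h⟩ else 0 : C(Y, ℝ)) y • f i =
      ∑ i : s, p i y • f i := by
    rw [← Finset.sum_coe_sort s]
    exact Finset.sum_congr rfl fun i _ => by simp
  rw [h1, ← one_smul ℝ (f y), ← hsum, Finset.sum_smul, ← Finset.sum_sub_distrib]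
  calc ‖∑ i : s, (p i y • f y - p i y • f i)‖ ≤ ∑ i : s, p i y * ε := by
        refine norm_sum_le_of_le _ fun i _ => ?_
        rw [← smul_sub, norm_smul, Real.norm_of_nonneg (p.nonneg i y)]
        by_cases h : p i y = 0
        · simp [h]
        · have := hp i (subset_tsupport _ h)
          exact mul_le_mul_of_nonneg_left (le_of_lt this) (p.nonneg i y)
    _ = ε := by rw [← Finset.sum_mul, hsum, one_mul]

/-- A partition of unity approximates the family `Λ` uniformly to within `1 / 2` by `∑ θ i • Λ i`.
The operator of this sum factors through the finite-dimensional space `s → V`, and the remainder has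
norm less than `1`. -/
theorem finite_quotient_range_one_add_toOperator [T2Space Y] [CompleteSpace V]
    [FiniteDimensional ℂ V] (Λ : C(Y, C(Y, V) →L[ℂ] V)) :
    Module.Finite ℂ (C(Y, V) ⧸ (LinearMap.range
      ((1 + Λ.toOperator : C(Y, V) →L[ℂ] C(Y, V)) : C(Y, V) →ₗ[ℂ] C(Y, V)))) := by
  obtain ⟨s, θ, h⟩ := Λ.exists_norm_sub_sum_smul_le (ε := 1 / 2) (by norm_num)
  let D : C(Y, C(Y, V) →L[ℂ] V) := ⟨fun y => Λ y - ∑ i ∈ s, θ i y • Λ i, by fun_prop⟩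
  have hD : ‖D.toOperator‖ ≤ 1 / 2 := ContinuousMap.norm_toOperator_le D (by norm_num) h
  refine finite_quotient_range_one_add (W := s → V) Λ.toOperator D.toOperator
    (hD.trans_lt (by norm_num))
    { toFun := fun v => ⟨fun y => ∑ i : s, (θ i y : ℂ) • v i, by fun_prop⟩
      map_add' := fun v w => by ext; simp [Finset.sum_add_distrib]
      map_smul' := fun c v => by
        ext y
        simp only [Pi.smul_apply, ContinuousMap.coe_mk, RingHom.id_apply, ContinuousMap.coe_smul,
          Finset.smul_sum]
        exact Finset.sum_congr rfl fun i _ => smul_comm _ _ _ }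
    (LinearMap.pi fun i => (Λ i : C(Y, V) →ₗ[ℂ] V)) fun u => ?_
  ext y
  have h1 : ∑ i : s, (θ i y : ℂ) • Λ i u = (∑ i ∈ s, θ i y • Λ i) u := by
    simp only [sum_apply, smul_apply, Complex.coe_smul]
    exact Finset.sum_coe_sort s fun i => θ i y • Λ i u
  change Λ y u = (Λ y u - (∑ i ∈ s, θ i y • Λ i) u) + ∑ i : s, (θ i y : ℂ) • Λ i u
  rw [h1, sub_add_cancel]

/-! ### Integral operators with continuous kernel. -/

variable [MeasurableSpace Y] [BorelSpace Y]

theorem integrable_kernel_apply (ν : Measure Y) [IsFiniteMeasure ν] (k : C(Y, V →L[ℂ] V))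
    (u : C(Y, V)) : Integrable (fun w => k w (u w)) ν :=
  Continuous.integrable_of_hasCompactSupport (by fun_prop) (HasCompactSupport.of_compactSpace _)

/-- Integration against an operator-valued kernel. -/
def integralPairing (ν : Measure Y) [IsFiniteMeasure ν] (k : C(Y, V →L[ℂ] V)) :
    C(Y, V) →L[ℂ] V :=
  LinearMap.mkContinuous
    { toFun := fun u => ∫ w, k w (u w) ∂ν
      map_add' := fun u v => by
        simp only [ContinuousMap.add_apply, map_add]
        exact integral_add (integrable_kernel_apply ν k u) (integrable_kernel_apply ν k v)
      map_smul' := fun c u => by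
        simp only [ContinuousMap.smul_apply, map_smul]
        exact integral_smul c _ } (‖k‖ * ν.real Set.univ)
    fun u => by
      rw [mul_right_comm]
      refine norm_integral_le_of_norm_le_const (Eventually.of_forall fun w => ?_)
      exact (k w).le_of_opNorm_le_of_le (k.norm_coe_le_norm w) (u.norm_coe_le_norm w)

theorem integralPairing_apply (ν : Measure Y) [IsFiniteMeasure ν] (k : C(Y, V →L[ℂ] V))
    (u : C(Y, V)) : integralPairing ν k u = ∫ w, k w (u w) ∂ν := rfl

set_option synthInstance.maxHeartbeats 200000 in
-- The pairing is Lipschitz in the kernel, with the total mass as constant. Hence a curried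
-- continuous kernel becomes a continuous family of operators, as
-- `finite_quotient_range_one_add_toOperator` requires.
theorem continuous_integralPairing (ν : Measure Y) [IsFiniteMeasure ν] :
    Continuous (integralPairing ν : C(Y, V →L[ℂ] V) → C(Y, V) →L[ℂ] V) := by
  have h : LipschitzWith (ν.real Set.univ).toNNReal
      (integralPairing ν : C(Y, V →L[ℂ] V) → C(Y, V) →L[ℂ] V) := ?_
  · exact h.continuous
  refine LipschitzWith.of_dist_le_mul fun k l => ?_
  rw [dist_eq_norm, Real.coe_toNNReal _ measureReal_nonneg]
  refine ContinuousLinearMap.opNorm_le_bound _ (by positivity) fun u => ?_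
  rw [sub_apply, integralPairing_apply, integralPairing_apply,
    ← integral_sub (integrable_kernel_apply ν k u) (integrable_kernel_apply ν l u),
    mul_comm (ν.real _), mul_right_comm]
  refine norm_integral_le_of_norm_le_const (Eventually.of_forall fun w => ?_)
  refine (k w - l w).le_of_opNorm_le_of_le ?_ (u.norm_coe_le_norm w)
  have := ContinuousMap.dist_apply_le_dist (f := k) (g := l) w
  rwa [dist_eq_norm (k w) (l w)] at this

/-- A Fredholm integral equation with continuous kernel is solvable for some nonzero right-hand side
in every infinite-dimensional family. -/
theorem exists_integral_equation_solution [T2Space Y] [FiniteDimensional ℂ V]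
    (ν : Measure Y) [IsFiniteMeasure ν]
    (q : C(Y × Y, V →L[ℂ] V)) {P : Type*} [AddCommGroup P] [Module ℂ P]
    (hP : ¬ Module.Finite ℂ P) (f : P →ₗ[ℂ] C(Y, V)) :
    ∃ p ≠ 0, ∃ u : C(Y, V), ∀ z, u z + ∫ w, q (z, w) (u w) ∂ν = f p z := by
  have : CompleteSpace V := FiniteDimensional.complete ℂ V
  let Λ : C(Y, C(Y, V) →L[ℂ] V) := (ContinuousMap.mk _ (continuous_integralPairing ν)).comp q.curry
  have hfin := finite_quotient_range_one_add_toOperator Λ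
  -- An infinite-dimensional space cannot inject into the finite-dimensional cokernel, so some
  -- nonzero `p` gives a right-hand side in the range.
  have hinj : ¬ Function.Injective (Submodule.mkQ (LinearMap.range
      ((1 + Λ.toOperator : C(Y, V) →L[ℂ] C(Y, V)) : C(Y, V) →ₗ[ℂ] C(Y, V))) ∘ₗ f) := fun h =>
    hP (Module.Finite.of_injective _ h)
  rw [← LinearMap.ker_eq_bot, Submodule.eq_bot_iff] at hinj
  push Not at hinj
  obtain ⟨p, hp, hp0⟩ := hinj
  rw [LinearMap.mem_ker, LinearMap.comp_apply, Submodule.mkQ_apply,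
    Submodule.Quotient.mk_eq_zero] at hp
  obtain ⟨u, hu⟩ := hp
  refine ⟨p, hp0, u, fun z => ?_⟩
  rw [← hu]
  rfl

end Fredholm

/-! ### Cut-off functions and the `∂̄`-calculus -/

section Dbar

open Complex

variable {V : Type*} [NormedAddCommGroup V] [NormedSpace ℂ V]

/-- `f` is real differentiable at `z` with `∂f/∂z̄ = d` there. -/
def HasDbarAt (f : ℂ → V) (d : V) (z : ℂ) : Prop :=
  ∃ L : ℂ →L[ℝ] V, HasFDerivAt f L z ∧ (2⁻¹ : ℂ) • (L 1 + I • L I) = d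

theorem DifferentiableAt.hasDbarAt {f : ℂ → V} {z : ℂ} (h : DifferentiableAt ℝ f z) :
    HasDbarAt f (dbar f z) z := ⟨_, h.hasFDerivAt, rfl⟩

theorem HasDbarAt.dbar_eq {f : ℂ → V} {d : V} {z : ℂ} (h : HasDbarAt f d z) : dbar f z = d := by
  obtain ⟨L, hL, rfl⟩ := h
  rw [dbar, hL.fderiv]

theorem HasDbarAt.congr_of_eventuallyEq {f g : ℂ → V} {d : V} {z : ℂ} (h : HasDbarAt f d z)
    (hg : g =ᶠ[𝓝 z] f) : HasDbarAt g d z := by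
  obtain ⟨L, hL, rfl⟩ := h
  exact ⟨L, hL.congr_of_eventuallyEq hg, rfl⟩

theorem hasDbarAt_const (c : V) (z : ℂ) : HasDbarAt (fun _ => c) 0 z :=
  ⟨0, hasFDerivAt_const c z, by simp⟩

theorem HasDbarAt.sub {f g : ℂ → V} {a b : V} {z : ℂ} (hf : HasDbarAt f a z)
    (hg : HasDbarAt g b z) : HasDbarAt (fun w => f w - g w) (a - b) z := by
  obtain ⟨L, hL, rfl⟩ := hf
  obtain ⟨M, hM, rfl⟩ := hg
  refine ⟨L - M, hL.sub hM, ?_⟩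
  simp only [sub_apply]
  module

theorem HasDbarAt.sum {κ : Type*} {s : Finset κ} {f : κ → ℂ → V} {d : κ → V} {z : ℂ}
    (h : ∀ k ∈ s, HasDbarAt (f k) (d k) z) :
    HasDbarAt (fun w => ∑ k ∈ s, f k w) (∑ k ∈ s, d k) z := by
  choose! L hL hd using h
  refine ⟨∑ k ∈ s, L k, HasFDerivAt.fun_sum hL, ?_⟩
  rw [← Finset.sum_congr rfl hd]
  simp [Finset.smul_sum, Finset.sum_add_distrib]

theorem HasDbarAt.mul {f g : ℂ → ℂ} {a b : ℂ} {z : ℂ} (hf : HasDbarAt f a z)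
    (hg : HasDbarAt g b z) : HasDbarAt (fun w => f w * g w) (a * g z + f z * b) z := by
  obtain ⟨L, hL, rfl⟩ := hf
  obtain ⟨M, hM, rfl⟩ := hg
  refine ⟨_, hL.mul hM, ?_⟩
  simp only [add_apply, smul_apply, smul_eq_mul]
  ring

theorem HasDbarAt.apply {κ : Type*} [Fintype κ] {f : ℂ → κ → ℂ} {d : κ → ℂ} {z : ℂ}
    (h : HasDbarAt f d z) (i : κ) : HasDbarAt (fun w => f w i) (d i) z := by
  obtain ⟨L, hL, rfl⟩ := h
  exact ⟨_, (hasFDerivAt_pi'.1 hL) i, by simp⟩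

theorem DifferentiableAt.hasDbarAt_zero {f : ℂ → V} {z : ℂ} (h : DifferentiableAt ℂ f z) :
    HasDbarAt f 0 z := by
  refine ⟨_, h.hasFDerivAt.restrictScalars ℝ, ?_⟩
  have : fderiv ℂ f z I = I • fderiv ℂ f z 1 := by rw [← map_smul]; simp
  simp [this, smul_smul]

/-- Vanishing of `∂̄f` is the Cauchy–Riemann equation `L I = I • L 1`. -/
theorem HasDbarAt.differentiableAt {f : ℂ → V} {z : ℂ} (h : HasDbarAt f 0 z) :
    DifferentiableAt ℂ f z := by
  obtain ⟨L, hL, h0⟩ := h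
  rw [differentiableAt_complex_iff_differentiableAt_real]
  refine ⟨hL.differentiableAt, ?_⟩
  rw [hL.fderiv]
  rw [smul_eq_zero] at h0
  have h1 := h0.resolve_left (by norm_num)
  have h2 := congrArg (I • ·) h1
  simp only [smul_add, smul_smul, I_mul_I, smul_zero, neg_smul, one_smul] at h2
  rw [add_neg_eq_zero] at h2
  exact h2.symm

theorem ContDiff.dbar {f : ℂ → V} (h : ContDiff ℝ ∞ f) : ContDiff ℝ ∞ (dbar f) := by
  have h1 : ContDiff ℝ ∞ (fderiv ℝ f) := h.fderiv_right (m := ∞) (by simp)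
  have h2 : ∀ v : ℂ, ContDiff ℝ ∞ fun z => fderiv ℝ f z v := fun v => h1.clm_apply contDiff_const
  exact ((h2 1).add ((h2 I).const_smul I)).const_smul (2⁻¹ : ℂ)

theorem tsupport_dbar_subset (f : ℂ → V) : tsupport (dbar f) ⊆ tsupport f := by
  refine (closure_mono fun z hz => ?_).trans (tsupport_fderiv_subset ℝ (f := f))
  contrapose! hz
  rw [Function.mem_support, not_not] at hz
  simp [dbar, hz]

end Dbar

section Cutoffs

variable {ι : Type*} [Fintype ι]

/-- Since `ψ k` is constant near the support of `φ k`, the supports of `dbar (ψ k)` and of `φ k` are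
disjoint, which will make the integral kernel continuous. Boundedness of the other sets leaves only
the frame `o` near infinity, so that every `dbar (ψ k)` vanishes there. -/
theorem exists_cutoffs {D : ι → Set ℂ} (hD : ∀ k, IsOpen (D k)) (hcover : ∀ z, ∃ k, z ∈ D k)
    (o : ι) (hbd : ∀ k ≠ o, Bornology.IsBounded (D k)) :
    ∃ φ ψ : ι → ℂ → ℂ, (∀ k, ContDiff ℝ ∞ (φ k)) ∧ (∀ k, ContDiff ℝ ∞ (ψ k)) ∧
      (∀ z, ∑ k, φ k z = 1) ∧ (∀ k, tsupport (φ k) ⊆ D k) ∧ (∀ k, tsupport (ψ k) ⊆ D k) ∧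
      (∀ k, ∀ z ∈ tsupport (φ k), ψ k =ᶠ[𝓝 z] 1) ∧
      ∃ R : ℝ, ∀ z : ℂ, R < ‖z‖ → ψ o =ᶠ[𝓝 z] 1 ∧ ∀ k ≠ o, ψ k =ᶠ[𝓝 z] 0 := by
  obtain ⟨f, hf⟩ := SmoothPartitionOfUnity.exists_isSubordinate 𝓘(ℝ, ℂ) isClosed_univ D hD
    (fun z _ => Set.mem_iUnion.2 (hcover z))
  have hψ : ∀ k, ∃ g : ℂ → ℝ, ContDiff ℝ ∞ g ∧ tsupport g ⊆ D k ∧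
      ∀ z ∈ tsupport (f k), ∀ᶠ w in 𝓝 z, g w = 1 := by
    intro k
    obtain ⟨u, huo, hsu, hu⟩ := normal_exists_closure_subset (isClosed_tsupport (f k)) (hD k) (hf k)
    obtain ⟨g, h1, h0, -⟩ := exists_contMDiffMap_one_nhds_of_subset_interior 𝓘(ℝ, ℂ) (n := ⊤)
      (isClosed_tsupport (f k)) (hsu.trans (interior_maximal subset_closure huo))
    refine ⟨g, g.contMDiff.contDiff, ?_, fun z hz => ?_⟩
    · refine (closure_minimal (fun z hz => ?_) isClosed_closure).trans hu
      by_contra h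
      exact hz (h0 z h)
    · exact h1.filter_mono (nhds_le_nhdsSet hz)
  choose g hg hgD hg1 using hψ
  have htf : ∀ k, tsupport (fun z => (f k z : ℂ)) = tsupport (f k) := fun k => by
    simp [tsupport, Function.support]
  have htg : ∀ k, tsupport (fun z => (g k z : ℂ)) = tsupport (g k) := fun k => by
    simp [tsupport, Function.support]
  have hsum : ∀ z, ∑ k, f k z = 1 := fun z => by
    rw [← finsum_eq_sum_of_fintype]
    exact f.sum_eq_one (Set.mem_univ z)
  obtain ⟨R, hR⟩ : ∃ R, ∀ k ≠ o, D k ⊆ Metric.closedBall 0 R := by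
    have : Bornology.IsBounded (⋃ k ∈ {k | k ≠ o}, D k) :=
      (Bornology.isBounded_biUnion (Set.toFinite _)).2 hbd
    obtain ⟨R, hR⟩ := this.subset_closedBall 0
    exact ⟨R, fun k hk => (Set.subset_biUnion_of_mem (u := D) hk).trans hR⟩
  refine ⟨fun k z => f k z, fun k z => g k z, fun k => ?_, fun k => ?_, fun z => ?_, fun k => ?_,
    fun k => ?_, fun k z hz => ?_, R, fun z hz => ?_⟩
  · exact Complex.ofRealCLM.contDiff.comp (f k).contMDiff.contDiff
  · exact Complex.ofRealCLM.contDiff.comp (hg k)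
  · change ∑ k, ((f k z : ℝ) : ℂ) = 1
    exact_mod_cast hsum z
  · rw [htf]; exact hf k
  · rw [htg]; exact hgD k
  · rw [htf] at hz
    filter_upwards [hg1 k z hz] with w hw
    simp [hw]
  · have hout : ∀ k ≠ o, z ∉ D k := fun k hk h => by
      have := hR k hk h
      rw [mem_closedBall_zero_iff] at this
      linarith
    constructor
    · have h1 : f o z = 1 := by
        rw [← hsum z]
        refine (Finset.sum_eq_single_of_mem (f := fun k => f k z) o (Finset.mem_univ o)
          fun k _ hk => ?_).symm
        by_contra h
        exact hout k hk (hf k (subset_tsupport _ h))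
      filter_upwards [hg1 o z (subset_tsupport _ (by simp [h1]))] with w hw
      simp [hw]
    · intro k hk
      have : z ∉ tsupport (g k) := fun h => hout k hk (hgD k h)
      filter_upwards [(isClosed_tsupport (g k)).isOpen_compl.mem_nhds this] with w hw
      simp [image_eq_zero_of_notMem_tsupport hw]

/-- The Cauchy kernel multiplied by functions with disjoint supports is continuous. -/
theorem continuous_mul_cauchyKernel {h φ : ℂ → ℂ} (hh : Continuous h) (hφ : Continuous φ)
    (hd : Disjoint (tsupport h) (tsupport φ)) :
    Continuous fun p : ℂ × ℂ => h p.1 * φ p.2 * (Real.pi * (p.1 - p.2))⁻¹ := by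
  rw [continuous_iff_continuousAt]
  rintro ⟨z, w⟩
  by_cases hz : z ∈ tsupport h
  · by_cases hw : w ∈ tsupport φ
    · have hzw : z ≠ w := fun e => Set.disjoint_left.1 hd hz (e ▸ hw)
      have : (Real.pi * (z - w) : ℂ) ≠ 0 :=
        mul_ne_zero (by exact_mod_cast Real.pi_ne_zero) (sub_ne_zero.2 hzw)
      exact ContinuousAt.mul (by fun_prop) (ContinuousAt.inv₀ (by fun_prop) this)
    · refine (continuousAt_const (y := (0 : ℂ))).congr ?_
      filter_upwards [continuousAt_snd.preimage_mem_nhds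
        ((isClosed_tsupport φ).isOpen_compl.mem_nhds hw)] with p hp
      simp [image_eq_zero_of_notMem_tsupport hp]
  · refine (continuousAt_const (y := (0 : ℂ))).congr ?_
    filter_upwards [continuousAt_fst.preimage_mem_nhds
      ((isClosed_tsupport h).isOpen_compl.mem_nhds hz)] with p hp
    simp [image_eq_zero_of_notMem_tsupport hp]

end Cutoffs

/-! ### Solving a Cousin problem -/

section Cousin

open MeasureTheory Polynomial

variable {ι : Type*} [Fintype ι] {n : ℕ}

/-- A holomorphic `GL(n)`-cocycle for the cover `D`. -/
structure HolomorphicCocycle (D : ι → Set ℂ) (A : ι → ι → ℂ → Matrix (Fin n) (Fin n) ℂ) :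
    Prop where
  differentiableOn : ∀ k l i j, DifferentiableOn ℂ (fun z => A k l z i j) (D k ∩ D l)
  self : ∀ k, ∀ z ∈ D k, A k k z = 1
  mul : ∀ k l m, ∀ z, z ∈ D k → z ∈ D l → z ∈ D m → A k l z * A l m z = A k m z

variable {D : ι → Set ℂ} {A : ι → ι → ℂ → Matrix (Fin n) (Fin n) ℂ}

/-- The local sections `t` cut off by `χ`, summed, and read in the frame `m`. -/
def cutoffSum (A : ι → ι → ℂ → Matrix (Fin n) (Fin n) ℂ) (χ : ι → ℂ → ℂ) (t : ι → ℂ → Fin n → ℂ)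
    (m : ι) (z : ℂ) : Fin n → ℂ := ∑ k, χ k z • (A m k z).mulVec (t k z)

theorem cutoffSum_apply (χ : ι → ℂ → ℂ) (t : ι → ℂ → Fin n → ℂ)
    (m : ι) (z : ℂ) (i : Fin n) :
    cutoffSum A χ t m z i = ∑ k, ∑ j, χ k z * A m k z i j * t k z j := by
  simp [cutoffSum, Finset.sum_apply, Matrix.mulVec, dotProduct, Finset.mul_sum, mul_assoc]

/-- The cut-off sum is a section of the bundle and not merely a family of vectors. The cocycle
relation is needed only for those `k` with `χ k z ≠ 0`, where it is available because `z ∈ D k`. -/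
theorem mulVec_cutoffSum (hA : HolomorphicCocycle D A) {χ : ι → ℂ → ℂ}
    (hχ : ∀ k z, χ k z ≠ 0 → z ∈ D k) (t : ι → ℂ → Fin n → ℂ) {l m : ι} {z : ℂ}
    (hl : z ∈ D l) (hm : z ∈ D m) :
    (A l m z).mulVec (cutoffSum A χ t m z) = cutoffSum A χ t l z := by
  rw [cutoffSum, cutoffSum, Matrix.mulVec_sum]
  refine Finset.sum_congr rfl fun k _ => ?_
  rw [Matrix.mulVec_smul]
  by_cases hk : χ k z = 0
  · simp [hk]
  · rw [Matrix.mulVec_mulVec, hA.mul l m k z hl hm (hχ k z hk)]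

theorem cutoffSum_eq_of_eq_zero (hA : HolomorphicCocycle D A) {χ : ι → ℂ → ℂ} {o : ι} {z : ℂ}
    (t : ι → ℂ → Fin n → ℂ) (hz : z ∈ D o) (ho : χ o z = 1) (hχ : ∀ k ≠ o, χ k z = 0) :
    cutoffSum A χ t o z = t o z := by
  rw [cutoffSum, Finset.sum_eq_single_of_mem o (Finset.mem_univ o)
    fun k _ hk => by rw [hχ k hk, zero_smul], ho, hA.self o z hz]
  simp

/-- Leibniz rule: the transition matrices are holomorphic, so `∂̄` falls only on the cut-offs and on
`t`. Outside the support of `χ k` nothing is known about `A m k`, but the summand is zero nearby. -/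
theorem hasDbarAt_cutoffSum (hD : ∀ k, IsOpen (D k)) (hA : HolomorphicCocycle D A)
    {χ : ι → ℂ → ℂ} (hχ : ∀ k, ContDiff ℝ ∞ (χ k)) (hχD : ∀ k, tsupport (χ k) ⊆ D k)
    {t t' : ι → ℂ → Fin n → ℂ} {m : ι} {z : ℂ} (hz : z ∈ D m)
    (ht : ∀ k i, HasDbarAt (fun w => t k w i) (t' k z i) z) (i : Fin n) :
    HasDbarAt (fun w => cutoffSum A χ t m w i)
      (cutoffSum A (fun k => dbar (χ k)) t m z i + cutoffSum A χ t' m z i) z := by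
  simp only [cutoffSum_apply, ← Finset.sum_add_distrib]
  refine HasDbarAt.sum fun k _ => HasDbarAt.sum fun j _ => ?_
  by_cases hk : z ∈ tsupport (χ k)
  · have h1 : DifferentiableAt ℂ (fun w => A m k w i j) z :=
      (hA.differentiableOn m k i j).differentiableAt
        (((hD m).inter (hD k)).mem_nhds ⟨hz, hχD k hk⟩)
    have h2 := (((hχ k).differentiable (by simp) z).hasDbarAt.mul h1.hasDbarAt_zero).mul (ht k j)
    simpa using h2
  · have h1 : χ k =ᶠ[𝓝 z] 0 := notMem_tsupport_iff_eventuallyEq.1 hk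
    have h2 : dbar (χ k) z = 0 :=
      image_eq_zero_of_notMem_tsupport fun h => hk (tsupport_dbar_subset _ h)
    rw [h2, h1.self_of_nhds]
    simp only [Pi.zero_apply, zero_mul, add_zero]
    refine (hasDbarAt_const 0 z).congr_of_eventuallyEq ?_
    filter_upwards [h1] with w hw
    simp [hw]

/-- Regularity of `t k` is asked only on the support of `χ k`. This matters for `χ = dbar ψ`, whose
support avoids the places where the Cauchy transform in `t k` is not yet known to be smooth. -/
theorem contDiffAt_cutoffSum (hD : ∀ k, IsOpen (D k)) (hA : HolomorphicCocycle D A)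
    {χ : ι → ℂ → ℂ} (hχ : ∀ k, ContDiff ℝ ∞ (χ k)) (hχD : ∀ k, tsupport (χ k) ⊆ D k)
    {t : ι → ℂ → Fin n → ℂ} {m : ι} {z : ℂ} (hz : z ∈ D m)
    (ht : ∀ k i, z ∈ tsupport (χ k) → ContDiffAt ℝ 1 (fun w => t k w i) z) (i : Fin n) :
    ContDiffAt ℝ 1 (fun w => cutoffSum A χ t m w i) z := by
  simp only [cutoffSum_apply]
  refine ContDiffAt.sum fun k _ => ContDiffAt.sum fun j _ => ?_
  by_cases hk : z ∈ tsupport (χ k)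
  · have h1 : AnalyticAt ℂ (fun w => A m k w i j) z :=
      (hA.differentiableOn m k i j).analyticAt
        (((hD m).inter (hD k)).mem_nhds ⟨hz, hχD k hk⟩)
    exact (((hχ k).contDiffAt.of_le (by simp)).mul (h1.contDiffAt.restrict_scalars ℝ)).mul
      (ht k j hk)
  · refine (contDiffAt_const (c := (0 : ℂ))).congr_of_eventuallyEq ?_
    filter_upwards [notMem_tsupport_iff_eventuallyEq.1 hk] with w hw
    simp [hw]

/-! ### Reduction to an integral equation on a disc. -/

theorem integrable_cauchyKernel_smul {V : Type*} [NormedAddCommGroup V] [NormedSpace ℂ V]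
    {g : ℂ → V} (hg : Continuous g) (hc : HasCompactSupport g) (z : ℂ) :
    Integrable fun w : ℂ => (Real.pi * (z - w) : ℂ)⁻¹ • g w := by
  have h : Integrable fun w : ℂ => (Real.pi * w : ℂ)⁻¹ • g (z - w) :=
    hc.convolutionExists_right (ContinuousLinearMap.lsmul ℝ ℂ) locallyIntegrable_inv hg z
  simpa using h.comp_sub_left z

theorem cauchyTransform_apply {κ : Type*} [Fintype κ] {g : ℂ → κ → ℂ} (hg : Continuous g)
    (hc : HasCompactSupport g) (z : ℂ) (j : κ) :
    cauchyTransform g z j = ∫ w, (Real.pi * (z - w) : ℂ)⁻¹ * g w j :=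
  ((ContinuousLinearMap.proj (R := ℂ) (φ := fun _ : κ => ℂ) j).integral_comp_comm
    (integrable_cauchyKernel_smul hg hc z)).symm

/-- The kernel of the integral equation attached to a cocycle and cut-off functions. -/
def cousinKernel (h : ι → ι → Fin n → Fin n → ℂ → ℂ) (φ : ι → ℂ → ℂ) (z w : ℂ) :
    (ι → Fin n → ℂ) →L[ℂ] (ι → Fin n → ℂ) :=
  LinearMap.toContinuousLinearMap
    { toFun := fun v k i => ∑ l, ∑ j, h k l i j z * φ l w * (Real.pi * (z - w) : ℂ)⁻¹ * v l j
      map_add' := fun u v => by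
        ext k i
        simp only [Pi.add_apply, mul_add, Finset.sum_add_distrib]
      map_smul' := fun c v => by
        ext k i
        simp only [Pi.smul_apply, smul_eq_mul, RingHom.id_apply, Finset.mul_sum]
        exact Finset.sum_congr rfl fun l _ => Finset.sum_congr rfl fun j _ => by ring }

theorem cousinKernel_apply (h : ι → ι → Fin n → Fin n → ℂ → ℂ) (φ : ι → ℂ → ℂ) (z w : ℂ)
    (v : ι → Fin n → ℂ) (k : ι) (i : Fin n) : cousinKernel h φ z w v k i =
      ∑ l, ∑ j, h k l i j z * φ l w * (Real.pi * (z - w) : ℂ)⁻¹ * v l j := rfl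

theorem continuous_cousinKernel {h : ι → ι → Fin n → Fin n → ℂ → ℂ} {φ : ι → ℂ → ℂ}
    (hh : ∀ k l i j, Continuous (h k l i j)) (hφ : ∀ l, Continuous (φ l))
    (hd : ∀ k l i j, Disjoint (tsupport (h k l i j)) (tsupport (φ l)))
    {X : Type*} [TopologicalSpace X] {f g : X → ℂ} (hf : Continuous f) (hg : Continuous g) :
    Continuous fun x => cousinKernel h φ (f x) (g x) := by
  rw [continuous_clm_apply]
  intro v
  refine continuous_pi fun k => continuous_pi fun i => ?_
  simp only [cousinKernel_apply]
  exact continuous_finsetSum _ fun l _ => continuous_finsetSum _ fun j _ =>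
    ((continuous_mul_cauchyKernel (hh k l i j) (hφ l) (hd k l i j)).comp (hf.prodMk hg)).mul
      continuous_const

/-- The Fredholm alternative with the space of all polynomials as parameter space. The map from
polynomials to right-hand sides need not be injective: it is the polynomial that comes out nonzero.
-/
theorem exists_cousinKernel_solution {h : ι → ι → Fin n → Fin n → ℂ → ℂ} {φ : ι → ℂ → ℂ}
    (hh : ∀ k l i j, Continuous (h k l i j)) (hφ : ∀ l, Continuous (φ l))
    (hd : ∀ k l i j, Disjoint (tsupport (h k l i j)) (tsupport (φ l)))
    {Y : Set ℂ} (hY : IsCompact Y) (o : ι) (ε : Fin n → ℂ) :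
    ∃ p : ℂ[X], p ≠ 0 ∧ ∃ u : C(Y, ι → Fin n → ℂ), ∀ (z : Y) k i, u z k i +
      (∫ w : Y, cousinKernel h φ z w (u w) ∂(volume.comap Subtype.val)) k i =
        ∑ j, h k o i j z * (p.eval (z : ℂ) * ε j) := by
  have hYm : MeasurableSet Y := hY.measurableSet
  have hYc : CompactSpace Y := isCompact_iff_compactSpace.1 hY
  have hν : IsFiniteMeasure ((volume : Measure ℂ).comap (Subtype.val : Y → ℂ)) := ⟨by
    rw [Measure.comap_apply _ Subtype.val_injective (fun s hs => hYm.subtype_image hs) _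
      MeasurableSet.univ, Set.image_univ, Subtype.range_coe]
    exact hY.measure_lt_top⟩
  let q : C(Y × Y, (ι → Fin n → ℂ) →L[ℂ] (ι → Fin n → ℂ)) :=
    ⟨fun p => cousinKernel h φ p.1 p.2, continuous_cousinKernel hh hφ hd
      (continuous_subtype_val.comp continuous_fst) (continuous_subtype_val.comp continuous_snd)⟩
  let f : ℂ[X] →ₗ[ℂ] C(Y, ι → Fin n → ℂ) :=
    { toFun := fun p => ⟨fun z k i => ∑ j, h k o i j z * (p.eval (z : ℂ) * ε j), by
        have := p.continuous
        fun_prop⟩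
      map_add' := fun p r => by
        ext z k i
        simp [mul_add, add_mul, Finset.sum_add_distrib]
      map_smul' := fun c p => by
        ext z k i
        simp only [eval_smul, smul_eq_mul, ContinuousMap.coe_mk, RingHom.id_apply,
          ContinuousMap.smul_apply, Pi.smul_apply, Finset.mul_sum]
        exact Finset.sum_congr rfl fun j _ => by ring }
  obtain ⟨p, hp, u, hu⟩ := exists_integral_equation_solution
    ((volume : Measure ℂ).comap (Subtype.val : Y → ℂ)) q Polynomial.not_finite f
  exact ⟨p, hp, u, fun z k i => congrFun (congrFun (hu z) k) i⟩

theorem integral_cousinKernel_apply {h : ι → ι → Fin n → Fin n → ℂ → ℂ} {φ : ι → ℂ → ℂ}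
    (hh : ∀ k l i j, Continuous (h k l i j)) (hφ : ∀ l, Continuous (φ l))
    (hd : ∀ k l i j, Disjoint (tsupport (h k l i j)) (tsupport (φ l)))
    {Y : Set ℂ} (hY : IsCompact Y) (u : C(Y, ι → Fin n → ℂ)) (z : ℂ) (k : ι) (i : Fin n) :
    (∫ w : Y, cousinKernel h φ z w (u w) ∂(volume.comap Subtype.val)) k i =
      ∑ l, ∑ j, h k l i j z * ∫ w : Y, (Real.pi * (z - w) : ℂ)⁻¹ * (φ l w * u w l j)
        ∂(volume.comap Subtype.val) := by
  have hYm : MeasurableSet Y := hY.measurableSet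
  have hYc : CompactSpace Y := isCompact_iff_compactSpace.1 hY
  have hν : IsFiniteMeasure ((volume : Measure ℂ).comap (Subtype.val : Y → ℂ)) := ⟨by
    rw [Measure.comap_apply _ Subtype.val_injective (fun s hs => hYm.subtype_image hs) _
      MeasurableSet.univ, Set.image_univ, Subtype.range_coe]
    exact hY.measure_lt_top⟩
  have hq : Continuous fun w : Y => cousinKernel h φ z w (u w) :=
    (continuous_cousinKernel hh hφ hd continuous_const continuous_subtype_val).clm_apply
      u.continuous
  have hqi := hq.integrable_of_hasCompactSupport (HasCompactSupport.of_compactSpace _)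
    (μ := (volume : Measure ℂ).comap (Subtype.val : Y → ℂ))
  have h3 := ((ContinuousLinearMap.proj (R := ℂ) (φ := fun _ : Fin n => ℂ) i).comp
      (ContinuousLinearMap.proj (R := ℂ) (φ := fun _ : ι => Fin n → ℂ) k)).integral_comp_comm hqi
  refine h3.symm.trans ?_
  have hcont : ∀ l j, Continuous fun w : Y => h k l i j z * φ l w *
      (Real.pi * (z - w) : ℂ)⁻¹ * u w l j := fun l j =>
    Continuous.mul ((continuous_mul_cauchyKernel (hh k l i j) (hφ l) (hd k l i j)).comp
      (by fun_prop : Continuous fun w : Y => ((z, (w : ℂ)) : ℂ × ℂ))) (by fun_prop)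
  have hint : ∀ l j, Integrable (fun w : Y => h k l i j z * φ l w *
      (Real.pi * (z - w) : ℂ)⁻¹ * u w l j) (volume.comap Subtype.val) := fun l j =>
    (hcont l j).integrable_of_hasCompactSupport (HasCompactSupport.of_compactSpace _)
  change ∫ w : Y, ∑ l, ∑ j, h k l i j z * φ l w * (Real.pi * (z - w) : ℂ)⁻¹ * u w l j
    ∂(volume.comap Subtype.val) = _
  rw [integral_finsetSum _ fun l _ => integrable_finsetSum _ fun j _ => hint l j]
  refine Finset.sum_congr rfl fun l _ => ?_
  rw [integral_finsetSum _ fun j _ => hint l j]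
  refine Finset.sum_congr rfl fun j _ => ?_
  rw [← integral_const_mul]
  exact integral_congr_ae (Eventually.of_forall fun w => by ring)

/-- Solution of the integral equation, in terms of Cauchy transforms. -/
theorem exists_cauchyTransform_equation {h : ι → ι → Fin n → Fin n → ℂ → ℂ} {φ : ι → ℂ → ℂ}
    (hh : ∀ k l i j, Continuous (h k l i j)) (hφ : ∀ l, Continuous (φ l))
    (hd : ∀ k l i j, Disjoint (tsupport (h k l i j)) (tsupport (φ l)))
    {R : ℝ} (hR : ∀ k l i j z, R < ‖z‖ → h k l i j z = 0) (o : ι) (ε : Fin n → ℂ) :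
    ∃ p : ℂ[X], p ≠ 0 ∧ ∃ u : ι → ℂ → Fin n → ℂ, (∀ k, Continuous (u k)) ∧
      (∀ k z, R < ‖z‖ → u k z = 0) ∧
      ∀ k z i, u k z i = (∑ j, h k o i j z * (p.eval z * ε j)) -
        ∑ l, ∑ j, h k l i j z * cauchyTransform (fun w => φ l w • u l w) z j := by
  -- By the equation itself, a solution vanishes where all `h k l i j` do, that is, beyond radius
  -- `R`. The margin `1` therefore makes its extension by zero off `Y` continuous.
  let Y := Metric.closedBall (0 : ℂ) (R + 1)
  have hYk : IsCompact Y := isCompact_closedBall _ _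
  have hYm : MeasurableSet Y := hYk.measurableSet
  obtain ⟨p, hp, u, hu⟩ := exists_cousinKernel_solution hh hφ hd hYk o ε
  simp only [integral_cousinKernel_apply hh hφ hd hYk] at hu
  classical
  obtain ⟨U, hUY, hU0⟩ : ∃ U : ι → ℂ → Fin n → ℂ, (∀ k (z : Y), U k z = u z k) ∧
      ∀ k, ∀ z ∉ Y, U k z = 0 :=
    ⟨fun k z => if hz : z ∈ Y then u ⟨z, hz⟩ k else 0, fun k z => dif_pos z.2,
      fun k z hz => dif_neg hz⟩
  have hUR : ∀ k z, R < ‖z‖ → U k z = 0 := by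
    intro k z hz
    by_cases hzY : z ∈ Y
    · ext i
      have h1 := hu ⟨z, hzY⟩ k i
      simp only [hR _ _ _ _ z hz, zero_mul, Finset.sum_const_zero, add_zero] at h1
      rw [hUY k ⟨z, hzY⟩, h1, Pi.zero_apply]
    · exact hU0 k z hzY
  have hUc : ∀ k, Continuous (U k) := by
    intro k
    rw [continuous_iff_continuousAt]
    intro z
    by_cases hz : R < ‖z‖
    · refine (continuousAt_const (y := (0 : Fin n → ℂ))).congr ?_
      filter_upwards [(isOpen_lt continuous_const continuous_norm).mem_nhds hz] with w hw
      exact (hUR k w hw).symm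
    · have h1 : ContinuousOn (U k) Y := by
        rw [continuousOn_iff_continuous_domRestrict]
        have : Y.domRestrict (U k) = fun z => u z k := funext fun z => hUY k z
        rw [this]
        fun_prop
      refine h1.continuousAt (Metric.closedBall_mem_nhds_of_mem ?_)
      rw [mem_ball_zero_iff]
      linarith [not_lt.1 hz]
  have hGc : ∀ l, Continuous fun w => φ l w • U l w := fun l => (hφ l).smul (hUc l)
  have hGs : ∀ l, HasCompactSupport fun w => φ l w • U l w := fun l =>
    HasCompactSupport.intro (isCompact_closedBall (0 : ℂ) R) fun z hz => by
      have hz' : R < ‖z‖ := by simpa using hz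
      change φ l z • U l z = 0
      rw [hUR l z hz', smul_zero]
  refine ⟨p, hp, U, hUc, hUR, fun k z i => ?_⟩
  by_cases hz : z ∈ Y
  swap
  · have hz' : R < ‖z‖ := by
      have : R + 1 < ‖z‖ := by simpa [Y] using hz
      linarith
    simp [hUR k z hz', hR _ _ _ _ z hz']
  rw [hUY k ⟨z, hz⟩, eq_sub_iff_add_eq]
  refine Eq.trans ?_ (hu ⟨z, hz⟩ k i)
  congr 1
  refine Finset.sum_congr rfl fun l _ => Finset.sum_congr rfl fun j _ => ?_
  rw [cauchyTransform_apply (hGc l) (hGs l)]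
  congr 1
  have h4 : ∀ w : Y, (Real.pi * (z - w) : ℂ)⁻¹ * (φ l w * u w l j) =
      (Real.pi * (z - w) : ℂ)⁻¹ * (φ l w • U l w) j := fun w => by
    rw [hUY, Pi.smul_apply, smul_eq_mul]
  simp only [h4]
  rw [integral_subtype_comap hYm fun w : ℂ =>
    (Real.pi * (z - w) : ℂ)⁻¹ * (φ l w • U l w) j]
  refine (setIntegral_eq_integral_of_forall_compl_eq_zero fun w hw => ?_).symm
  simp [hU0 l w hw]

/-- A holomorphic vector bundle on the sphere, given by a cocycle on a cover of `ℂ` in which only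
`D o` is unbounded, has sections over `ℂ` with a prescribed polynomial principal part at infinity in
a given direction. -/
theorem HolomorphicCocycle.exists_section (hA : HolomorphicCocycle D A) (hD : ∀ k, IsOpen (D k))
    {φ ψ : ι → ℂ → ℂ} (hφ : ∀ k, ContDiff ℝ ∞ (φ k)) (hψ : ∀ k, ContDiff ℝ ∞ (ψ k))
    (hsum : ∀ z, ∑ k, φ k z = 1) (hφD : ∀ k, tsupport (φ k) ⊆ D k)
    (hψD : ∀ k, tsupport (ψ k) ⊆ D k) (hφψ : ∀ k, ∀ z ∈ tsupport (φ k), ψ k =ᶠ[𝓝 z] 1)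
    {o : ι} {R : ℝ} (hR : ∀ z : ℂ, R < ‖z‖ → ψ o =ᶠ[𝓝 z] 1 ∧ ∀ k ≠ o, ψ k =ᶠ[𝓝 z] 0)
    (ε : Fin n → ℂ) :
    ∃ p : ℂ[X], p ≠ 0 ∧ ∃ s : ι → ℂ → Fin n → ℂ, (∀ k, DifferentiableOn ℂ (s k) (D k)) ∧
      (∀ k l, ∀ z ∈ D k, z ∈ D l → (A k l z).mulVec (s l z) = s k z) ∧
      Tendsto (fun z => s o z - p.eval z • ε) (Bornology.cobounded ℂ) (𝓝 0) := by
  classical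
  have hdbar1 : ∀ {χ : ℂ → ℂ} {c z : ℂ}, χ =ᶠ[𝓝 z] (fun _ => c) → dbar χ z = 0 := fun h =>
    ((hasDbarAt_const _ _).congr_of_eventuallyEq h).dbar_eq
  have hdψ : ∀ k, tsupport (dbar (ψ k)) ⊆ D k := fun k =>
    (tsupport_dbar_subset _).trans (hψD k)
  have hdφ : ∀ k, Disjoint (tsupport (dbar (ψ k))) (tsupport (φ k)) := by
    intro k
    rw [Set.disjoint_left]
    intro z hz hz'
    refine (notMem_tsupport_iff_eventuallyEq.2 ?_) hz
    filter_upwards [eventually_eventuallyEq_nhds.2 (hφψ k z hz')] with w hw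
    exact hdbar1 hw
  have hdR : ∀ k z, R < ‖z‖ → dbar (ψ k) z = 0 := by
    intro k z hz
    by_cases hk : k = o
    · subst hk
      exact hdbar1 (hR z hz).1
    · exact hdbar1 ((hR z hz).2 k hk)
  -- The factor `ψ k` lets `A k l` be continued by zero off `D k`. It does no harm, since `u k`
  -- enters only through `φ k • u k` and `ψ k = 1` on the support of `φ k`.
  let h : ι → ι → Fin n → Fin n → ℂ → ℂ := fun k l i j z =>
    ψ k z * (dbar (ψ l) z * A k l z i j)
  have hh : ∀ k l i j, Continuous (h k l i j) := by
    intro k l i j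
    have h1 : Continuous (ψ k) := (hψ k).continuous
    have h2 : Continuous (dbar (ψ l)) := (hψ l).dbar.continuous
    rw [continuous_iff_continuousAt]
    intro z
    by_cases hk : z ∈ tsupport (ψ k)
    · by_cases hl : z ∈ tsupport (dbar (ψ l))
      · have h3 := (hA.differentiableOn k l i j).continuousOn.continuousAt
          (((hD k).inter (hD l)).mem_nhds ⟨hψD k hk, hdψ l hl⟩)
        exact h1.continuousAt.mul (h2.continuousAt.mul h3)
      · refine (continuousAt_const (y := (0 : ℂ))).congr ?_
        filter_upwards [notMem_tsupport_iff_eventuallyEq.1 hl] with w hw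
        simp [h, hw]
    · refine (continuousAt_const (y := (0 : ℂ))).congr ?_
      filter_upwards [notMem_tsupport_iff_eventuallyEq.1 hk] with w hw
      simp [h, hw]
  have hd : ∀ k l i j, Disjoint (tsupport (h k l i j)) (tsupport (φ l)) := fun k l i j =>
    (hdφ l).mono_left ((tsupport_mul_subset_right).trans tsupport_mul_subset_left)
  obtain ⟨p, hp, u, huc, huR, hu⟩ := exists_cauchyTransform_equation hh
    (fun l => (hφ l).continuous) hd (R := R)
    (fun k l i j z hz => by simp [h, hdR l z hz]) o ε
  refine ⟨p, hp, ?_⟩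
  -- Here `∂̄ (t k) = -G k`, so `∂̄` of the section `cutoffSum A ψ t` in the frame `m` is `cutoffSum
  -- A (dbar ψ) t m - ∑ ψ k • A m k • G k`. The integral equation says that `G k` is `φ k` times the
  -- first term read in the frame `k`; as `∑ φ k = 1`, the two terms cancel.
  let G : ι → ℂ → Fin n → ℂ := fun k z => φ k z • u k z
  let t : ι → ℂ → Fin n → ℂ := fun k z j =>
    (if k = o then p.eval z * ε j else 0) - cauchyTransform (G k) z j
  have hGc : ∀ k, Continuous (G k) := fun k => (hφ k).continuous.smul (huc k)
  have hGs : ∀ k, HasCompactSupport (G k) := fun l =>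
    HasCompactSupport.intro (isCompact_closedBall (0 : ℂ) R) fun z hz => by
      have hz' : R < ‖z‖ := by simpa using hz
      change φ l z • u l z = 0
      rw [huR l z hz', smul_zero]
  have hGφ : ∀ k, tsupport (G k) ⊆ tsupport (φ k) := fun k =>
    closure_mono fun z hz hz' => hz (by change φ k z • u k z = 0; rw [hz', zero_smul])
  have hu' : ∀ k z, u k z = ψ k z • cutoffSum A (fun l => dbar (ψ l)) t k z := by
    intro k z
    ext i
    rw [hu, Pi.smul_apply, cutoffSum_apply, smul_eq_mul, Finset.mul_sum]
    have : ∑ j, h k o i j z * (p.eval z * ε j) =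
        ∑ l, ∑ j, h k l i j z * (if l = o then p.eval z * ε j else 0) := by
      rw [Finset.sum_eq_single_of_mem o (Finset.mem_univ o) fun l _ hl => by simp [hl]]
      simp
    rw [this, ← Finset.sum_sub_distrib]
    refine Finset.sum_congr rfl fun l _ => ?_
    rw [← Finset.sum_sub_distrib, Finset.mul_sum]
    refine Finset.sum_congr rfl fun j _ => ?_
    simp only [t, h, G]
    ring
  have hG : ∀ k z, G k z = φ k z • cutoffSum A (fun l => dbar (ψ l)) t k z := by
    intro k z
    by_cases hz : φ k z = 0
    · simp [G, hz]
    · have := (hφψ k z (subset_tsupport _ hz)).self_of_nhds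
      change φ k z • u k z = _
      rw [hu', this, Pi.one_apply, one_smul]
  have hpd : ∀ (k : ι) (j : Fin n), Differentiable ℂ fun z : ℂ =>
      if k = o then p.eval z * ε j else 0 := by
    intro k j
    by_cases hk : k = o
    · simp only [hk, if_true]
      exact p.differentiable.mul_const _
    · simp [hk]
  -- A bootstrap: `G` is so far only continuous. On the support of `dbar (ψ l)`, which misses that
  -- of `G l`, the function `t l` is holomorphic, so the formula `hG` shows that `G` is `C¹`, as
  -- needed to apply `∂̄` to its Cauchy transform.
  have hGd : ∀ k, ContDiff ℝ 1 (G k) := by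
    intro k
    rw [contDiff_pi]
    intro i
    have hGi : ∀ w, G k w i = φ k w * cutoffSum A (fun l => dbar (ψ l)) t k w i := fun w => by
      rw [hG, Pi.smul_apply, smul_eq_mul]
    rw [contDiff_iff_contDiffAt]
    intro z
    simp only [hGi]
    by_cases hz : z ∈ tsupport (φ k)
    · refine ((hφ k).contDiffAt.of_le (by simp)).mul
        (contDiffAt_cutoffSum hD hA (fun l => (hψ l).dbar) hdψ (hφD k hz) (fun l j hl => ?_) i)
      have hz' : z ∉ tsupport (G l) := fun h' => Set.disjoint_left.1 (hdφ l) hl (hGφ l h')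
      have h1 : DifferentiableOn ℂ (fun w => t l w j) (tsupport (G l))ᶜ := fun w hw =>
        ((hpd l j w).sub (differentiableAt_pi.1
          (differentiableAt_cauchyTransform (hGc l) (hGs l) hw) j)).differentiableWithinAt
      exact (h1.analyticAt ((isClosed_tsupport _).isOpen_compl.mem_nhds
        hz')).contDiffAt.restrict_scalars ℝ
    · refine (contDiffAt_const (c := (0 : ℂ))).congr_of_eventuallyEq ?_
      filter_upwards [notMem_tsupport_iff_eventuallyEq.1 hz] with w hw
      simp [hw]
  have ht : ∀ z k i, HasDbarAt (fun w => t k w i) (-G k z i) z := by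
    intro z k i
    have h1 := (hasFDerivAt_cauchyTransform (hGd k) (hGs k) z).differentiableAt.hasDbarAt
    rw [dbar_cauchyTransform (hGd k) (hGs k)] at h1
    simpa using (hpd k i z).hasDbarAt_zero.sub (h1.apply i)
  have hψD' : ∀ k z, ψ k z ≠ 0 → z ∈ D k := fun k z hz => hψD k (subset_tsupport _ hz)
  have hdψD' : ∀ k z, dbar (ψ k) z ≠ 0 → z ∈ D k := fun k z hz => hdψ k (subset_tsupport _ hz)
  refine ⟨cutoffSum A ψ t, fun m z hz => ?_, fun k l z hk hl => mulVec_cutoffSum hA hψD' t hk hl,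
    ?_⟩
  · refine DifferentiableAt.differentiableWithinAt (differentiableAt_pi.2 fun i => ?_)
    have h1 := hasDbarAt_cutoffSum hD hA hψ hψD (t' := fun k z i => -G k z i) hz
      (fun k i => ht z k i) i
    have h2 : cutoffSum A ψ (fun k z i => -G k z i) m z =
        - cutoffSum A (fun k => dbar (ψ k)) t m z := by
      have h3 : ∀ k, ψ k z • (A m k z).mulVec (-G k z) =
          -(φ k z • cutoffSum A (fun k => dbar (ψ k)) t m z) := by
        intro k
        rw [hG]
        by_cases hk : φ k z = 0
        · simp [hk]
        · have hk' := subset_tsupport _ hk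
          rw [(hφψ k z hk').self_of_nhds, Pi.one_apply, one_smul, Matrix.mulVec_neg,
            Matrix.mulVec_smul, mulVec_cutoffSum hA hdψD' t hz (hφD k hk')]
      change ∑ k, ψ k z • (A m k z).mulVec (-G k z) = _
      rw [Finset.sum_congr rfl fun k _ => h3 k, Finset.sum_neg_distrib, ← Finset.sum_smul, hsum,
        one_smul]
    rw [h2, Pi.neg_apply, add_neg_cancel] at h1
    exact h1.differentiableAt
  -- Beyond radius `R` only the summand `o` survives, with `ψ o = 1`, and the section differs from
  -- its principal part by `-cauchyTransform (G o)`.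
  · have h1 := (tendsto_cauchyTransform_cobounded (hGc o) (hGs o)).neg
    rw [neg_zero] at h1
    refine h1.congr' ?_
    filter_upwards [tendsto_norm_cobounded_atTop.eventually_gt_atTop R] with z hz
    have h2 := (hR z hz).1.self_of_nhds
    rw [cutoffSum_eq_of_eq_zero hA t (hψD o (subset_tsupport _ (by simp [h2]))) h2
      fun k hk => ((hR z hz).2 k hk).self_of_nhds]
    ext j
    simp [t]

end Cousin

/-! ### Lattices of meromorphic sections on the sphere -/

namespace RiemannSphere

/-- The affine coordinate, with the value `0` at infinity. -/
def coordinate (y : OnePoint ℂ) : ℂ := y.elim 0 id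

@[simp] theorem coordinate_coe (z : ℂ) : coordinate (z : OnePoint ℂ) = z := rfl

/-- A local parametrization of the sphere sending `0` to `x`. -/
def param (x : OnePoint ℂ) (t : ℂ) : OnePoint ℂ :=
  x.elim (inversion (t : OnePoint ℂ)) fun a => ((a + t : ℂ) : OnePoint ℂ)

@[simp] theorem param_coe (a t : ℂ) : param (a : OnePoint ℂ) t = ((a + t : ℂ) : OnePoint ℂ) := rfl

theorem param_infty {t : ℂ} (ht : t ≠ 0) :
    param OnePoint.infty t = ((t⁻¹ : ℂ) : OnePoint ℂ) := inversion_coe ht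

/-- The transition function of `𝒪(d)` in the parametrization around `x`: the function `z⁻ᵈ` near
infinity, and `1` elsewhere. -/
def gauge (x : OnePoint ℂ) (d : ℤ) (t : ℂ) : ℂ := x.elim (t ^ d) fun _ => 1

@[simp] theorem gauge_coe (a : ℂ) (d : ℤ) (t : ℂ) : gauge (a : OnePoint ℂ) d t = 1 := rfl

@[simp] theorem gauge_infty (d : ℤ) (t : ℂ) : gauge OnePoint.infty d t = t ^ d := rfl

theorem gauge_ne_zero (x : OnePoint ℂ) (d : ℤ) {t : ℂ} (ht : t ≠ 0) : gauge x d t ≠ 0 := by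
  induction x using OnePoint.rec with
  | infty => exact zpow_ne_zero d ht
  | coe a => exact one_ne_zero

section Lattice

variable {n : ℕ} {E : OnePoint ℂ → Type*} [∀ x, AddCommGroup (E x)] [∀ x, Module ℂ (E x)]

/-- Near `x`, the sections `σᵢ` twisted by `dᵢ` are given in the frame `e` by the matrix `f` of
holomorphic functions of the local parameter at `x`. -/
structure IsTwistedMatrix (e : Fin n → ∀ y, E y) (x : OnePoint ℂ) (σ : Fin n → ∀ y, E y)
    (d : Fin n → ℤ) (f : ℂ → Matrix (Fin n) (Fin n) ℂ) : Prop where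
  analyticAt : ∀ i k, AnalyticAt ℂ (fun t => f t i k) 0
  eq : ∀ᶠ t in 𝓝[≠] 0, ∀ i,
    gauge x (d i) t • σ i (param x t) = ∑ k, f t i k • e k (param x t)

variable {e : Fin n → ∀ y, E y} {x : OnePoint ℂ} {σ : Fin n → ∀ y, E y} {d : Fin n → ℤ}
  {f : ℂ → Matrix (Fin n) (Fin n) ℂ}

theorem analyticAt_det {f : ℂ → Matrix (Fin n) (Fin n) ℂ} {a : ℂ}
    (hf : ∀ i k, AnalyticAt ℂ (fun t => f t i k) a) : AnalyticAt ℂ (fun t => (f t).det) a := by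
  simp only [Matrix.det_apply']
  exact Finset.analyticAt_fun_sum _ fun s _ =>
    analyticAt_const.mul (Finset.analyticAt_fun_prod _ fun i _ => hf _ _)

/-- Replacing a section by a combination of the sections. -/
theorem IsTwistedMatrix.update (hf : IsTwistedMatrix e x σ d f) (j : Fin n) (m : ℤ)
    (b : Fin n → OnePoint ℂ → ℂ) (g : ℂ → Fin n → ℂ) (β : Fin n → ℂ → ℂ)
    (hg : ∀ k, AnalyticAt ℂ (fun t => g t k) 0)
    (hβ : ∀ᶠ t in 𝓝[≠] 0, ∀ i, gauge x m t * b i (param x t) = β i t * gauge x (d i) t)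
    (hgβ : ∀ᶠ t in 𝓝[≠] 0, ∀ k, g t k = ∑ i, β i t * f t i k) :
    IsTwistedMatrix e x (Function.update σ j fun y => ∑ i, b i y • σ i y) (Function.update d j m)
      (fun t => (f t).updateRow j (g t)) := by
  refine ⟨fun i k => ?_, ?_⟩
  · by_cases hi : i = j
    · subst hi
      simpa using hg k
    · simpa [Matrix.updateRow_ne hi] using hf.analyticAt i k
  · filter_upwards [hf.eq, hβ, hgβ] with t h1 h2 h3 i
    by_cases hi : i = j
    · subst hi
      simp only [Function.update_self, Matrix.updateRow_self, h3, Finset.sum_smul, Finset.smul_sum]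
      rw [Finset.sum_comm]
      refine Finset.sum_congr rfl fun l _ => ?_
      rw [smul_smul, h2, mul_smul, h1, Finset.smul_sum]
      simp only [mul_smul]
    · simpa [Function.update_of_ne hi, Matrix.updateRow_ne hi] using h1 i

/-- Used at points other than the zero being removed: replacing row `j` by a combination of rows
multiplies the determinant by `β j`, a unit at `0`. -/
theorem IsTwistedMatrix.update_of_analyticAt (hf : IsTwistedMatrix e x σ d f) (j : Fin n) (m : ℤ)
    (b : Fin n → OnePoint ℂ → ℂ) (β : Fin n → ℂ → ℂ) (hβa : ∀ i, AnalyticAt ℂ (β i) 0)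
    (hβ0 : β j 0 ≠ 0)
    (hβ : ∀ᶠ t in 𝓝[≠] 0, ∀ i, gauge x m t * b i (param x t) = β i t * gauge x (d i) t) :
    ∃ f', IsTwistedMatrix e x (Function.update σ j fun y => ∑ i, b i y • σ i y)
      (Function.update d j m) f' ∧
      analyticOrderAt (fun t => (f' t).det) 0 = analyticOrderAt (fun t => (f t).det) 0 := by
  refine ⟨_, hf.update j m b (fun t k => ∑ i, β i t * f t i k) β
    (fun k => Finset.analyticAt_fun_sum _ fun i _ => (hβa i).mul (hf.analyticAt i k)) hβ
    (Eventually.of_forall fun t k => rfl), ?_⟩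
  have h1 : (fun t => ((f t).updateRow j fun k => ∑ i, β i t * f t i k).det) =
      β j * fun t => (f t).det := by
    ext t
    have h2 := Matrix.det_updateRow_sum (f t) j fun i => β i t
    simp only [smul_eq_mul] at h2
    rw [Pi.mul_apply, ← h2]
    congr 2
    ext k
    simp
  rw [h1, analyticOrderAt_mul (hβa j) (analyticAt_det hf.analyticAt),
    (hβa j).analyticOrderAt_eq_zero.2 hβ0, zero_add]

/-- Used at the zero being removed: the combination of rows with coefficients `c` vanishes at `t =
0`, so it is divisible by `t`. The new determinant is `c j * t⁻¹` times the old one, and its order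
drops by one. -/
theorem IsTwistedMatrix.update_of_vecMul_eq_zero (hf : IsTwistedMatrix e x σ d f) (j : Fin n)
    (m : ℤ) (b : Fin n → OnePoint ℂ → ℂ) (c : Fin n → ℂ) (hc : Matrix.vecMul c (f 0) = 0)
    (hcj : c j ≠ 0)
    (hβ : ∀ᶠ t in 𝓝[≠] 0, ∀ i, gauge x m t * b i (param x t) = c i * t⁻¹ * gauge x (d i) t) :
    ∃ f', IsTwistedMatrix e x (Function.update σ j fun y => ∑ i, b i y • σ i y)
      (Function.update d j m) f' ∧
      analyticOrderAt (fun t => (f' t).det) 0 + 1 = analyticOrderAt (fun t => (f t).det) 0 := by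
  have hg : ∀ k, ∃ g : ℂ → ℂ, AnalyticAt ℂ g 0 ∧ ∀ᶠ t in 𝓝 0, ∑ i, c i * f t i k = t * g t := by
    intro k
    have h1 : AnalyticAt ℂ (fun t => ∑ i, c i * f t i k) 0 :=
      Finset.analyticAt_fun_sum _ fun i _ => analyticAt_const.mul (hf.analyticAt i k)
    have h2 : ((1 : ℕ) : ℕ∞) ≤ analyticOrderAt (fun t => ∑ i, c i * f t i k) 0 := by
      rw [Nat.cast_one, Order.one_le_iff_ne_zero, h1.analyticOrderAt_ne_zero]
      exact congrFun hc k
    obtain ⟨g, hg, h⟩ := (natCast_le_analyticOrderAt h1).1 h2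
    exact ⟨g, hg, by simpa using h⟩
  choose g hga hg using hg
  have hg' : ∀ᶠ t in 𝓝 (0 : ℂ), ∀ k, ∑ i, c i * f t i k = t * g k t := eventually_all.2 hg
  have h := hf.update j m b (fun t k => g k t) (fun i t => c i * t⁻¹) hga hβ (by
    filter_upwards [hg'.filter_mono nhdsWithin_le_nhds, self_mem_nhdsWithin] with t ht ht0 k
    have ht0 : t ≠ 0 := ht0
    have : ∑ i, c i * t⁻¹ * f t i k = t⁻¹ * ∑ i, c i * f t i k := by
      rw [Finset.mul_sum]
      exact Finset.sum_congr rfl fun i _ => by ring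
    rw [this, ht, inv_mul_cancel_left₀ ht0])
  refine ⟨_, h, ?_⟩
  have h1 : (fun t => t * ((f t).updateRow j fun k => g k t).det) =ᶠ[𝓝 0]
      fun t => c j * (f t).det := by
    filter_upwards [hg'] with t ht
    have h2 := Matrix.det_updateRow_sum (f t) j c
    rw [smul_eq_mul] at h2
    rw [← h2, ← Matrix.det_updateRow_smul]
    congr 2
    ext k
    simp [← ht k]
  have h3 := analyticOrderAt_congr h1
  have h4 : analyticOrderAt (fun t : ℂ => t) 0 = 1 := analyticOrderAt_id
  have h5 : analyticOrderAt (fun _ : ℂ => c j) (0 : ℂ) = 0 :=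
    (analyticAt_const.analyticOrderAt_eq_zero).2 hcj
  have h6 := analyticOrderAt_mul (f := fun t : ℂ => t) analyticAt_id (analyticAt_det h.analyticAt)
  have h7 := analyticOrderAt_mul (f := fun _ : ℂ => c j) (z₀ := 0) analyticAt_const
    (analyticAt_det hf.analyticAt)
  rw [h4] at h6
  rw [h5, zero_add] at h7
  rw [add_comm, ← h6, ← h7]
  exact h3

open Classical in
/-- A system of sections which is generically a basis can be modified, and the twists lowered, until
it is a basis of the given lattice everywhere. -/
theorem exists_isTwistedMatrix_det_ne_zero (e : OnePoint ℂ → Fin n → ∀ y, E y)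
    (D : Multiset (OnePoint ℂ)) (σ : Fin n → ∀ y, E y) (d : Fin n → ℤ)
    (h : ∀ x, ∃ f, IsTwistedMatrix (e x) x σ d f ∧
      analyticOrderAt (fun t => (f t).det) 0 ≤ D.count x) :
    ∃ (σ : Fin n → ∀ y, E y) (d : Fin n → ℤ), ∀ x, ∃ f, IsTwistedMatrix (e x) x σ d f ∧
      (f 0).det ≠ 0 := by
  induction hN : D.card using Nat.strong_induction_on generalizing D σ d with
  | _ N ih =>
  by_cases hall : ∀ x, ∃ f, IsTwistedMatrix (e x) x σ d f ∧ (f 0).det ≠ 0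
  · exact ⟨σ, d, hall⟩
  push Not at hall
  obtain ⟨p, hp⟩ := hall
  obtain ⟨F, hF, hFD⟩ := h p
  have hF0 := hp F hF
  have hpD : p ∈ D := by
    rw [← Multiset.count_ne_zero]
    intro h0
    rw [h0, Nat.cast_zero, nonpos_iff_eq_zero,
      (analyticAt_det hF.analyticAt).analyticOrderAt_eq_zero] at hFD
    exact hFD hF0
  obtain ⟨c, hc0, hc⟩ := Matrix.exists_vecMul_eq_zero_iff.2 hF0
  -- Maximality of the twist `d j` makes every exponent `d j - d i` with `c i ≠ 0` nonnegative. So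
  -- `z ^ (d j - d i)` is holomorphic on `ℂ` (for `p = ∞`), and `t ^ (d j - d i)` is holomorphic at
  -- infinity (for `p` finite).
  obtain ⟨j, hj, hmax⟩ := Finset.exists_max_image {i | c i ≠ 0} d (by
    obtain ⟨i, hi⟩ := Function.ne_iff.1 hc0
    exact ⟨i, by simpa using hi⟩)
  simp only [Finset.mem_filter, Finset.mem_univ, true_and] at hj hmax
  have hpow : ∀ i, c i ≠ 0 → (((d j - d i).toNat : ℕ) : ℤ) = d j - d i := fun i hi =>
    Int.toNat_of_nonneg (by linarith [hmax i hi])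
  -- For finite `p = a`, the division by `z - a` introduces a simple zero at infinity, which
  -- lowering the twist by one absorbs. For `p = ∞`, lowering the twist is itself the division by
  -- `t`, and the powers of `z` only bring the sections to a common twist.
  let b : Fin n → OnePoint ℂ → ℂ := fun i y =>
    p.elim (c i * coordinate y ^ (d j - d i)) fun a => c i * (coordinate y - a)⁻¹
  refine ih (D.erase p).card ?_ (D.erase p) (Function.update σ j fun y => ∑ i, b i y • σ i y)
    (Function.update d j (d j - 1)) (fun x => ?_) rfl
  · rw [← hN]
    exact Multiset.card_erase_lt_of_mem hpD
  by_cases hx : x = p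
  · subst hx
    obtain ⟨f', hf', hord⟩ := hF.update_of_vecMul_eq_zero j (d j - 1) b c hc hj (by
      filter_upwards [self_mem_nhdsWithin] with t ht i
      have ht : t ≠ 0 := ht
      induction x using OnePoint.rec with
      | infty =>
        change t ^ (d j - 1) * (c i * coordinate (param OnePoint.infty t) ^ (d j - d i)) = _
        rw [param_infty ht, coordinate_coe, gauge_infty, inv_zpow', mul_left_comm, ← zpow_add₀ ht,
          mul_assoc, ← zpow_neg_one, ← zpow_add₀ ht]
        congr 2
        ring
      | coe a =>
        change 1 * (c i * (coordinate (param (a : OnePoint ℂ) t) - a)⁻¹) = c i * t⁻¹ * 1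
        simp)
    refine ⟨f', hf', ?_⟩
    rw [← hord] at hFD
    rw [← Multiset.cons_erase hpD, Multiset.count_cons_self, Nat.cast_add, Nat.cast_one] at hFD
    exact (ENat.add_le_add_iff_right ENat.one_ne_top).1 hFD
  · obtain ⟨f, hf, hfD⟩ := h x
    have hcount : (D.erase p).count x = D.count x := Multiset.count_erase_of_ne hx D
    rw [← hcount] at hfD
    suffices ∃ β : Fin n → ℂ → ℂ, (∀ i, AnalyticAt ℂ (β i) 0) ∧ β j 0 ≠ 0 ∧
        ∀ᶠ t in 𝓝[≠] 0, ∀ i, gauge x (d j - 1) t * b i (param x t) = β i t * gauge x (d i) t by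
      obtain ⟨β, h1, h2, h3⟩ := this
      obtain ⟨f', hf', hord⟩ := hf.update_of_analyticAt j (d j - 1) b β h1 h2 h3
      exact ⟨f', hf', hord ▸ hfD⟩
    induction x using OnePoint.rec with
    | infty =>
      induction p using OnePoint.rec with
      | infty => exact absurd rfl hx
      | coe a =>
        refine ⟨fun i t => c i * t ^ (d j - d i).toNat * (1 - a * t)⁻¹, fun i => ?_, ?_, ?_⟩
        · refine (by fun_prop : AnalyticAt ℂ (fun t : ℂ => c i * t ^ (d j - d i).toNat) 0).mul
            (AnalyticAt.inv (by fun_prop) (by simp))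
        · simpa using hj
        · have h1 : ∀ᶠ t : ℂ in 𝓝 0, 1 - a * t ≠ 0 :=
            ContinuousAt.eventually_ne (by fun_prop) (by simp)
          filter_upwards [h1.filter_mono nhdsWithin_le_nhds, self_mem_nhdsWithin] with t h1 ht i
          have ht : t ≠ 0 := ht
          change t ^ (d j - 1) * (c i * (coordinate (param OnePoint.infty t) - a)⁻¹) = _
          rw [param_infty ht, coordinate_coe, gauge_infty]
          by_cases hi : c i = 0
          · simp [hi]
          · rw [← zpow_natCast, hpow i hi]
            have h2 : (t⁻¹ - a)⁻¹ = t * (1 - a * t)⁻¹ := by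
              rw [show t⁻¹ - a = (1 - a * t) * t⁻¹ by field_simp, mul_inv, inv_inv, mul_comm]
            rw [h2, zpow_sub₀ ht, zpow_sub₀ ht, zpow_one]
            field_simp
    | coe x₀ =>
      induction p using OnePoint.rec with
      | infty =>
        refine ⟨fun i t => c i * (x₀ + t) ^ (d j - d i).toNat, fun i => by fun_prop, ?_, ?_⟩
        · simpa using hj
        · refine Eventually.of_forall fun t i => ?_
          change 1 * (c i * (x₀ + t) ^ (d j - d i)) = c i * (x₀ + t) ^ (d j - d i).toNat * 1
          by_cases hi : c i = 0
          · simp [hi]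
          · rw [← zpow_natCast, hpow i hi]
            simp
      | coe a =>
        have hxa : x₀ - a ≠ 0 := sub_ne_zero.2 fun h => hx (by rw [h])
        refine ⟨fun i t => c i * (x₀ + t - a)⁻¹, fun i => ?_, ?_, ?_⟩
        · exact analyticAt_const.mul (AnalyticAt.inv (by fun_prop) (by simpa using hxa))
        · simpa using ⟨hj, hxa⟩
        · refine Eventually.of_forall fun t i => ?_
          change 1 * (c i * (x₀ + t - a)⁻¹) = c i * (x₀ + t - a)⁻¹ * 1
          ring

end Lattice

end RiemannSphere

/-! ### Holomorphic functions in local parameters -/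

namespace RiemannSphere

theorem isOpenEmbedding_param (x : OnePoint ℂ) : IsOpenEmbedding (param x) := by
  induction x using OnePoint.rec with
  | infty => exact inversionHomeomorph.isOpenEmbedding.comp OnePoint.isOpenEmbedding_coe
  | coe a => exact OnePoint.isOpenEmbedding_coe.comp (Homeomorph.addLeft a).isOpenEmbedding

@[simp] theorem param_zero (x : OnePoint ℂ) : param x 0 = x := by
  induction x using OnePoint.rec with
  | infty => exact inversion_zero
  | coe a => simp

theorem map_param_nhds (x : OnePoint ℂ) : map (param x) (𝓝 0) = 𝓝 x := by
  rw [(isOpenEmbedding_param x).map_nhds_eq, param_zero]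

theorem map_param_nhdsNE (x : OnePoint ℂ) : map (param x) (𝓝[≠] 0) = 𝓝[≠] x := by
  have h := (isOpenEmbedding_param x).map_nhdsWithin_preimage_eq {x}ᶜ 0
  rw [param_zero] at h
  rw [← h]
  congr 2
  ext t
  simp only [Set.mem_compl_iff, Set.mem_singleton_iff, Set.mem_preimage, not_iff_not]
  exact ⟨fun h => h ▸ param_zero x,
    fun h => (isOpenEmbedding_param x).injective (h.trans (param_zero x).symm)⟩

theorem eventually_nhdsNE_iff_param {x : OnePoint ℂ} {P : OnePoint ℂ → Prop} :
    (∀ᶠ y in 𝓝[≠] x, P y) ↔ ∀ᶠ t in 𝓝[≠] 0, P (param x t) := by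
  rw [← map_param_nhdsNE, eventually_map]

/-- The local parameter at `x`, inverse to `param x`. -/
def localParam (x y : OnePoint ℂ) : ℂ :=
  x.elim (coordinate (inversion y)) fun a => coordinate y - a

@[simp] theorem localParam_param (x : OnePoint ℂ) (t : ℂ) : localParam x (param x t) = t := by
  induction x using OnePoint.rec with
  | infty =>
    change coordinate (inversion (inversion (t : OnePoint ℂ))) = t
    rw [inversion_involutive, coordinate_coe]
  | coe a =>
    change coordinate ((a + t : ℂ) : OnePoint ℂ) - a = t
    simp

theorem chartAt_symm_apply (x : OnePoint ℂ) (z : ℂ) :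
    (chartAt ℂ x).symm z = param x (z - chartAt ℂ x x) := by
  induction x using OnePoint.rec with
  | infty =>
    have h1 : chartAt ℂ (OnePoint.infty : OnePoint ℂ) = inftyChart := if_pos rfl
    rw [h1, inftyChart_symm, inftyChart_apply, inversion_infty, affineChart_coe, sub_zero]
    rfl
  | coe a =>
    have h1 : chartAt ℂ (a : OnePoint ℂ) = affineChart := if_neg (OnePoint.coe_ne_infty a)
    rw [h1, affineChart_symm, affineChart_coe, param_coe, add_sub_cancel]

/-- A function on the sphere is holomorphic at `x` if it is analytic in the local parameter. -/
def HolAt (g : OnePoint ℂ → ℂ) (x : OnePoint ℂ) : Prop := AnalyticAt ℂ (fun t => g (param x t)) 0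

theorem HolAt.continuousAt {g : OnePoint ℂ → ℂ} {x : OnePoint ℂ} (hg : HolAt g x) :
    ContinuousAt g x := by
  have h := AnalyticAt.continuousAt hg
  rw [ContinuousAt, param_zero] at h
  rwa [ContinuousAt, ← map_param_nhds x, tendsto_map'_iff]

theorem HolAt.mul {g h : OnePoint ℂ → ℂ} {x : OnePoint ℂ} (hg : HolAt g x) (hh : HolAt h x) :
    HolAt (fun y => g y * h y) x := AnalyticAt.mul hg hh

theorem HolAt.const (c : ℂ) (x : OnePoint ℂ) : HolAt (fun _ => c) x := analyticAt_const

theorem HolAt.inv {g : OnePoint ℂ → ℂ} {x : OnePoint ℂ} (hg : HolAt g x) (h0 : g x ≠ 0) :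
    HolAt (fun y => (g y)⁻¹) x := AnalyticAt.inv hg (by rwa [param_zero])

theorem HolAt.sum {ι : Type*} (s : Finset ι) {g : ι → OnePoint ℂ → ℂ} {x : OnePoint ℂ}
    (hg : ∀ i ∈ s, HolAt (g i) x) : HolAt (fun y => ∑ i ∈ s, g i y) x :=
  Finset.analyticAt_fun_sum s hg

theorem holAt_comp_localParam {f : ℂ → ℂ} (hf : AnalyticAt ℂ f 0) (x : OnePoint ℂ) :
    HolAt (fun y => f (localParam x y)) x := by
  simpa [HolAt] using hf

theorem HolAt.eventuallyEq_of_nhdsNE {g h : OnePoint ℂ → ℂ} {x : OnePoint ℂ} (hg : HolAt g x)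
    (hh : HolAt h x) (hgh : ∀ᶠ y in 𝓝[≠] x, g y = h y) : g =ᶠ[𝓝 x] h := by
  have h1 := (AnalyticAt.frequently_eq_iff_eventually_eq hg hh).1
    (eventually_nhdsNE_iff_param.1 hgh).frequently
  rw [← map_param_nhds x]
  exact h1

/-- Change of the local parameter. -/
theorem exists_param_comp (x : OnePoint ℂ) (t₀ : ℂ) : ∃ φ : ℂ → ℂ, AnalyticAt ℂ φ 0 ∧ φ 0 = t₀ ∧
    ∀ᶠ t in 𝓝 0, param (param x t₀) t = param x (φ t) := by
  induction x using OnePoint.rec with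
  | infty =>
    by_cases h0 : t₀ = 0
    · subst h0
      exact ⟨id, analyticAt_id, rfl, by simp⟩
    · refine ⟨fun t => (t₀⁻¹ + t)⁻¹, AnalyticAt.inv (by fun_prop) (by simpa using h0), by simp, ?_⟩
      have h1 : ∀ᶠ t : ℂ in 𝓝 0, t₀⁻¹ + t ≠ 0 :=
        ContinuousAt.eventually_ne (by fun_prop) (by simpa using h0)
      filter_upwards [h1] with t ht
      rw [param_infty h0, param_coe, param_infty (inv_ne_zero ht), inv_inv]
  | coe a =>
    refine ⟨fun t => t₀ + t, by fun_prop, by simp, ?_⟩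
    simp [add_assoc]

theorem holAt_param {g : OnePoint ℂ → ℂ} {x : OnePoint ℂ} {t₀ : ℂ}
    (h : AnalyticAt ℂ (fun t => g (param x t)) t₀) : HolAt g (param x t₀) := by
  obtain ⟨φ, hφ, h0, hx⟩ := exists_param_comp x t₀
  rw [← h0] at h
  refine (AnalyticAt.comp (g := fun t => g (param x t)) h hφ).congr ?_
  filter_upwards [hx] with t ht
  simp [ht]

theorem HolAt.eventually {g : OnePoint ℂ → ℂ} {x : OnePoint ℂ} (hg : HolAt g x) :
    ∀ᶠ y in 𝓝 x, HolAt g y := by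
  rw [← map_param_nhds x, eventually_map]
  filter_upwards [AnalyticAt.eventually_analyticAt hg] with t ht using holAt_param ht

/-- The extension by zero of a function on an open set. -/
def extendFun {U : Opens (OnePoint ℂ)} (f : U → ℂ) (x : OnePoint ℂ) : ℂ :=
  open Classical in if h : x ∈ U then f ⟨x, h⟩ else 0

@[simp] theorem extendFun_coe {U : Opens (OnePoint ℂ)} (f : U → ℂ) (x : U) : extendFun f x = f x :=
  dif_pos x.2

theorem eventually_chartAt_symm {U : Opens (OnePoint ℂ)} (x : U) : ∀ᶠ t in 𝓝 (0 : ℂ),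
    (((chartAt ℂ x).symm (t + chartAt ℂ (x : OnePoint ℂ) x) : U) : OnePoint ℂ) = param x t := by
  have h := U.chartAt_subtype_val_symm_eventuallyEq (H := ℂ) (x := x)
  have h2 : Tendsto (fun t : ℂ => t + chartAt ℂ (x : OnePoint ℂ) x) (𝓝 0)
      (𝓝 (chartAt ℂ (x : OnePoint ℂ) x)) := by
    have : ContinuousAt (fun t : ℂ => t + chartAt ℂ (x : OnePoint ℂ) x) 0 := by fun_prop
    simpa [ContinuousAt] using this
  filter_upwards [h2.eventually h] with t ht
  rw [chartAt_symm_apply] at ht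
  simpa using ht.symm

/-- With `mdifferentiable_of_holAt`, this translates between differentiability on the manifold and
analyticity in the local parameter; this direction rests on the analyticity of complex
differentiable functions. -/
theorem holAt_extendFun {U : Opens (OnePoint ℂ)} (f : holomorphicFunctions U) (x : U) :
    HolAt (extendFun f.1) x := by
  have : IsManifold 𝓘(ℂ) 1 U := IsManifold.of_le (n := ω) le_top
  have h : MDifferentiableOn 𝓘(ℂ) 𝓘(ℂ) (f.1 ∘ (chartAt ℂ x).symm) (chartAt ℂ x).target :=
    (show MDifferentiable 𝓘(ℂ) 𝓘(ℂ) f.1 from f.2).comp_mdifferentiableOn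
      (mdifferentiableOn_atlas_symm (I := 𝓘(ℂ)) (chart_mem_atlas ℂ x))
  rw [mdifferentiableOn_iff_differentiableOn] at h
  have h1 := h.analyticAt ((chartAt ℂ x).open_target.mem_nhds (mem_chart_target ℂ x))
  have h2 : AnalyticAt ℂ (fun t => t + chartAt ℂ (x : OnePoint ℂ) x) 0 := by fun_prop
  refine (h1.comp_of_eq h2 (zero_add _)).congr ?_
  filter_upwards [eventually_chartAt_symm x] with t ht
  rw [← ht, extendFun_coe]
  rfl

theorem mdifferentiable_of_holAt {U : Opens (OnePoint ℂ)} {g : OnePoint ℂ → ℂ}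
    (h : ∀ x ∈ U, HolAt g x) : MDifferentiable 𝓘(ℂ) 𝓘(ℂ) fun x : U => g x := by
  have hg : ∀ x ∈ U, MDifferentiableAt 𝓘(ℂ) 𝓘(ℂ) g x := by
    intro x hx
    rw [mdifferentiableAt_iff]
    refine ⟨(h x hx).continuousAt, DifferentiableAt.differentiableWithinAt ?_⟩
    have h2 : AnalyticAt ℂ (fun z => z - chartAt ℂ x x) (chartAt ℂ x x) := by fun_prop
    refine (AnalyticAt.comp_of_eq (h x hx) h2 (sub_self _)).differentiableAt.congr_of_eventuallyEq
      (Eventually.of_forall fun z => ?_)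
    change g ((chartAt ℂ x).symm z) = g (param x (z - chartAt ℂ x x))
    rw [chartAt_symm_apply]
  exact fun x => (hg x x.2).comp x ((contMDiff_subtype_val (n := ω)).mdifferentiable (by simp) x)

/-- The restriction to `U` of a function on the sphere, holomorphic at all points of `U`. -/
def restrictHol (U : Opens (OnePoint ℂ)) (g : OnePoint ℂ → ℂ) (h : ∀ x ∈ U, HolAt g x) :
    holomorphicFunctions U := ⟨fun x => g x, mdifferentiable_of_holAt h⟩

/-- The extension of a holomorphic function is determined by its germs. -/
theorem eq_zero_of_eventually {U : Opens (OnePoint ℂ)} (f : holomorphicFunctions U)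
    (h : ∀ x ∈ U, ∀ᶠ y in 𝓝[≠] x, extendFun f.1 y = 0) : f = 0 := by
  ext x
  have := ((holAt_extendFun f x).eventuallyEq_of_nhdsNE (HolAt.const 0 x)
    (h x x.2)).self_of_nhds
  simpa using this

end RiemannSphere

/-! ### Membership of sections in a sheaf, pointwise -/

namespace RiemannSphere

theorem eventually_subtype_nhdsNE {U : Opens (OnePoint ℂ)} (x : U) {P : OnePoint ℂ → Prop} :
    (∀ᶠ y : U in 𝓝[≠] x, P y) ↔ ∀ᶠ y in 𝓝[≠] (x : OnePoint ℂ), P y := by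
  have h := U.isOpenEmbedding'.map_nhdsWithin_preimage_eq {(x : OnePoint ℂ)}ᶜ x
  have h1 : ((↑) : U → OnePoint ℂ) ⁻¹' {(x : OnePoint ℂ)}ᶜ = {x}ᶜ := by
    ext y
    simp only [Set.mem_preimage, Set.mem_compl_iff, Set.mem_singleton_iff, Subtype.ext_iff]
  rw [h1] at h
  rw [← h, eventually_map]

section Classes

variable {E : OnePoint ℂ → Type*} [∀ x, AddCommGroup (E x)] [∀ x, Module ℂ (E x)]

/-- The class over `U` of a section defined on the whole sphere. -/
def cls (U : Opens (OnePoint ℂ)) (σ : ∀ x, E x) : SectionClasses E U :=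
  (negligibleSections E U).mkQ fun x => σ x

theorem exists_eq_cls {U : Opens (OnePoint ℂ)} (c : SectionClasses E U) :
    ∃ σ : ∀ x, E x, c = cls U σ := by
  classical
  obtain ⟨s, rfl⟩ := Submodule.mkQ_surjective _ c
  refine ⟨fun x => if h : x ∈ U then s ⟨x, h⟩ else 0, ?_⟩
  unfold cls
  congr 1
  ext x
  simp

theorem cls_eq_iff {U : Opens (OnePoint ℂ)} {σ τ : ∀ x, E x} :
    cls U σ = cls U τ ↔ ∀ x ∈ U, ∀ᶠ y in 𝓝[≠] x, σ y = τ y := by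
  unfold cls
  rw [Submodule.mkQ_apply, Submodule.mkQ_apply, Submodule.Quotient.eq]
  change (∀ x : U, ∀ᶠ y : U in 𝓝[≠] x, σ y - τ y = 0) ↔ _
  simp only [sub_eq_zero, Subtype.forall]
  exact forall₂_congr fun x hx =>
    eventually_subtype_nhdsNE (⟨x, hx⟩ : U) (P := fun y => σ y = τ y)

theorem restrict_cls {U W : Opens (OnePoint ℂ)} (h : W ≤ U) (σ : ∀ x, E x) :
    SectionClasses.restrict E h (cls U σ) = cls W σ := rfl

theorem smul_cls {U : Opens (OnePoint ℂ)} (f : holomorphicFunctions U) (σ : ∀ x, E x) :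
    f • cls U σ = cls U fun y => extendFun f.1 y • σ y := by
  unfold cls
  rw [← map_smul]
  congr 1
  ext x
  change f.1 x • σ x = extendFun f.1 x • σ x
  rw [extendFun_coe]

theorem cls_zero (U : Opens (OnePoint ℂ)) : cls U (0 : ∀ x, E x) = 0 :=
  map_zero (negligibleSections E U).mkQ

theorem cls_add (U : Opens (OnePoint ℂ)) (σ τ : ∀ x, E x) : cls U (σ + τ) = cls U σ + cls U τ :=
  map_add (negligibleSections E U).mkQ _ _

theorem cls_sum {ι : Type*} (s : Finset ι) (U : Opens (OnePoint ℂ)) (σ : ι → ∀ x, E x) :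
    cls U (fun y => ∑ i ∈ s, σ i y) = ∑ i ∈ s, cls U (σ i) := by
  unfold cls
  rw [← map_sum]
  congr 1
  ext x
  simp

theorem sum_smul_cls {ι : Type*} [Fintype ι] {U : Opens (OnePoint ℂ)}
    (f : ι → holomorphicFunctions U) (σ : ι → ∀ x, E x) :
    ∑ i, f i • cls U (σ i) = cls U fun y => ∑ i, extendFun (f i).1 y • σ i y := by
  simp only [smul_cls, cls_sum]

end Classes

/-! ### Stalks of subsheaves, and frames. -/

variable {n : ℕ} {E : OnePoint ℂ → Type*} [∀ x, AddCommGroup (E x)] [∀ x, Module ℂ (E x)]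
  [TopologicalSpace (TotalSpace (Fin n → ℂ) E)] [∀ x, TopologicalSpace (E x)]
  [FiberBundle (Fin n → ℂ) E] [VectorBundle ℂ (Fin n → ℂ) E]

variable (n) in
/-- A section is meromorphic at `x`. -/
def MerAt (x : OnePoint ℂ) (σ : ∀ y, E y) : Prop :=
  MeromorphicAt (fun t => (trivializationAt (Fin n → ℂ) E x).linearMapAt ℂ (param x t)
    (σ (param x t))) 0

theorem MerAt.congr {x : OnePoint ℂ} {σ τ : ∀ y, E y} (h : MerAt n x σ)
    (hστ : ∀ᶠ y in 𝓝[≠] x, σ y = τ y) : MerAt n x τ := by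
  refine MeromorphicAt.congr h ?_
  filter_upwards [eventually_nhdsNE_iff_param.1 hστ] with t ht
  rw [ht]

theorem _root_.MeromorphicAt.comp_add_const {V : Type*} [NormedAddCommGroup V] [NormedSpace ℂ V]
    {f : ℂ → V} {a b c : ℂ} (hf : MeromorphicAt f a) (h : b + c = a) :
    MeromorphicAt (fun z => f (z + c)) b := by
  subst h
  exact MeromorphicAt.comp_analyticAt (f := f) (g := fun z => z + c) hf (by fun_prop)

theorem meromorphicAt_readInTrivialization_iff {U : Opens (OnePoint ℂ)} (σ : ∀ y, E y) (x : U) :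
    MeromorphicAt (fun z => readInTrivialization n E (fun y : U => σ y) x
      ((chartAt ℂ x).symm z)) (chartAt ℂ x x) ↔ MerAt n (x : OnePoint ℂ) σ := by
  have h0 := eventually_chartAt_symm x
  constructor
  · intro h
    refine (h.comp_add_const (zero_add (chartAt ℂ x x))).congr
      (Eventually.filter_mono nhdsWithin_le_nhds ?_)
    filter_upwards [h0] with t ht
    rw [← ht]
    rfl
  · intro h
    refine (MeromorphicAt.comp_add_const h (add_neg_cancel (chartAt ℂ (x : OnePoint ℂ) x))).congr
      (Eventually.filter_mono nhdsWithin_le_nhds ?_)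
    have h1 : ContinuousAt (fun z => z + -chartAt ℂ (x : OnePoint ℂ) x)
      (chartAt ℂ (x : OnePoint ℂ) x) := by fun_prop
    have h2 := h1.tendsto
    beta_reduce at h2
    rw [add_neg_cancel] at h2
    filter_upwards [h2.eventually h0] with z hz
    rw [neg_add_cancel_right] at hz
    rw [← hz]
    rfl

theorem cls_mem_meromorphicSections_iff {U : Opens (OnePoint ℂ)} {σ : ∀ y, E y} :
    cls U σ ∈ meromorphicSections n E U ↔ ∀ x ∈ U, MerAt n x σ := by
  constructor
  · rintro ⟨s, hs, hsσ⟩ x hx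
    obtain ⟨τ, hτ⟩ : ∃ τ : ∀ y, E y, s = fun y : U => τ y := by
      classical
      exact ⟨fun y => if h : y ∈ U then s ⟨y, h⟩ else 0, by ext y; simp⟩
    subst hτ
    exact ((meromorphicAt_readInTrivialization_iff τ (⟨x, hx⟩ : U)).1 (hs ⟨x, hx⟩)).congr
      (cls_eq_iff.1 hsσ x hx)
  · intro h
    exact ⟨_, fun x => (meromorphicAt_readInTrivialization_iff σ x).2 (h x x.2), rfl⟩

/-- The section `σ` belongs to the stalk of `F` at `x`. -/
def MemAt (F : MeromorphicSubsheaf n E) (x : OnePoint ℂ) (σ : ∀ y, E y) : Prop :=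
  ∃ W : Opens (OnePoint ℂ), x ∈ W ∧ cls W σ ∈ F.sections W

variable {F : MeromorphicSubsheaf n E}

/-- The sheaf axiom: membership is tested on stalks. The meromorphy that gluing presupposes is also
a local condition. -/
theorem cls_mem_iff {U : Opens (OnePoint ℂ)} {σ : ∀ y, E y} :
    cls U σ ∈ F.sections U ↔ ∀ x ∈ U, MemAt F x σ := by
  constructor
  · exact fun h x hx => ⟨U, hx, h⟩
  · intro h
    refine F.mem_of_locally (cls_mem_meromorphicSections_iff.2 fun x hx => ?_) fun x hx => ?_
    · obtain ⟨W, hxW, hW⟩ := h x hx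
      exact cls_mem_meromorphicSections_iff.1 (F.sections_le W hW) x hxW
    · obtain ⟨W, hxW, hW⟩ := h x hx
      refine ⟨W ⊓ U, inf_le_right, ⟨hxW, hx⟩, ?_⟩
      exact F.restrict_mem (inf_le_left : W ⊓ U ≤ W) hW

theorem MemAt.merAt {x : OnePoint ℂ} {σ : ∀ y, E y} (h : MemAt F x σ) : MerAt n x σ := by
  obtain ⟨W, hxW, hW⟩ := h
  exact cls_mem_meromorphicSections_iff.1 (F.sections_le W hW) x hxW

/-- A property which holds on a punctured neighbourhood of `x` does so at all nearby points. -/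
theorem eventually_nhdsNE_of_eventually_nhdsNE {X : Type*} [TopologicalSpace X] [T1Space X] {x : X}
    {P : X → Prop} (h : ∀ᶠ y in 𝓝[≠] x, P y) : ∀ᶠ y in 𝓝 x, ∀ᶠ z in 𝓝[≠] y, P z := by
  have h' := h
  rw [eventually_nhdsWithin_iff, ← eventually_eventually_nhds] at h
  filter_upwards [h] with y hy
  by_cases hyx : y = x
  · rwa [hyx]
  · refine Eventually.filter_mono nhdsWithin_le_nhds ?_
    filter_upwards [hy, isOpen_ne.mem_nhds hyx] with z hz hzx using hz hzx

theorem MemAt.congr {x : OnePoint ℂ} {σ τ : ∀ y, E y} (h : MemAt F x σ)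
    (hστ : ∀ᶠ y in 𝓝[≠] x, σ y = τ y) : MemAt F x τ := by
  obtain ⟨W, hxW, hW⟩ := h
  obtain ⟨t, ht, hto, hxt⟩ := eventually_nhds_iff.1 (eventually_nhdsNE_of_eventually_nhdsNE hστ)
  refine ⟨W ⊓ ⟨t, hto⟩, ⟨hxW, hxt⟩, ?_⟩
  have h1 : cls (W ⊓ ⟨t, hto⟩) σ = cls (W ⊓ ⟨t, hto⟩) τ :=
    cls_eq_iff.2 fun y hy => ht y hy.2
  rw [← h1]
  exact F.restrict_mem (inf_le_left : W ⊓ ⟨t, hto⟩ ≤ W) hW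

/-- The sections `e₁, …, eₙ` form a frame of `F` over `U`. -/
structure IsFrameOn (F : MeromorphicSubsheaf n E) (U : Opens (OnePoint ℂ)) (e : Fin n → ∀ y, E y) :
    Prop where
  linearIndependent : ∀ y ∈ U, ∀ᶠ z in 𝓝[≠] y, LinearIndependent ℂ fun i => e i z
  memAt : ∀ y ∈ U, ∀ (σ : ∀ y, E y) (g : Fin n → OnePoint ℂ → ℂ), (∀ i, HolAt (g i) y) →
    (∀ᶠ z in 𝓝[≠] y, σ z = ∑ i, g i z • e i z) → MemAt F y σ
  exists_coeff : ∀ V ≤ U, ∀ σ : ∀ y, E y, (∀ y ∈ V, MemAt F y σ) →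
    ∃ g : Fin n → OnePoint ℂ → ℂ, (∀ i, ∀ y ∈ V, HolAt (g i) y) ∧
      ∀ y ∈ V, ∀ᶠ z in 𝓝[≠] y, σ z = ∑ i, g i z • e i z

end RiemannSphere

/-! ### Local frames -/

namespace RiemannSphere

theorem holAt_coe_iff {g : OnePoint ℂ → ℂ} {a : ℂ} :
    HolAt g (a : OnePoint ℂ) ↔ AnalyticAt ℂ (fun z : ℂ => g z) a := by
  constructor
  · intro h
    have h2 : AnalyticAt ℂ (fun z => z - a) a := by fun_prop
    refine (AnalyticAt.comp_of_eq h h2 (sub_self a)).congr (Eventually.of_forall fun z => ?_)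
    simp
  · intro h
    have h2 : AnalyticAt ℂ (fun t => a + t) 0 := by fun_prop
    exact AnalyticAt.comp_of_eq (g := fun z : ℂ => g z) h h2 (add_zero a)

theorem eventually_nhds_coe {a : ℂ} {P : OnePoint ℂ → Prop} :
    (∀ᶠ y in 𝓝 (a : OnePoint ℂ), P y) ↔ ∀ᶠ z : ℂ in 𝓝 a, P (z : OnePoint ℂ) := by
  rw [OnePoint.nhds_coe_eq, eventually_map]

/-- The image of a disc in the affine line. -/
def affineDisc (a : ℂ) (r : ℝ) : Opens (OnePoint ℂ) :=
  ⟨((↑) : ℂ → OnePoint ℂ) '' Metric.ball a r,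
    OnePoint.isOpenEmbedding_coe.isOpenMap _ Metric.isOpen_ball⟩

/-- The identity theorem on a connected set. It allows linear algebra over the ring of functions on
a small disc: a singular matrix has a nonzero null vector. -/
theorem isDomain_holomorphicFunctions_affineDisc (a : ℂ) {r : ℝ} (hr : 0 < r) :
    IsDomain (holomorphicFunctions (affineDisc a r)) := by
  have ha : (a : OnePoint ℂ) ∈ affineDisc a r := ⟨a, Metric.mem_ball_self hr, rfl⟩
  have hnt : Nontrivial (holomorphicFunctions (affineDisc a r)) :=
    ⟨0, 1, fun h => zero_ne_one (congrFun (congrArg Subtype.val h) ⟨a, ha⟩)⟩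
  have hana : ∀ f : holomorphicFunctions (affineDisc a r),
      AnalyticOnNhd ℂ (fun z : ℂ => extendFun f.1 z) (Metric.ball a r) := fun f z hz =>
    holAt_coe_iff.1 (holAt_extendFun f ⟨z, z, hz, rfl⟩)
  have hzero : ∀ f : holomorphicFunctions (affineDisc a r),
      (∀ z ∈ Metric.ball a r, extendFun f.1 (z : OnePoint ℂ) = 0) → f = 0 := by
    intro f hf
    ext x
    obtain ⟨x, z, hz, rfl⟩ := x
    have := hf z hz
    rwa [extendFun_coe f.1 ⟨(z : OnePoint ℂ), z, hz, rfl⟩] at this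
  have : NoZeroDivisors (holomorphicFunctions (affineDisc a r)) := by
    refine ⟨fun {f g} hfg => ?_⟩
    refine ((hana f).eq_zero_or_eq_zero_of_mul_eq_zero (hana g) (fun z hz => ?_)
      (convex_ball a r).isPreconnected).imp (hzero f) (hzero g)
    have hz' : (z : OnePoint ℂ) ∈ affineDisc a r := ⟨z, hz, rfl⟩
    have h := congrFun (congrArg Subtype.val hfg) ⟨z, hz'⟩
    rw [extendFun_coe f.1 ⟨_, hz'⟩, extendFun_coe g.1 ⟨_, hz'⟩]
    exact h
  exact NoZeroDivisors.to_isDomain _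

/-- Evaluation at a point. -/
def evalHol {U : Opens (OnePoint ℂ)} (x : U) : holomorphicFunctions U →+* ℂ :=
  (Pi.evalRingHom (fun _ : U => ℂ) x).comp (holomorphicFunctions U).subtype

variable {n : ℕ} {E : OnePoint ℂ → Type*} [∀ x, AddCommGroup (E x)] [∀ x, Module ℂ (E x)]
  [TopologicalSpace (TotalSpace (Fin n → ℂ) E)] [∀ x, TopologicalSpace (E x)]
  [FiberBundle (Fin n → ℂ) E] [VectorBundle ℂ (Fin n → ℂ) E]

/-- The components of the sections `eᵢ` in the trivialisation at `x`. -/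
def componentMatrix (x : OnePoint ℂ) (e : Fin n → ∀ y, E y) (y : OnePoint ℂ) :
    Matrix (Fin n) (Fin n) ℂ :=
  fun i => (trivializationAt (Fin n → ℂ) E x).linearMapAt ℂ y (e i y)

theorem MerAt.component {x : OnePoint ℂ} {σ : ∀ y, E y} (h : MerAt n x σ) (k : Fin n) :
    MeromorphicAt (fun t => (trivializationAt (Fin n → ℂ) E x).linearMapAt ℂ (param x t)
      (σ (param x t)) k) 0 := by
  obtain ⟨m, hm⟩ := h
  exact ⟨m, (ContinuousLinearMap.proj (R := ℂ) (φ := fun _ : Fin n => ℂ) k).analyticAt _ |>.comp hm⟩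

/-- Meromorphic sections which are holomorphically independent over all open subsets of `U`, are
pointwise independent outside a discrete subset. -/
theorem eventually_linearIndependent {U : Opens (OnePoint ℂ)} {e : Fin n → ∀ y, E y}
    {y : OnePoint ℂ} (hy : y ∈ U) (hmer : ∀ i, MerAt n y (e i))
    (hli : ∀ W ≤ U, LinearIndependent (holomorphicFunctions W) fun i => cls W (e i)) :
    ∀ᶠ z in 𝓝[≠] y, LinearIndependent ℂ fun i => e i z := by
  have hbase : ∀ᶠ z in 𝓝[≠] y, z ∈ (trivializationAt (Fin n → ℂ) E y).baseSet :=
    Eventually.filter_mono nhdsWithin_le_nhds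
      ((trivializationAt (Fin n → ℂ) E y).open_baseSet.mem_nhds
        (mem_baseSet_trivializationAt _ _ y))
  have hentry : ∀ i k, MeromorphicAt (fun t => componentMatrix y e (param y t) i k) 0 :=
    fun i k => (hmer i).component k
  have hdet : MeromorphicAt (fun t => (componentMatrix y e (param y t)).det) 0 := by
    simp only [Matrix.det_apply']
    exact MeromorphicAt.fun_sum fun s _ =>
      (MeromorphicAt.const _ _).mul (MeromorphicAt.fun_prod fun i _ => hentry _ _)
  -- A meromorphic determinant vanishes identically or nowhere on a punctured neighbourhood. In the
  -- first case a null vector of the component matrix over a small disc is a forbidden holomorphic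
  -- relation.
  rcases hdet.eventually_eq_zero_or_eventually_ne_zero with h0 | h0
  · exfalso
    have hhol : ∀ᶠ z in 𝓝[≠] y, ∀ i k, HolAt (fun w => componentMatrix y e w i k) z := by
      rw [eventually_nhdsNE_iff_param]
      refine eventually_all.2 fun i => eventually_all.2 fun k => ?_
      filter_upwards [(hentry i k).eventually_analyticAt] with t ht
      exact holAt_param (g := fun w => componentMatrix y e w i k) ht
    have hU : ∀ᶠ z in 𝓝[≠] y, z ∈ U := Eventually.filter_mono nhdsWithin_le_nhds
      (U.isOpen.mem_nhds hy)
    have hinf : ∀ᶠ z in 𝓝[≠] y, z ≠ OnePoint.infty := by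
      by_cases hy : y = OnePoint.infty
      · subst hy
        exact self_mem_nhdsWithin
      · exact Eventually.filter_mono nhdsWithin_le_nhds (isOpen_ne.mem_nhds hy)
    have hall := hbase.and (hhol.and (hU.and (hinf.and
      (eventually_nhdsNE_iff_param (P := fun z => (componentMatrix y e z).det = 0).2 h0))))
    -- Moving to a nearby `z ≠ y` turns conditions on a punctured neighbourhood of `y` into
    -- conditions on a full neighbourhood of `z`, hence on a disc of the affine chart.
    have hall' := (eventually_eventually_nhdsWithin.2 hall).and self_mem_nhdsWithin
    obtain ⟨z, hz, hzy⟩ := hall'.exists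
    rw [isOpen_compl_singleton.nhdsWithin_eq hzy] at hz
    induction z using OnePoint.rec with
    | infty => exact hz.self_of_nhds.2.2.2.1 rfl
    | coe a =>
      obtain ⟨r, hr, hball⟩ := Metric.eventually_nhds_iff_ball.1 (eventually_nhds_coe.1 hz)
      have hdom := isDomain_holomorphicFunctions_affineDisc a hr
      have hW : ∀ w ∈ affineDisc a r, w ∈ (trivializationAt (Fin n → ℂ) E y).baseSet ∧
          (∀ i k, HolAt (fun w => componentMatrix y e w i k) w) ∧ w ∈ U ∧ w ≠ OnePoint.infty ∧
          (componentMatrix y e w).det = 0 := by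
        rintro _ ⟨z, hz, rfl⟩
        exact hball z hz
      let M : Matrix (Fin n) (Fin n) (holomorphicFunctions (affineDisc a r)) := fun i k =>
        restrictHol _ (fun w => componentMatrix y e w i k) fun w hw => (hW w hw).2.1 i k
      have hM : M.det = 0 := by
        ext w
        have h1 := RingHom.map_det (evalHol w) M
        exact h1.trans (hW w w.2).2.2.2.2
      obtain ⟨v, hv0, hv⟩ := Matrix.exists_vecMul_eq_zero_iff.2 hM
      apply hv0
      have h2 := Fintype.linearIndependent_iff.1 (hli (affineDisc a r) fun w hw => (hW w hw).2.2.1)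
        v ?_
      · exact funext h2
      rw [sum_smul_cls, ← cls_zero, cls_eq_iff]
      intro w hw
      refine Eventually.filter_mono nhdsWithin_le_nhds ?_
      filter_upwards [(affineDisc a r).isOpen.mem_nhds hw] with w hw
      have hb := (hW w hw).1
      suffices h : (trivializationAt (Fin n → ℂ) E y).linearMapAt ℂ w
          (∑ i, extendFun (v i).1 w • e i w) = 0 by
        rw [Pi.zero_apply, ← (trivializationAt (Fin n → ℂ) E y).symmₗ_linearMapAt (R := ℂ) hb
          (∑ i, extendFun (v i).1 w • e i w), h, map_zero]
      ext k
      have h3 := congrArg (evalHol ⟨w, hw⟩) (congrFun hv k)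
      simp only [Matrix.vecMul, dotProduct, map_sum, map_mul, Pi.zero_apply, map_zero] at h3
      rw [map_sum, Finset.sum_apply]
      refine Eq.trans (Finset.sum_congr rfl fun i _ => ?_) h3
      rw [map_smul, extendFun_coe (v i).1 ⟨w, hw⟩]
      rfl
  · have h0' := eventually_nhdsNE_iff_param (P := fun z => (componentMatrix y e z).det ≠ 0).2 h0
    filter_upwards [h0'] with z hz
    refine LinearIndependent.of_comp ((trivializationAt (Fin n → ℂ) E y).linearMapAt ℂ z) ?_
    exact Matrix.linearIndependent_rows_of_det_ne_zero hz

/-- The span condition over every smaller open set provides the coefficients, and independence over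
all of them provides generic pointwise independence. -/
theorem exists_isFrameOn {F : MeromorphicSubsheaf n E} (hF : F.IsLocallyFree n) (x : OnePoint ℂ) :
    ∃ (U : Opens (OnePoint ℂ)) (e : Fin n → ∀ y, E y), x ∈ U ∧ IsFrameOn F U e := by
  obtain ⟨U, c, hx, h⟩ := hF x
  choose e he using fun i => exists_eq_cls (c i)
  obtain rfl : c = fun i => cls U (e i) := funext he
  simp only [restrict_cls] at h
  have hmem : ∀ W ≤ U, ∀ i, cls W (e i) ∈ F.sections W := fun W hW i => by
    rw [← (h W hW).2]
    exact Submodule.subset_span ⟨i, rfl⟩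
  refine ⟨U, e, hx, fun y hy => ?_, fun y hy σ g hg hσ => ?_, fun V hV σ hσ => ?_⟩
  · refine eventually_linearIndependent hy (fun i => ?_) fun W hW => (h W hW).1
    exact MemAt.merAt (F := F) ⟨U, hy, hmem U le_rfl i⟩
  · have h1 := ((eventually_all.2 fun i => (hg i).eventually).and
      (eventually_nhdsNE_of_eventually_nhdsNE hσ)).and (U.isOpen.mem_nhds hy)
    obtain ⟨t, ht, hto, hyt⟩ := eventually_nhds_iff.1 h1
    refine ⟨⟨t, hto⟩, hyt, ?_⟩
    have h2 : cls ⟨t, hto⟩ σ = ∑ i, restrictHol ⟨t, hto⟩ (g i) (fun z hz => (ht z hz).1.1 i) •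
        cls ⟨t, hto⟩ (e i) := by
      rw [sum_smul_cls, cls_eq_iff]
      intro z hz
      filter_upwards [(ht z hz).1.2, mem_nhdsWithin_of_mem_nhds (hto.mem_nhds hz)] with w hw hwt
      rw [hw]
      refine Finset.sum_congr rfl fun i _ => ?_
      rw [extendFun_coe _ (⟨w, hwt⟩ : (⟨t, hto⟩ : Opens (OnePoint ℂ)))]
      rfl
    rw [h2]
    exact Submodule.sum_mem _ fun i _ => Submodule.smul_mem _ _ (hmem _ (fun z hz => (ht z hz).2) i)
  · have h1 := cls_mem_iff.2 hσ
    rw [← (h V hV).2, Submodule.mem_span_range_iff_exists_fun] at h1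
    obtain ⟨f, hf⟩ := h1
    rw [sum_smul_cls] at hf
    exact ⟨fun i => extendFun (f i).1, fun i y hy => holAt_extendFun (f i) ⟨y, hy⟩,
      cls_eq_iff.1 hf.symm⟩

end RiemannSphere

/-! ### Splitting a sheaf with a twisted frame -/

namespace RiemannSphere

theorem HolAt.det {n : ℕ} {A : OnePoint ℂ → Matrix (Fin n) (Fin n) ℂ} {x : OnePoint ℂ}
    (h : ∀ i k, HolAt (fun y => A y i k) x) : HolAt (fun y => (A y).det) x :=
  analyticAt_det (f := fun t => A (param x t)) h

/-- Cramer's rule. -/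
theorem HolAt.matrix_inv {n : ℕ} {A : OnePoint ℂ → Matrix (Fin n) (Fin n) ℂ} {x : OnePoint ℂ}
    (h : ∀ i k, HolAt (fun y => A y i k) x) (hdet : (A x).det ≠ 0) (i k : Fin n) :
    HolAt (fun y => (A y)⁻¹ i k) x := by
  have h1 : (fun y => (A y)⁻¹ i k) =
      fun y => ((A y).det)⁻¹ * ((A y).updateRow k (Pi.single i 1)).det := by
    ext y
    rw [Matrix.inv_def, Matrix.smul_apply, Matrix.adjugate_apply, Ring.inverse_eq_inv', smul_eq_mul]
  rw [h1]
  refine ((HolAt.det h).inv hdet).mul (HolAt.det fun a b => ?_)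
  by_cases ha : a = k
  · subst ha
    simpa using HolAt.const _ x
  · simpa [Matrix.updateRow_ne ha] using h a b

theorem sum_vecMul_smul {m : Type*} [Fintype m] {V : Type*} [AddCommGroup V] [Module ℂ V]
    (c : m → ℂ) (A : Matrix m m ℂ) (e : m → V) :
    ∑ i, c i • ∑ k, A i k • e k = ∑ k, Matrix.vecMul c A k • e k := by
  simp only [Finset.smul_sum, smul_smul, Matrix.vecMul, dotProduct, Finset.sum_smul]
  exact Finset.sum_comm

variable {n : ℕ} {E : OnePoint ℂ → Type*} [∀ x, AddCommGroup (E x)] [∀ x, Module ℂ (E x)]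
  [TopologicalSpace (TotalSpace (Fin n → ℂ) E)] [∀ x, TopologicalSpace (E x)]
  [FiberBundle (Fin n → ℂ) E] [VectorBundle ℂ (Fin n → ℂ) E] {F : MeromorphicSubsheaf n E}

/-- Change of frame. -/
theorem IsFrameOn.exists_of_matrix {U : Opens (OnePoint ℂ)} {e : Fin n → ∀ y, E y}
    (he : IsFrameOn F U e) {x : OnePoint ℂ} (hx : x ∈ U)
    {A : OnePoint ℂ → Matrix (Fin n) (Fin n) ℂ} (hA : ∀ i k, HolAt (fun y => A y i k) x)
    (hdet : (A x).det ≠ 0) {τ : Fin n → ∀ y, E y}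
    (hτ : ∀ᶠ z in 𝓝[≠] x, ∀ i, τ i z = ∑ k, A z i k • e k z) :
    ∃ V : Opens (OnePoint ℂ), x ∈ V ∧ IsFrameOn F V τ := by
  have h1 := ((eventually_all.2 fun i => eventually_all.2 fun k => (hA i k).eventually).and
    ((HolAt.det hA).continuousAt.eventually_ne hdet)).and
    ((eventually_nhdsNE_of_eventually_nhdsNE hτ).and (U.isOpen.mem_nhds hx))
  obtain ⟨t, ht, hto, hxt⟩ := eventually_nhds_iff.1 h1
  have htn : ∀ y ∈ t, ∀ᶠ z in 𝓝[≠] y, z ∈ t := fun y hy =>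
    mem_nhdsWithin_of_mem_nhds (hto.mem_nhds hy)
  refine ⟨⟨t, hto⟩, hxt, fun y hy => ?_, fun y hy σ g hg hσ => ?_, fun V hV σ hσ => ?_⟩
  · filter_upwards [he.linearIndependent y (ht y hy).2.2, (ht y hy).2.1, htn y hy] with z hz hτz hzt
    simp only [hτz]
    rw [Fintype.linearIndependent_iff] at hz ⊢
    intro c hc
    rw [sum_vecMul_smul] at hc
    have h2 : Matrix.vecMul c (A z) = 0 := funext (hz _ hc)
    exact congrFun (Matrix.eq_zero_of_vecMul_eq_zero (ht z hzt).1.2 h2)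
  · refine he.memAt y (ht y hy).2.2 σ (fun k z => Matrix.vecMul (fun i => g i z) (A z) k)
      (fun k => HolAt.sum Finset.univ fun i _ => (hg i).mul ((ht y hy).1.1 i k)) ?_
    filter_upwards [hσ, (ht y hy).2.1] with z hz hτz
    rw [hz, ← sum_vecMul_smul]
    simp only [hτz]
  · obtain ⟨h, hh, hσh⟩ := he.exists_coeff V (fun y hy => (ht y (hV hy)).2.2) σ hσ
    refine ⟨fun i z => Matrix.vecMul (fun k => h k z) (A z)⁻¹ i, fun i y hy =>
      HolAt.sum Finset.univ fun k _ => (hh k y hy).mul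
        (HolAt.matrix_inv (ht y (hV hy)).1.1 (ht y (hV hy)).1.2 k i), fun y hy => ?_⟩
    filter_upwards [hσh y hy, (ht y (hV hy)).2.1, htn y (hV hy)] with z hz hτz hzt
    simp only [hz, hτz]
    rw [sum_vecMul_smul, Matrix.vecMul_vecMul, Matrix.nonsing_inv_mul _ (isUnit_iff_ne_zero.2
      (ht z hzt).1.2), Matrix.vecMul_one]

/-- The sections of `F` with values generically in the subspaces `S y`. -/
def subsheafIn (F : MeromorphicSubsheaf n E) (S : ∀ y, Submodule ℂ (E y)) :
    MeromorphicSubsheaf n E where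
  sections U :=
    { carrier := {c | c ∈ F.sections U ∧
        ∃ τ : ∀ y, E y, c = cls U τ ∧ ∀ x ∈ U, ∀ᶠ y in 𝓝[≠] x, τ y ∈ S y}
      add_mem' := by
        rintro _ _ ⟨h1, σ, rfl, hσ⟩ ⟨h2, τ, rfl, hτ⟩
        refine ⟨add_mem h1 h2, σ + τ, (cls_add U σ τ).symm, fun x hx => ?_⟩
        filter_upwards [hσ x hx, hτ x hx] with y h3 h4 using add_mem h3 h4
      zero_mem' := ⟨zero_mem _, 0, (cls_zero U).symm,
        fun x _ => Eventually.of_forall fun y => zero_mem _⟩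
      smul_mem' := by
        rintro f _ ⟨h1, σ, rfl, hσ⟩
        refine ⟨Submodule.smul_mem _ f h1, _, smul_cls f σ, fun x hx => ?_⟩
        filter_upwards [hσ x hx] with y h3 using Submodule.smul_mem _ _ h3 }
  sections_le U _ hs := F.sections_le U hs.1
  restrict_mem := by
    rintro W U h _ ⟨h1, σ, rfl, hσ⟩
    exact ⟨F.restrict_mem h h1, σ, rfl, fun x hx => hσ x (h hx)⟩
  mem_of_locally := by
    intro U s hmer hs
    obtain ⟨σ, rfl⟩ := exists_eq_cls s
    refine ⟨F.mem_of_locally hmer fun x hx => ?_, σ, rfl, fun x hx => ?_⟩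
    · obtain ⟨W, h, hxW, hW⟩ := hs x hx
      exact ⟨W, h, hxW, hW.1⟩
    · obtain ⟨W, h, hxW, -, τ, hστ, hτ⟩ := hs x hx
      filter_upwards [cls_eq_iff.1 hστ x hxW, hτ x hxW] with y h1 h2
      rwa [h1]

theorem cls_mem_subsheafIn_iff {S : ∀ y, Submodule ℂ (E y)} {U : Opens (OnePoint ℂ)}
    {σ : ∀ y, E y} : cls U σ ∈ (subsheafIn F S).sections U ↔
      (∀ x ∈ U, MemAt F x σ) ∧ ∀ x ∈ U, ∀ᶠ y in 𝓝[≠] x, σ y ∈ S y := by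
  constructor
  · rintro ⟨h1, τ, hστ, hτ⟩
    refine ⟨cls_mem_iff.1 h1, fun x hx => ?_⟩
    filter_upwards [cls_eq_iff.1 hστ x hx, hτ x hx] with y h1 h2
    rwa [h1]
  · exact fun h => ⟨cls_mem_iff.2 h.1, σ, rfl, h.2⟩

theorem IsFrameOn.memAt_self {U : Opens (OnePoint ℂ)} {e : Fin n → ∀ y, E y}
    (he : IsFrameOn F U e) {x : OnePoint ℂ} (hx : x ∈ U) {g : OnePoint ℂ → ℂ} (hg : HolAt g x)
    (i : Fin n) : MemAt F x fun y => g y • e i y := by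
  classical
  refine he.memAt x hx _ (fun j => if j = i then g else 0) (fun j => ?_) ?_
  · by_cases hj : j = i
    · simpa [hj] using hg
    · rw [if_neg hj]
      exact HolAt.const 0 x
  · refine Eventually.of_forall fun z => ?_
    rw [Finset.sum_eq_single i]
    · simp
    · intro j _ hj
      simp [hj]
    · simp

/-- A sheaf with local frames proportional to a fixed tuple of sections splits. -/
theorem exists_isDirectSum (σ : Fin n → ∀ y, E y)
    (hσ : ∀ x, ∃ (U : Opens (OnePoint ℂ)) (G : Fin n → OnePoint ℂ → ℂ), x ∈ U ∧
      (∀ y ∈ U, ∀ᶠ z in 𝓝[≠] y, ∀ i, G i z ≠ 0) ∧ IsFrameOn F U fun i y => G i y • σ i y) :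
    ∃ L : Fin n → MeromorphicSubsheaf n E, (∀ i, (L i).IsLocallyFree 1) ∧ F.IsDirectSum L := by
  have hgen : ∀ x, ∀ᶠ y in 𝓝[≠] x, LinearIndependent ℂ fun i => σ i y := by
    intro x
    obtain ⟨U, G, hx, hG, hU⟩ := hσ x
    filter_upwards [hU.linearIndependent x hx, hG x hx] with y h1 h2
    have h3 := h1.units_smul fun i => (Units.mk0 (G i y) (h2 i))⁻¹
    convert h3 using 1
    ext i
    simp [Units.smul_def, smul_smul, h2 i]
  -- Each summand consists of all sections of `F` that lie generically on the line of `σ i`; near a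
  -- point it is generated by `G i • σ i`.
  refine ⟨fun i => subsheafIn F fun y => ℂ ∙ σ i y, fun i x => ?_, fun U => ⟨?_, ?_⟩⟩
  · obtain ⟨U, G, hx, hG, hU⟩ := hσ x
    refine ⟨U, fun _ => cls U fun y => G i y • σ i y, hx, fun W hW => ⟨?_, le_antisymm ?_ ?_⟩⟩
    · rw [Fintype.linearIndependent_iff]
      intro r hr k
      rw [Subsingleton.elim k 0]
      simp only [restrict_cls, Fin.sum_univ_one] at hr
      rw [smul_cls, ← cls_zero, cls_eq_iff] at hr
      refine eq_zero_of_eventually _ fun y hy => ?_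
      filter_upwards [hr y hy, hU.linearIndependent y (hW hy)] with z h1 h2
      exact (smul_eq_zero.1 h1).resolve_right (h2.ne_zero i)
    · rw [Submodule.span_le]
      rintro _ ⟨-, rfl⟩
      change cls W (fun y => G i y • σ i y) ∈ (subsheafIn F fun y => ℂ ∙ σ i y).sections W
      refine (cls_mem_subsheafIn_iff (F := F)).2 ⟨fun y hy => ?_,
        fun y hy => Eventually.of_forall fun z => ?_⟩
      · simpa using hU.memAt_self (hW hy) (HolAt.const 1 y) i
      · exact Submodule.smul_mem _ _ (Submodule.mem_span_singleton_self _)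
    · intro c hc
      obtain ⟨τ, rfl⟩ := exists_eq_cls c
      rw [cls_mem_subsheafIn_iff] at hc
      obtain ⟨g, hg, hτg⟩ := hU.exists_coeff W hW τ hc.1
      have h1 : cls W τ = restrictHol W (g i) (hg i) • cls W fun y => G i y • σ i y := by
        rw [smul_cls, cls_eq_iff]
        intro y hy
        filter_upwards [hτg y hy, hc.2 y hy, hU.linearIndependent y (hW hy), hG y (hW hy),
          mem_nhdsWithin_of_mem_nhds (W.isOpen.mem_nhds hy)] with z h1 h2 h3 h4 h5
        obtain ⟨a, ha⟩ := Submodule.mem_span_singleton.1 h2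
        rw [extendFun_coe _ (⟨z, h5⟩ : W)]
        change τ z = g i z • G i z • σ i z
        classical
        have h6 : ∑ j, (g j z - if j = i then a * (G i z)⁻¹ else 0) • G j z • σ j z = 0 := by
          simp only [sub_smul, Finset.sum_sub_distrib, ite_smul, zero_smul, Finset.sum_ite_eq',
            Finset.mem_univ, if_true]
          rw [← h1, ← ha, smul_smul, inv_mul_cancel_right₀ (h4 i), sub_self]
        have h7 := Fintype.linearIndependent_iff.1 h3 _ h6 i
        rw [if_pos rfl, sub_eq_zero] at h7
        rw [h7, smul_smul, inv_mul_cancel_right₀ (h4 i), ha]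
      rw [h1]
      exact Submodule.smul_mem _ _ (Submodule.subset_span ⟨0, rfl⟩)
  · intro i
    rw [Submodule.disjoint_def]
    intro c hc hc'
    obtain ⟨τ, rfl⟩ := exists_eq_cls c
    -- A sum of sections of the other summands takes generic values in the span of the other `σ j`,
    -- which meets the line of `σ i` only in zero at generic points.
    have h1 : ⨆ j, ⨆ (_ : j ≠ i), (subsheafIn F fun y => ℂ ∙ σ j y).sections U ≤
        (subsheafIn F fun y => Submodule.span ℂ ((fun j => σ j y) '' {i}ᶜ)).sections U := by
      refine iSup₂_le fun j hj c hc => ?_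
      obtain ⟨τ, rfl⟩ := exists_eq_cls c
      rw [cls_mem_subsheafIn_iff] at hc ⊢
      refine ⟨hc.1, fun x hx => ?_⟩
      filter_upwards [hc.2 x hx] with y hy
      refine Submodule.span_mono ?_ hy
      rw [Set.singleton_subset_iff]
      exact ⟨j, hj, rfl⟩
    have h2 := (cls_mem_subsheafIn_iff.1 (h1 hc')).2
    rw [← cls_zero, cls_eq_iff]
    intro x hx
    filter_upwards [h2 x hx, (cls_mem_subsheafIn_iff.1 hc).2 x hx, hgen x] with y h3 h4 h5
    have h6 := h5.disjoint_span_image (s := {i}) (t := {i}ᶜ) disjoint_compl_right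
    rw [Set.image_singleton] at h6
    exact Submodule.disjoint_def.1 h6 _ h4 h3
  · refine le_antisymm (iSup_le fun i c hc => hc.1) fun c hc => ?_
    obtain ⟨τ, rfl⟩ := exists_eq_cls c
    rw [cls_mem_iff] at hc
    classical
    -- The coefficients are chosen point by point. Where the `σ i` are independent they are unique,
    -- so they agree generically with the local ones `g i * G i`, and no gluing is required.
    let a : ∀ y, Fin n → ℂ := fun y =>
      if h : ∃ a : Fin n → ℂ, τ y = ∑ j, a j • σ j y then h.choose else 0
    have key : ∀ x ∈ U, (∀ᶠ y in 𝓝[≠] x, τ y = ∑ i, a y i • σ i y) ∧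
        ∀ i, MemAt F x fun y => a y i • σ i y := by
      intro x hx
      obtain ⟨V, G, hxV, hG, hV⟩ := hσ x
      obtain ⟨g, hg, hτg⟩ := hV.exists_coeff (V ⊓ U) inf_le_left τ fun y hy => hc y hy.2
      have h1 : ∀ᶠ y in 𝓝[≠] x, τ y = ∑ i, a y i • σ i y ∧ ∀ i, a y i = g i y * G i y := by
        filter_upwards [hτg x ⟨hxV, hx⟩, hgen x] with y h2 h3
        have h4 : ∃ a : Fin n → ℂ, τ y = ∑ j, a j • σ j y :=
          ⟨fun i => g i y * G i y, by simpa only [mul_smul] using h2⟩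
        have h5 : a y = h4.choose := dif_pos h4
        have h6 : τ y = ∑ j, a y j • σ j y := by
          rw [h5]
          exact h4.choose_spec
        refine ⟨h6, fun i => ?_⟩
        have h7 : ∑ j, (a y j - g j y * G j y) • σ j y = 0 := by
          simp only [sub_smul, Finset.sum_sub_distrib, mul_smul]
          rw [← h6, ← h2, sub_self]
        exact sub_eq_zero.1 (Fintype.linearIndependent_iff.1 h3 _ h7 i)
      refine ⟨h1.mono fun y hy => hy.1, fun i => ?_⟩
      refine (hV.memAt_self hxV (hg i x ⟨hxV, hx⟩) i).congr ?_
      filter_upwards [h1] with y hy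
      rw [hy.2 i, mul_smul]
    have h1 : cls U τ = ∑ i, cls U fun y => a y i • σ i y := by
      rw [← cls_sum, cls_eq_iff]
      exact fun x hx => (key x hx).1
    rw [h1]
    refine Submodule.sum_mem _ fun i _ => Submodule.mem_iSup_of_mem i ?_
    exact (cls_mem_subsheafIn_iff (F := F)).2 ⟨fun x hx => (key x hx).2 i, fun x hx =>
      Eventually.of_forall fun y =>
        Submodule.smul_mem _ _ (Submodule.mem_span_singleton_self _)⟩

end RiemannSphere

/-! ### Zeros and poles of systems of functions on a cover -/

namespace RiemannSphere

/-- A function which differs from a polynomial of degree `d` by a function tending to zero at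
infinity has a pole of order `d` there. -/
theorem analyticAt_pow_mul_comp_inv {s : ℂ → ℂ} {p : Polynomial ℂ} {c : ℂ}
    (hs : ∀ᶠ z in Bornology.cobounded ℂ, DifferentiableAt ℂ s z)
    (h : Tendsto (fun z => s z - p.eval z * c) (Bornology.cobounded ℂ) (𝓝 0)) :
    AnalyticAt ℂ (Function.update (fun t => t ^ p.natDegree * s t⁻¹) 0 (p.leadingCoeff * c)) 0 := by
  -- Removable singularity: `t ^ p.natDegree * p.eval t⁻¹` is the reversed polynomial, whose
  -- constant term is the leading coefficient of `p`; this gives the value at `0`.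
  refine Complex.analyticAt_of_differentiable_on_punctured_nhds_of_continuousAt ?_ ?_
  · filter_upwards [tendsto_inv₀_nhdsNE_zero.eventually hs, self_mem_nhdsWithin] with t ht ht0
    have ht0 : t ≠ 0 := ht0
    have h1 : DifferentiableAt ℂ (fun t => t ^ p.natDegree * s t⁻¹) t :=
      (differentiableAt_id.pow _).mul (DifferentiableAt.fun_comp' t ht (differentiableAt_inv ht0))
    refine h1.congr_of_eventuallyEq ?_
    filter_upwards [isOpen_ne.mem_nhds ht0] with u hu using Function.update_of_ne hu _ _
  · rw [continuousAt_update_same]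
    have h1 : Tendsto (fun t : ℂ => t ^ p.natDegree * (s t⁻¹ - p.eval t⁻¹ * c)) (𝓝[≠] 0)
        (𝓝 (0 ^ p.natDegree * 0)) :=
      (((continuous_pow p.natDegree).tendsto (0 : ℂ)).mono_left nhdsWithin_le_nhds).mul
        (h.comp tendsto_inv₀_nhdsNE_zero)
    have h2 : Tendsto (fun t : ℂ => p.reverse.eval t * c) (𝓝[≠] 0)
        (𝓝 (p.reverse.eval 0 * c)) :=
      ((p.reverse.continuous.mul continuous_const).tendsto 0).mono_left nhdsWithin_le_nhds
    have h3 := h1.add h2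
    rw [mul_zero, zero_add, ← Polynomial.coeff_zero_eq_eval_zero,
      Polynomial.coeff_zero_reverse] at h3
    refine h3.congr' ?_
    filter_upwards [self_mem_nhdsWithin] with t ht
    have ht : t ≠ 0 := ht
    have h4 : p.reverse.eval t = t ^ p.natDegree * p.eval t⁻¹ := by
      let _ := invertibleOfNonzero (inv_ne_zero ht)
      have h5 := Polynomial.eval₂_reverse_mul_pow (RingHom.id ℂ) t⁻¹ p
      rw [invOf_eq_inv, inv_inv, Polynomial.eval₂_id, Polynomial.eval₂_id] at h5
      rw [← h5, inv_pow, mul_comm, mul_assoc, inv_mul_cancel₀ (pow_ne_zero _ ht), mul_one]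
    rw [h4]
    ring

/-- Functions on an open cover with the same zeros on the overlaps and without zeros near infinity
have only finitely many zeros. -/
theorem exists_finset_zeros {ι : Type*} {D : ι → Set ℂ} (hD : ∀ k, IsOpen (D k))
    (hcover : ∀ z, ∃ k, z ∈ D k) {Δ : ι → ℂ → ℂ} (hΔ : ∀ k, DifferentiableOn ℂ (Δ k) (D k))
    (hrel : ∀ k l, ∀ z ∈ D k, z ∈ D l → Δ l z = 0 → Δ k z = 0)
    (hinf : ∀ᶠ z in Bornology.cobounded ℂ, ∀ k, z ∈ D k → Δ k z ≠ 0) :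
    (∀ k, ∀ z ∈ D k, ∀ᶠ w in 𝓝[≠] z, Δ k w ≠ 0) ∧
      ∃ t : Finset ℂ, ∀ k, ∀ z ∈ D k, Δ k z = 0 → z ∈ t := by
  let Z : Set ℂ := {z | ∃ k, z ∈ D k ∧ Δ k z = 0}
  have hZ : ∀ k, ∀ z ∈ D k, z ∈ Z ↔ Δ k z = 0 := fun k z hz =>
    ⟨fun ⟨l, hl, h0⟩ => hrel k l z hz hl h0, fun h0 => ⟨k, hz, h0⟩⟩
  have hdich : ∀ z, (∀ᶠ w in 𝓝 z, w ∈ Z) ∨ ∀ᶠ w in 𝓝[≠] z, w ∉ Z := by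
    intro z
    obtain ⟨k, hk⟩ := hcover z
    have hn := (hD k).mem_nhds hk
    refine (((hΔ k).analyticAt hn).eventually_eq_zero_or_eventually_ne_zero).imp (fun h => ?_)
      fun h => ?_
    · filter_upwards [h, hn] with w hw hwD using ⟨k, hwD, hw⟩
    · filter_upwards [h, mem_nhdsWithin_of_mem_nhds hn] with w hw hwD
      rwa [hZ k w hwD]
  -- Every point is either interior to the zero set or has a punctured neighbourhood free of zeros,
  -- so the interior is clopen; `ℂ` is connected and there are no zeros near infinity, so it is
  -- empty.
  have hclopen : IsClopen {z | ∀ᶠ w in 𝓝 z, w ∈ Z} := by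
    refine ⟨⟨?_⟩, isOpen_setOfPred_eventually_nhds⟩
    rw [isOpen_iff_eventually]
    intro z hz
    filter_upwards [eventually_nhdsNE_of_eventually_nhdsNE ((hdich z).resolve_left hz)] with w hw h
    obtain ⟨u, hu, hu'⟩ := (hw.and (h.filter_mono nhdsWithin_le_nhds)).exists
    exact hu hu'
  have hZinf : ∀ᶠ z in Bornology.cobounded ℂ, z ∉ Z := by
    filter_upwards [hinf] with z hz
    rintro ⟨k, hk, h0⟩
    exact hz k hk h0
  have hne : ∀ z, ∀ᶠ w in 𝓝[≠] z, w ∉ Z := by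
    intro z
    refine (hdich z).resolve_left fun h => ?_
    rcases isClopen_iff.1 hclopen with h1 | h1
    · exact (h1 ▸ h : z ∈ (∅ : Set ℂ))
    · obtain ⟨w, hw⟩ := hZinf.exists
      have h2 : w ∈ {z | ∀ᶠ w in 𝓝 z, w ∈ Z} := h1 ▸ Set.mem_univ w
      exact hw (Eventually.self_of_nhds h2)
  refine ⟨fun k z hz => ?_, ?_⟩
  · filter_upwards [hne z, mem_nhdsWithin_of_mem_nhds ((hD k).mem_nhds hz)] with w hw hwD
    exact fun h0 => hw ((hZ k w hwD).2 h0)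
  · have hbd : Bornology.IsBounded Z := by
      rw [Bornology.isBounded_def]
      exact hZinf
    obtain ⟨t, -, ht⟩ := hbd.isCompact_closure.elim_nhds_subcover
      (fun z => {w | w ≠ z → w ∉ Z}) fun z _ => eventually_nhdsWithin_iff.1 (hne z)
    refine ⟨t, fun k z hz h0 => ?_⟩
    have hzZ : z ∈ Z := ⟨k, hz, h0⟩
    obtain ⟨a, ha, haz⟩ := Set.mem_iUnion₂.1 (ht (subset_closure hzZ))
    have : z = a := by
      by_contra hza
      exact haz hza hzZ
    rwa [this]

/-- A neighbourhood of infinity and finitely many bounded sets subordinate to a given cover. -/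
theorem exists_finite_cover (U : OnePoint ℂ → Opens (OnePoint ℂ)) (hU : ∀ x, x ∈ U x) :
    ∃ (ι : Type) (_ : Fintype ι) (c : ι → OnePoint ℂ) (o : ι) (D : ι → Set ℂ),
      c o = OnePoint.infty ∧ (∀ k, IsOpen (D k)) ∧ (∀ z, ∃ k, z ∈ D k) ∧
      (∀ k ≠ o, Bornology.IsBounded (D k)) ∧ ∀ k, ∀ z ∈ D k, (z : OnePoint ℂ) ∈ U (c k) := by
  have hopen : ∀ x, IsOpen (((↑) : ℂ → OnePoint ℂ) ⁻¹' U x) := fun x =>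
    (U x).isOpen.preimage OnePoint.continuous_coe
  have hcompact : IsCompact (((↑) : ℂ → OnePoint ℂ) ⁻¹' U OnePoint.infty)ᶜ :=
    ((OnePoint.isOpen_iff_of_mem (hU OnePoint.infty)).1 (U OnePoint.infty).isOpen).2
  obtain ⟨t, -, ht⟩ := hcompact.elim_nhds_subcover
    (fun a => Metric.ball a 1 ∩ ((↑) : ℂ → OnePoint ℂ) ⁻¹' U a) fun a _ =>
      inter_mem (Metric.ball_mem_nhds a one_pos) ((hopen a).mem_nhds (hU a))
  refine ⟨Option t, inferInstance, fun k => k.elim OnePoint.infty fun a => (a : ℂ), none,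
    fun k => k.elim (((↑) : ℂ → OnePoint ℂ) ⁻¹' U OnePoint.infty) fun a =>
      Metric.ball (a : ℂ) 1 ∩ ((↑) : ℂ → OnePoint ℂ) ⁻¹' U (a : ℂ), rfl, ?_, ?_, ?_, ?_⟩
  · rintro (_ | a)
    · exact hopen _
    · exact Metric.isOpen_ball.inter (hopen _)
  · intro z
    by_cases hz : (z : OnePoint ℂ) ∈ U OnePoint.infty
    · exact ⟨none, hz⟩
    · obtain ⟨a, ha, haz⟩ := Set.mem_iUnion₂.1 (ht hz)
      exact ⟨some ⟨a, ha⟩, haz⟩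
  · rintro (_ | a) hk
    · exact absurd rfl hk
    · exact Metric.isBounded_ball.subset Set.inter_subset_left
  · rintro (_ | a) z hz
    · exact hz
    · exact hz.2

/-! ### The cocycle of transition functions. -/

variable {n : ℕ} {E : OnePoint ℂ → Type*} [∀ x, AddCommGroup (E x)] [∀ x, Module ℂ (E x)]
  [TopologicalSpace (TotalSpace (Fin n → ℂ) E)] [∀ x, TopologicalSpace (E x)]
  [FiberBundle (Fin n → ℂ) E] [VectorBundle ℂ (Fin n → ℂ) E] {F : MeromorphicSubsheaf n E}

/-- Generic independence determines the coefficients off the point, and holomorphy carries equality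
to the point itself. Hence the cocycle identities hold at every point and not only generically. -/
theorem IsFrameOn.coeff_unique {U : Opens (OnePoint ℂ)} {e : Fin n → ∀ y, E y}
    (he : IsFrameOn F U e) {x : OnePoint ℂ} (hx : x ∈ U) {g h : Fin n → OnePoint ℂ → ℂ}
    (hg : ∀ i, HolAt (g i) x) (hh : ∀ i, HolAt (h i) x)
    (hgh : ∀ᶠ z in 𝓝[≠] x, ∑ i, g i z • e i z = ∑ i, h i z • e i z) (i : Fin n) :
    g i x = h i x := by
  refine ((hg i).eventuallyEq_of_nhdsNE (hh i) ?_).self_of_nhds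
  filter_upwards [hgh, he.linearIndependent x hx] with z h1 h2
  have h3 : ∑ j, (g j z - h j z) • e j z = 0 := by
    simp only [sub_smul, Finset.sum_sub_distrib]
    rw [h1, sub_self]
  exact sub_eq_zero.1 (Fintype.linearIndependent_iff.1 h2 _ h3 i)

/-- The transition functions between local frames. -/
theorem exists_holomorphicCocycle {ι : Type*} {V : ι → Opens (OnePoint ℂ)}
    {e : ι → Fin n → ∀ y, E y} (he : ∀ k, IsFrameOn F (V k) (e k)) {D : ι → Set ℂ}
    (hDV : ∀ k, ∀ z ∈ D k, (z : OnePoint ℂ) ∈ V k) :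
    ∃ B : ι → ι → OnePoint ℂ → Matrix (Fin n) (Fin n) ℂ,
      HolomorphicCocycle D (fun k l z => B k l z) ∧
      ∀ k l, ∀ z ∈ D k, z ∈ D l → ∀ᶠ y in 𝓝[≠] (z : OnePoint ℂ), ∀ j,
        e l j y = ∑ i, B k l y i j • e k i y := by
  have h : ∀ k l j, ∃ g : Fin n → OnePoint ℂ → ℂ, (∀ i, ∀ y ∈ V k ⊓ V l, HolAt (g i) y) ∧
      ∀ y ∈ V k ⊓ V l, ∀ᶠ z in 𝓝[≠] y, e l j z = ∑ i, g i z • e k i z := fun k l j =>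
    (he k).exists_coeff (V k ⊓ V l) inf_le_left (e l j) fun y hy => by
      simpa using (he l).memAt_self hy.2 (HolAt.const 1 y) j
  choose g hg heg using h
  -- Column `j` holds the coefficients of `e l j` in the frame `e k`, so that the matrix acts on
  -- column vectors of coordinates, taking the frame `l` to the frame `k`.
  refine ⟨fun k l y => Matrix.of fun i j => g k l j i y, ⟨fun k l i j z hz => ?_, fun k z hz => ?_,
    fun k l m z hk hl hm => ?_⟩, fun k l z hk hl => ?_⟩
  · exact (holAt_coe_iff.1 (hg k l j i z ⟨hDV k z hz.1, hDV l z hz.2⟩)).differentiableAt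
      |>.differentiableWithinAt
  · ext i j
    refine (he k).coeff_unique (hDV k z hz) (g := g k k j)
      (h := fun i _ => (1 : Matrix (Fin n) (Fin n) ℂ) i j)
      (fun i => hg k k j i z ⟨hDV k z hz, hDV k z hz⟩) (fun i => HolAt.const _ _) ?_ i
    filter_upwards [heg k k j z ⟨hDV k z hz, hDV k z hz⟩] with w hw
    rw [← hw]
    simp [Matrix.one_apply]
  · ext i j
    refine (he k).coeff_unique (hDV k z hk) (g := fun i y => ∑ r, g k l r i y * g l m j r y)
      (h := g k m j) (fun i => HolAt.sum _ fun r _ => (hg k l r i z ⟨hDV k z hk, hDV l z hl⟩).mul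
        (hg l m j r z ⟨hDV l z hl, hDV m z hm⟩))
      (fun i => hg k m j i z ⟨hDV k z hk, hDV m z hm⟩) ?_ i
    filter_upwards [heg l m j z ⟨hDV l z hl, hDV m z hm⟩, heg k m j z ⟨hDV k z hk, hDV m z hm⟩,
      eventually_all.2 fun r => heg k l r z ⟨hDV k z hk, hDV l z hl⟩] with w h1 h2 h3
    rw [← h2, h1]
    simp only [h3, Finset.sum_smul, Finset.smul_sum, smul_smul]
    rw [Finset.sum_comm]
    exact Finset.sum_congr rfl fun _ _ => Finset.sum_congr rfl fun _ _ => by rw [mul_comm]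
  · exact eventually_all.2 fun j => heg k l j z ⟨hDV k z hk, hDV l z hl⟩

end RiemannSphere

/-! ### Construction of a twisted frame -/

namespace RiemannSphere

variable {n : ℕ}

theorem eventually_cobounded_mem {ι : Type*} [Finite ι] {D : ι → Set ℂ} {o : ι}
    (hbd : ∀ k ≠ o, Bornology.IsBounded (D k)) :
    ∀ᶠ z in Bornology.cobounded ℂ, ∀ k ≠ o, z ∉ D k := by
  rw [eventually_all]
  intro k
  by_cases hk : k = o
  · simp [hk]
  · filter_upwards [Bornology.isBounded_def.1 (hbd k hk)] with z hz _ using hz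

/-- A vector bundle given by a cocycle has `n` sections, independent near infinity, where they have
poles of prescribed form. -/
theorem _root_.HolomorphicCocycle.exists_matrix {ι : Type*} [Fintype ι] {D : ι → Set ℂ}
    {A : ι → ι → ℂ → Matrix (Fin n) (Fin n) ℂ} (hA : HolomorphicCocycle D A)
    (hD : ∀ k, IsOpen (D k)) (hcover : ∀ z, ∃ k, z ∈ D k) {o : ι}
    (hbd : ∀ k ≠ o, Bornology.IsBounded (D k)) :
    ∃ (S : ι → ℂ → Matrix (Fin n) (Fin n) ℂ) (d : Fin n → ℕ) (f : ℂ → Matrix (Fin n) (Fin n) ℂ),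
      (∀ k i j, DifferentiableOn ℂ (fun z => S k z i j) (D k)) ∧
      (∀ k l, ∀ z ∈ D k, z ∈ D l → S k z = S l z * (A k l z).transpose) ∧
      (∀ i j, AnalyticAt ℂ (fun t => f t i j) 0) ∧
      (∀ t ≠ 0, ∀ i j, f t i j = t ^ d i * S o t⁻¹ i j) ∧ (f 0).det ≠ 0 := by
  obtain ⟨φ, ψ, hφ, hψ, hsum, hφD, hψD, hφψ, R, hR⟩ := exists_cutoffs hD hcover o hbd
  -- One section for each standard direction, twisted by the degree of its polynomial. The matrix at
  -- infinity is then diagonal, with the nonzero leading coefficients as entries.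
  choose p hp s hs hsA hsp using fun i : Fin n =>
    hA.exists_section hD hφ hψ hsum hφD hψD hφψ hR (Pi.single i 1)
  have hDo : ∀ᶠ z in Bornology.cobounded ℂ, z ∈ D o := by
    filter_upwards [eventually_cobounded_mem hbd] with z hz
    obtain ⟨k, hk⟩ := hcover z
    by_cases hko : k = o
    · rwa [← hko]
    · exact absurd hk (hz k hko)
  refine ⟨fun k z => Matrix.of fun i j => s i k z j, fun i => (p i).natDegree,
    fun t => Matrix.of fun i j => Function.update (fun t => t ^ (p i).natDegree * s i o t⁻¹ j) 0
      ((p i).leadingCoeff * (Pi.single i 1 : Fin n → ℂ) j) t, fun k i j => ?_,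
    fun k l z hk hl => ?_, fun i j => ?_, fun t ht i j => ?_, ?_⟩
  · exact differentiableOn_pi.1 (hs i k) j
  · ext i j
    have := congrFun (hsA i k l z hk hl) j
    simp only [Matrix.mulVec, dotProduct] at this
    simp [Matrix.mul_apply, ← this, mul_comm]
  · refine analyticAt_pow_mul_comp_inv (s := fun z => s i o z j) ?_ ?_
    · filter_upwards [hDo] with z hz
      exact (differentiableOn_pi.1 (hs i o) j).differentiableAt ((hD o).mem_nhds hz)
    · exact tendsto_pi_nhds.1 (hsp i) j
  · simp [Function.update_of_ne ht]
  · have h1 : (Matrix.of fun i j => Function.update (fun t => t ^ (p i).natDegree * s i o t⁻¹ j) 0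
        ((p i).leadingCoeff * (Pi.single i 1 : Fin n → ℂ) j) 0) =
        Matrix.diagonal fun i => (p i).leadingCoeff := by
      ext i j
      by_cases hij : i = j
      · subst hij
        simp
      · simp [hij, Ne.symm hij]
    beta_reduce
    rw [h1, Matrix.det_diagonal]
    exact Finset.prod_ne_zero_iff.2 fun i _ => Polynomial.leadingCoeff_ne_zero.2 (hp i)

variable {E : OnePoint ℂ → Type*} [∀ x, AddCommGroup (E x)] [∀ x, Module ℂ (E x)]

/-- Local sections on a cover of `ℂ` which agree on the overlaps, can be glued. -/
theorem exists_glued {ι : Type*} [Fintype ι] {D : ι → Set ℂ} (hD : ∀ k, IsOpen (D k))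
    (hcover : ∀ z, ∃ k, z ∈ D k) {o : ι} (hbd : ∀ k ≠ o, Bornology.IsBounded (D k))
    (v : ι → ∀ y, E y)
    (hv : ∀ k l, ∀ z ∈ D k, z ∈ D l → ∀ᶠ y in 𝓝[≠] (z : OnePoint ℂ), v k y = v l y) :
    ∃ σ : ∀ y, E y, (∀ k, ∀ z ∈ D k, ∀ᶠ y in 𝓝[≠] (z : OnePoint ℂ), σ y = v k y) ∧
      ∀ᶠ y in 𝓝[≠] OnePoint.infty, σ y = v o y := by
  obtain ⟨φ, -, -, -, hsum, hφD, -⟩ := exists_cutoffs hD hcover o hbd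
  -- An average with weights `φ k` of vectors that generically agree where the weights are nonzero
  -- is their common value.
  refine ⟨fun y => ∑ k, φ k (coordinate y) • v k y, fun l z hl => ?_, ?_⟩
  · have h1 : ∀ᶠ y in 𝓝[≠] (z : OnePoint ℂ), ∀ k, φ k (coordinate y) • v k y =
        φ k (coordinate y) • v l y := by
      refine eventually_all.2 fun k => ?_
      by_cases hk : z ∈ D k
      · filter_upwards [hv k l z hk hl] with y hy
        rw [hy]
      · have h2 := notMem_tsupport_iff_eventuallyEq.1 fun h => hk (hφD k h)
        have h3 : ∀ᶠ y in 𝓝 (z : OnePoint ℂ), φ k (coordinate y) = 0 := eventually_nhds_coe.2 h2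
        filter_upwards [h3.filter_mono nhdsWithin_le_nhds] with y hy
        rw [hy, zero_smul, zero_smul]
    filter_upwards [h1] with y hy
    rw [Finset.sum_congr rfl fun k _ => hy k, ← Finset.sum_smul, hsum, one_smul]
  · rw [eventually_nhdsNE_iff_param]
    filter_upwards [tendsto_inv₀_nhdsNE_zero.eventually (eventually_cobounded_mem hbd),
      self_mem_nhdsWithin] with t ht ht0
    have h1 : ∀ k ≠ o, φ k t⁻¹ = 0 := fun k hk =>
      Function.notMem_support.1 fun h => ht k hk (hφD k (subset_tsupport _ h))
    have h2 : φ o t⁻¹ = 1 := by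
      rw [← hsum t⁻¹, Finset.sum_eq_single_of_mem o (Finset.mem_univ o) fun k _ hk => h1 k hk]
    rw [param_infty ht0, coordinate_coe, Finset.sum_eq_single_of_mem o (Finset.mem_univ o)
      fun k _ hk => by rw [h1 k hk, zero_smul], h2, one_smul]

/-! ### Twisted global sections and the splitting. -/

variable [TopologicalSpace (TotalSpace (Fin n → ℂ) E)] [∀ x, TopologicalSpace (E x)]
  [FiberBundle (Fin n → ℂ) E] [VectorBundle ℂ (Fin n → ℂ) E] {F : MeromorphicSubsheaf n E}

open Classical in
/-- A locally free subsheaf has global sections with twists which form a basis outside a finite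
set. -/
theorem exists_isTwistedMatrix_order_le (hF : F.IsLocallyFree n) :
    ∃ (U : OnePoint ℂ → Opens (OnePoint ℂ)) (e : OnePoint ℂ → Fin n → ∀ y, E y),
      (∀ x, x ∈ U x ∧ IsFrameOn F (U x) (e x)) ∧
      ∃ (D : Multiset (OnePoint ℂ)) (σ : Fin n → ∀ y, E y) (d : Fin n → ℤ),
        ∀ x, ∃ f, IsTwistedMatrix (e x) x σ d f ∧
          analyticOrderAt (fun t => (f t).det) 0 ≤ D.count x := by
  choose U e hU he using exists_isFrameOn hF
  obtain ⟨ι, _, c, o, D, hco, hD, hcover, hbd, hDU⟩ := exists_finite_cover U hU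
  obtain ⟨B, hB, heB⟩ := exists_holomorphicCocycle (fun k => he (c k)) hDU
  obtain ⟨S, d, f, hS, hSB, hf, hfS, hf0⟩ := hB.exists_matrix hD hcover hbd
  choose l hl using hcover
  have hglue : ∀ i, ∃ σ : ∀ y, E y,
      (∀ k, ∀ z ∈ D k, ∀ᶠ y in 𝓝[≠] (z : OnePoint ℂ),
        σ y = ∑ j, S k (coordinate y) i j • e (c k) j y) ∧
      ∀ᶠ y in 𝓝[≠] OnePoint.infty, σ y = ∑ j, S o (coordinate y) i j • e (c o) j y := by
    intro i
    refine exists_glued hD (fun z => ⟨l z, hl z⟩) hbd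
      (fun k y => ∑ j, S k (coordinate y) i j • e (c k) j y) fun k m z hk hm => ?_
    have h1 : ∀ᶠ y in 𝓝 (z : OnePoint ℂ), y ≠ OnePoint.infty ∧ coordinate y ∈ D k ∩ D m :=
      eventually_nhds_coe.2 (by
        filter_upwards [((hD k).inter (hD m)).mem_nhds ⟨hk, hm⟩] with w hw
        exact ⟨OnePoint.coe_ne_infty w, hw⟩)
    filter_upwards [heB k m z hk hm, h1.filter_mono nhdsWithin_le_nhds] with y hy hyD
    induction y using OnePoint.rec with
    | infty => exact absurd rfl hyD.1
    | coe w =>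
      rw [coordinate_coe] at hyD ⊢
      simp only [hy, hSB k m w hyD.2.1 hyD.2.2, Matrix.mul_apply, Matrix.transpose_apply,
        Finset.sum_smul, Finset.smul_sum, smul_smul]
      exact Finset.sum_comm
  choose σ hσ hσinf using hglue
  have hrel : ∀ k m, ∀ z ∈ D k, z ∈ D m → (S m z).det = 0 → (S k z).det = 0 := by
    intro k m z hk hm h0
    rw [hSB k m z hk hm, Matrix.det_mul, h0, zero_mul]
  have hSdet : ∀ k, DifferentiableOn ℂ (fun z => (S k z).det) (D k) := fun k z hz =>
    (analyticAt_det fun i j => (hS k i j).analyticAt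
      ((hD k).mem_nhds hz)).differentiableAt.differentiableWithinAt
  have hinf : ∀ᶠ z in Bornology.cobounded ℂ, ∀ k, z ∈ D k → (S k z).det ≠ 0 := by
    have h1 : ∀ᶠ t in 𝓝[≠] (0 : ℂ), (f t).det ≠ 0 :=
      ((analyticAt_det hf).continuousAt.eventually_ne hf0).filter_mono nhdsWithin_le_nhds
    filter_upwards [tendsto_inv₀_cobounded'.eventually (h1.and self_mem_nhdsWithin),
      eventually_cobounded_mem hbd] with z hz hzD k hk h0
    have hko : k = o := by
      by_contra hko
      exact hzD k hko hk
    subst hko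
    apply hz.1
    have h2 : f z⁻¹ = Matrix.of fun i j => (z⁻¹) ^ d i * S k z i j := by
      ext i j
      rw [hfS _ hz.2, inv_inv, Matrix.of_apply]
    rw [h2, Matrix.det_mul_column, h0, mul_zero]
  obtain ⟨hne, t, ht⟩ := exists_finset_zeros hD (fun z => ⟨l z, hl z⟩) hSdet hrel hinf
  -- At a finite point `a` the frame is that of a fixed piece `D (l a)` containing `a`, so the
  -- determinant there is that of `S (l a)`; the multiset below records each zero with its order in
  -- this frame.
  let c' : OnePoint ℂ → OnePoint ℂ := fun x => x.elim OnePoint.infty fun a => c (l a)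
  refine ⟨fun x => U (c' x), fun x => e (c' x), fun x => ⟨?_, he _⟩,
    ∑ a ∈ t, Multiset.replicate (analyticOrderNatAt (fun z => (S (l a) z).det) a) (a : OnePoint ℂ),
    σ, fun i => (d i : ℤ), fun x => ?_⟩
  · induction x using OnePoint.rec with
    | infty => exact hU _
    | coe a => exact hDU _ a (hl a)
  induction x using OnePoint.rec with
  | infty =>
    refine ⟨f, ⟨hf, ?_⟩, ?_⟩
    · have h1 := eventually_nhdsNE_iff_param.1 (eventually_all.2 hσinf)
      filter_upwards [h1, self_mem_nhdsWithin] with u hu hu0 i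
      rw [hu i, gauge_infty, zpow_natCast, Finset.smul_sum, hco]
      refine Finset.sum_congr rfl fun j _ => ?_
      rw [hfS u hu0, mul_smul, param_infty hu0, coordinate_coe]
      rfl
    · rw [(analyticAt_det hf).analyticOrderAt_eq_zero.2 hf0]
      exact zero_le
  | coe a =>
    have hSa : ∀ i j, AnalyticAt ℂ (fun z => S (l a) z i j) a := fun i j =>
      (hS (l a) i j).analyticAt ((hD _).mem_nhds (hl a))
    have hadd : AnalyticAt ℂ (fun t => a + t) 0 := by fun_prop
    have horder : analyticOrderAt (fun t => (S (l a) (a + t)).det) 0 =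
        analyticOrderAt (fun z => (S (l a) z).det) a := by
      have h1 := analyticOrderAt_comp_of_deriv_ne_zero
        (f := fun z => (S (l a) z).det) hadd (by simp)
      simpa [Function.comp_def] using h1
    refine ⟨fun t => S (l a) (a + t), ⟨fun i j => ?_, ?_⟩, ?_⟩
    · exact AnalyticAt.comp_of_eq (hSa i j) hadd (add_zero a)
    · have h1 := eventually_nhdsNE_iff_param.1 (eventually_all.2 fun i => hσ i (l a) a (hl a))
      filter_upwards [h1] with u hu i
      rw [hu i, gauge_coe, one_smul]
      rfl
    · rw [horder]
      have htop : analyticOrderAt (fun z => (S (l a) z).det) a ≠ ⊤ := by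
        rw [Ne, analyticOrderAt_eq_top]
        intro h
        obtain ⟨w, hw, hw'⟩ :=
          ((hne (l a) a (hl a)).and (h.filter_mono nhdsWithin_le_nhds)).exists
        exact hw hw'
      by_cases ha : a ∈ t
      · rw [← Nat.cast_analyticOrderNatAt htop, Nat.cast_le, Multiset.le_count_iff_replicate_le]
        exact Finset.single_le_sum (f := fun a : ℂ => Multiset.replicate
          (analyticOrderNatAt (fun z => (S (l a) z).det) a) (a : OnePoint ℂ))
          (fun _ _ => zero_le) ha
      · rw [(analyticAt_det hSa).analyticOrderAt_eq_zero.2 fun h0 => ha (ht _ a (hl a) h0)]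
        exact zero_le

/-- Every locally free sheaf of meromorphic sections on the sphere splits. -/
theorem exists_isDirectSum_of_isLocallyFree (hF : F.IsLocallyFree n) :
    ∃ L : Fin n → MeromorphicSubsheaf n E, (∀ i, (L i).IsLocallyFree 1) ∧ F.IsDirectSum L := by
  obtain ⟨U, e, he, D, σ₀, d₀, h₀⟩ := exists_isTwistedMatrix_order_le hF
  obtain ⟨σ, d, hσ⟩ := exists_isTwistedMatrix_det_ne_zero e D σ₀ d₀ h₀
  refine exists_isDirectSum σ fun x => ?_
  obtain ⟨f, hf, hdet⟩ := hσ x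
  -- The products `G i • σ i` are obtained from the local frame by the matrix `f`, which is
  -- invertible at `x`; hence they form a frame themselves.
  let G : Fin n → OnePoint ℂ → ℂ := fun i y => gauge x (d i) (localParam x y)
  have hG : ∀ᶠ z in 𝓝[≠] x, ∀ i, G i z ≠ 0 := by
    rw [eventually_nhdsNE_iff_param]
    filter_upwards [self_mem_nhdsWithin] with t ht i
    simpa [G] using gauge_ne_zero x (d i) ht
  have hA : ∀ i k, HolAt (fun y => f (localParam x y) i k) x := fun i k =>
    holAt_comp_localParam (hf.analyticAt i k) x
  have hx0 : localParam x x = 0 := by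
    simpa using localParam_param x 0
  obtain ⟨V, hxV, hV⟩ := (he x).2.exists_of_matrix (he x).1 hA (by rwa [hx0])
    (τ := fun i y => G i y • σ i y) (by
      rw [eventually_nhdsNE_iff_param]
      simpa [G] using hf.eq)
  obtain ⟨W, hW, hWo, hxW⟩ := eventually_nhds_iff.1 (eventually_nhdsNE_of_eventually_nhdsNE hG)
  exact ⟨V ⊓ ⟨W, hWo⟩, G, ⟨hxV, hxW⟩, fun y hy => hW y hy.2, fun y hy =>
    hV.linearIndependent y hy.1, fun y hy => hV.memAt y hy.1, fun V' hV' =>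
    hV.exists_coeff V' (hV'.trans inf_le_left)⟩

end RiemannSphere

end

theorem mainTheorem11 (n : ℕ) (E : OnePoint ℂ → Type*)
    [∀ x, AddCommGroup (E x)] [∀ x, Module ℂ (E x)]
    [TopologicalSpace (TotalSpace (Fin n → ℂ) E)] [∀ x, TopologicalSpace (E x)]
    [FiberBundle (Fin n → ℂ) E] [VectorBundle ℂ (Fin n → ℂ) E]
    [ContMDiffVectorBundle ω (Fin n → ℂ) E 𝓘(ℂ)]
    (F : MeromorphicSubsheaf n E) (hF : F.IsLocallyFree n) :
    ∃ L : Fin n → MeromorphicSubsheaf n E,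
      (∀ i, (L i).IsLocallyFree 1) ∧ F.IsDirectSum L :=
  RiemannSphere.exists_isDirectSum_of_isLocallyFree hF
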